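/- Let $F$ be a number field with ring of integers $\mathbf{Z}_F$, and let $A$ be a quaternion algebra over $F$ that is split at some infinite place of $F$. Let $\mathcal{O}$ be a maximal order in $A$. A right $\mathcal{O}$-ideal is a lattice in $A$ with right order $\mathcal{O}$; it is integral if it is contained in $\mathcal{O}$, two-sided if its left order is also $\mathcal{O}$, and principal if it is $x\mathcal{O}$ for some $x\in A^\times$. Its reduced norm $\mathrm{nrd}(I)$ is the fractional ideal of $F$ generated by the reduced norms of its elements. Let $\mathrm{Cl}_A$ be the ray class group of $F$ whose modulus is the product of the real places of $F$ that ramify in $A$. Let $\mathcal{B}$ be a finite set of primes of $\mathbf{Z}_F$ that generates $\mathrm{Cl}_A$, and let $\langle\mathcal{B}\rangle$ be the group of fractional ideals generated by $\mathcal{B}$. An integral right $\mathcal{O}$-ideal $I$ is smooth if $\mathrm{nrd}(I)\in\langle\mathcal{B}\rangle$. For a prime $\mathfrak{p}$ that splits in $A$, let $A^\times$ act through an isomorphism $A\otimes_F F_{\mathfrak p}\cong M_2(F_{\mathfrak p})$ on the Bruhat--Tits tree $\mathcal{T}_{\mathfrak p}$, whose vertices are the homothety classes of lattices in $F_{\mathfrak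 p}^2$, with its usual distance $d$. A $\mathfrak{p}$-reduction structure consists of $\mathcal{O}_0=\mathcal{O}$, the left order $\mathcal{O}_1$ of an integral right $\mathcal{O}$-ideal of norm $\mathfrak{p}$, the vertices $P_0,P_1$ fixed by $\mathcal{O}_0^\times,\mathcal{O}_1^\times$ respectively, and, for each $b\in\{0,1\}$ and each vertex $P$ with $d(P_b,P)=1$, an element $g\in\mathcal{O}_b^\times$ such that $gP=P_{1-b}$. A G-reduction structure consists of a $\mathfrak{p}$-reduction structure for each $\mathfrak{p}\in\mathcal{B}$ that splits in $A$, a finite set $X\subset\mathcal{O}\cap A^\times$ whose reduced norms generate ideals in $\langle\mathcal{B}\rangle$, and a map $\phi:\mathrm{Cl}_A\to\langle\mathcal{B}\rangle$ with $\phi(1)=\mathbf{Z}_F$ that lifts an isomorphism $\mathrm{Cl}_A\to\langle\mathcal{B}\rangle/\langle\mathrm{nrd}(X)\rangle$, namely the one that sends the class of each $\mathfrak{a}\in\langle\mathcal{B}\rangle$ to the class of $\mathfrak{a}$. $\mathtt{PReduce}(I,\mathfrak{p})$ is the following algorithm. Let $r$ be the largest integer such that $I\subset\mathcal{O}\mathfrak{p}^r$;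 set $J\leftarrow I\mathfrak{p}^{-r}$, $k\leftarrow v_{\mathfrak p}(\mathrm{nrd}(J))$, $c\leftarrow 1$, $b\leftarrow 0$; choose $x\in I$ such that $I_{\mathfrak p}=x\mathcal{O}_{\mathfrak p}$ and set $Q\leftarrow xP_0$. Repeat the following until $k<2$: let $P$ be the vertex at distance $1$ from $P_b$ in the segment $P_bQ$; let $g\in\mathcal{O}_b^\times$ be the element of the reduction structure with $gP=P_{1-b}$; replace $(c,J,Q)$ by $(gc,gJ,gQ)$; if $b=1$, set $J\leftarrow J\mathfrak{p}^{-1}$, $r\leftarrow r+1$, $k\leftarrow k-2$; set $b\leftarrow 1-b$. Return $(J,c,r)$. $\mathtt{GReduce}(I)$ is the following algorithm. Its input is a smooth integral right $\mathcal{O}$-ideal $I$, together with a G-reduction structure. (1) Set $\mathfrak{a}=\mathrm{nrd}(I)$ and let $\mathfrak{b}$ be the image under $\phi$ of the class of $\mathfrak{a}$. Choose $e\in\mathbf{Z}^X$ such that $\mathrm{nrd}(y)\mathfrak{a}=\mathfrak{b}$, where $y=\prod_{x\in X}x^{e_x}$, with the products over $X$ taken in some fixed order. Set $c\leftarrow\prod_{x\in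 X} x^{e_x\bmod 2}$ and $f\leftarrow\prod_{x\in X}\mathrm{nrd}(x)^{\lfloor e_x/2\rfloor}$. (2) Set $J\leftarrow cI$, let $\mathfrak{A}$ be the two-sided ideal generated by $J$, and set $J\leftarrow J\mathfrak{A}^{-1}$ and $\mathfrak{A}\leftarrow f\mathfrak{A}$. (3) For each $\mathfrak{p}\in\mathcal{B}$ that divides $\mathrm{nrd}(J)$ and splits in $A$, in any order: let $(J,c',r)$ be the output of $\mathtt{PReduce}(J,\mathfrak{p})$ and set $c\leftarrow c'c$ and $\mathfrak{A}\leftarrow\mathfrak{p}^r\mathfrak{A}$. (4) Return $J$, $cf$ and $\mathfrak{A}$. Then $\mathtt{GReduce}$ is correct: for every smooth integral right $\mathcal{O}$-ideal $I$ and every G-reduction structure, and whatever choices are made, each step can be carried out, the algorithm terminates, and its output $(J,c,\mathfrak{A})$ consists of an integral right $\mathcal{O}$-ideal $J$, an element $c\in A^\times$ and a two-sided $\mathcal{O}$-ideal $\mathfrak{A}$ such that $cI=J\mathfrak{A}$; moreover, $I$ is principal if and only if $J=\mathcal{O}$ and $\mathfrak{A}=\mathcal{O}$. -/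

import Mathlib

open scoped NumberField nonZeroDivisors TensorProduct
open IsDedekindDomain NumberField

noncomputable section

namespace QuatIdeal

/-! ### The Bruhat-Tits tree of a discretely valued field -/

section BruhatTits

variable (R K : Type*) [CommRing R] [Field K] [Algebra R K]

/-- Lattices in `K ^ 2`: finitely generated `R`-submodules that span `K ^ 2`. -/
abbrev BTLattice : Type _ :=
  {L : Submodule R (Fin 2 → K) //
    L.FG ∧ Submodule.span K (L : Set (Fin 2 → K)) = ⊤}

variable {R K}

/-- The lattice `g L`. -/
def BTLattice.act (g : GL (Fin 2) K) (L : BTLattice R K) : BTLattice R K :=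
  ⟨L.1.map ((Matrix.toLin' (g : Matrix (Fin 2) (Fin 2) K)).restrictScalars R), by
    refine ⟨L.2.1.map _, ?_⟩
    have hs : Function.Surjective (Matrix.toLin' (g : Matrix (Fin 2) (Fin 2) K)) := by
      intro v
      refine ⟨Matrix.toLin' ((g⁻¹ : GL (Fin 2) K) : Matrix (Fin 2) (Fin 2) K) v, ?_⟩
      rw [← LinearMap.comp_apply, ← Matrix.toLin'_mul, ← Units.val_mul, mul_inv_cancel]
      simp
    have h := Submodule.span_image (R := K) (s := (L.1 : Set (Fin 2 → K)))
      (Matrix.toLin' (g : Matrix (Fin 2) (Fin 2) K))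
    rw [L.2.2, Submodule.map_top, LinearMap.range_eq_top.2 hs] at h
    simpa using h⟩

/-- Homothety of lattices: `L' = u L` for some nonzero scalar `u`. -/
def homothetic (R K : Type*) [CommRing R] [Field K] [Algebra R K] : Setoid (BTLattice R K) where
  r L L' := ∃ u : Kˣ, (L'.1 : Set (Fin 2 → K)) = (fun v => (u : K) • v) '' (L.1 : Set (Fin 2 → K))
  iseqv :=
    { refl := fun L => ⟨1, by simp⟩
      symm := by
        rintro L L' ⟨u, hu⟩
        refine ⟨u⁻¹, ?_⟩
        rw [hu, Set.image_image]
        simp [smul_smul]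
      trans := by
        rintro L L' L'' ⟨u, hu⟩ ⟨w, hw⟩
        refine ⟨w * u, ?_⟩
        rw [hw, hu, Set.image_image]
        simp [smul_smul] }

variable (R K) in
/-- Vertices of the Bruhat-Tits tree: homothety classes of lattices in `K ^ 2`. -/
def BTVertex : Type _ := Quotient (homothetic R K)

/-- The action of `GL₂(K)` on the vertices. -/
def BTVertex.act (g : GL (Fin 2) K) : BTVertex R K → BTVertex R K :=
  Quotient.map (BTLattice.act g) (by
    rintro L L' ⟨u, hu⟩
    refine ⟨u, ?_⟩
    simp only [BTLattice.act, Submodule.map_coe, hu, Set.image_image]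
    simp)

/-- The distance `d(P, Q)` in the tree: the integer `|m - n|`, where `L`, `L'` are lattices in the
classes `P`, `Q` with bases `(e₀, e₁)` and `(ϖ ^ m e₀, ϖ ^ n e₁)` respectively.  Over a discrete
valuation ring such bases exist and all give the same integer. -/
def BTVertex.dist (P Q : BTVertex R K) : ℕ :=
  sInf {d : ℕ | ∃ (L L' : BTLattice R K) (ϖ : R) (e : Module.Basis (Fin 2) K (Fin 2 → K)) (m n : ℤ),
    Quotient.mk (homothetic R K) L = P ∧ Quotient.mk (homothetic R K) L' = Q ∧ Irreducible ϖ ∧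
    L.1 = Submodule.span R {e 0, e 1} ∧
    L'.1 = Submodule.span R {algebraMap R K ϖ ^ m • e 0, algebraMap R K ϖ ^ n • e 1} ∧
    d = (m - n).natAbs}

end BruhatTits

/-! ### Quaternion algebras, lattices and orders -/

variable {F : Type*} [Field F] [NumberField F]

/-- The quaternion algebra over `F` with generators `i`, `j` such that `i² = a`, `j² = b`
and `ij = -ji` (with `a`, `b` nonzero). -/
abbrev Quat (a b : F) : Type _ := QuaternionAlgebra F a 0 b

variable {a b : F}

/-- Mathlib's structure of `𝓞 F`-algebra, which instance search does not find unaided. -/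
instance instAlgebraQuat (a b : F) : Algebra (𝓞 F) (Quat a b) :=
  QuaternionAlgebra.instAlgebra

/-- The reduced norm `x ↦ x x̄`. -/
def nrd : Quat a b →* F where
  toFun x := (x * star x).re
  map_one' := by simp
  map_mul' x y := by
    simp
    ring

/-- The reduced norm on invertible elements. -/
def nrdU : (Quat a b)ˣ →* Fˣ := Units.map nrd

/-- `A ⊗ K` is isomorphic to `M₂(K)`, where `K` is the completion of `F` at some place. -/
def SplitsOver (a b : F) (K : Type*) [Field K] [Algebra F K] : Prop :=
  Nonempty ((K ⊗[F] Quat a b) ≃ₐ[K] Matrix (Fin 2) (Fin 2) K)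

/-- The prime `p` splits in the algebra. -/
def SplitsAt (a b : F) (p : HeightOneSpectrum (𝓞 F)) : Prop :=
  SplitsOver a b (p.adicCompletion F)

/-- The Eichler condition: the algebra is split at some infinite place (it is indefinite). -/
def EichlerCondition (a b : F) : Prop :=
  ∃ w : InfinitePlace F, SplitsOver a b w.Completion

/-- The product `c I`. -/
def lmul (c : Quat a b) (I : Submodule (𝓞 F) (Quat a b)) : Submodule (𝓞 F) (Quat a b) :=
  I.map (LinearMap.mulLeft (𝓞 F) c)

/-- The product `𝔞 I` with a fractional ideal `𝔞` of `F`. -/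
def scale (𝔞 : FractionalIdeal (𝓞 F)⁰ F) (I : Submodule (𝓞 F) (Quat a b)) :
    Submodule (𝓞 F) (Quat a b) :=
  (𝔞 : Submodule (𝓞 F) F).map (IsScalarTower.toAlgHom (𝓞 F) F (Quat a b)).toLinearMap * I

/-- The right order `{x | I x ⊆ I}`. -/
def rightOrder (I : Submodule (𝓞 F) (Quat a b)) : Subalgebra (𝓞 F) (Quat a b) where
  carrier := {x | ∀ y ∈ I, y * x ∈ I}
  mul_mem' := by
    intro x x' hx hx' y hy
    rw [← mul_assoc]
    exact hx' _ (hx _ hy)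
  add_mem' := by
    intro x x' hx hx' y hy
    rw [mul_add]
    exact I.add_mem (hx _ hy) (hx' _ hy)
  algebraMap_mem' := by
    intro r y hy
    rw [← Algebra.commutes, ← Algebra.smul_def]
    exact I.smul_mem r hy

/-- The left order `{x | x I ⊆ I}`. -/
def leftOrder (I : Submodule (𝓞 F) (Quat a b)) : Subalgebra (𝓞 F) (Quat a b) where
  carrier := {x | ∀ y ∈ I, x * y ∈ I}
  mul_mem' := by
    intro x x' hx hx' y hy
    rw [mul_assoc]
    exact hx _ (hx' _ hy)
  add_mem' := by
    intro x x' hx hx' y hy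
    rw [add_mul]
    exact I.add_mem (hx _ hy) (hx' _ hy)
  algebraMap_mem' := by
    intro r y hy
    rw [← Algebra.smul_def]
    exact I.smul_mem r hy

/-- Orders of the algebra: subrings that are lattices. -/
def IsOrder (O : Subalgebra (𝓞 F) (Quat a b)) : Prop :=
  Submodule.IsLattice F (Subalgebra.toSubmodule O)

/-- Maximal orders. -/
def IsMaximalOrder (O : Subalgebra (𝓞 F) (Quat a b)) : Prop :=
  IsOrder O ∧ ∀ O' : Subalgebra (𝓞 F) (Quat a b), IsOrder O' → O ≤ O' → O' = O

/-- Right `O`-ideals: lattices with right order `O`. -/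
def IsRightIdeal (O : Subalgebra (𝓞 F) (Quat a b)) (I : Submodule (𝓞 F) (Quat a b)) : Prop :=
  Submodule.IsLattice F I ∧ rightOrder I = O

/-- Two-sided `O`-ideals: lattices with left order and right order `O`. -/
def IsTwoSidedIdeal (O : Subalgebra (𝓞 F) (Quat a b)) (I : Submodule (𝓞 F) (Quat a b)) : Prop :=
  IsRightIdeal O I ∧ leftOrder I = O

/-- `I` is integral: it is contained in `O`. -/
def IsIntegral (O : Subalgebra (𝓞 F) (Quat a b)) (I : Submodule (𝓞 F) (Quat a b)) : Prop :=
  I ≤ Subalgebra.toSubmodule O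

/-- `I` is principal: it is equivalent to the unit ideal, that is `I = x O` for an invertible
element `x` of the algebra. -/
def IsPrincipal (O : Subalgebra (𝓞 F) (Quat a b)) (I : Submodule (𝓞 F) (Quat a b)) : Prop :=
  ∃ x : (Quat a b)ˣ, lmul (x : Quat a b) (Subalgebra.toSubmodule O) = I

/-- The inverse `{x | x I ⊆ O}`. -/
def idealInv (O : Subalgebra (𝓞 F) (Quat a b)) (I : Submodule (𝓞 F) (Quat a b)) :
    Submodule (𝓞 F) (Quat a b) where
  carrier := {x | ∀ y ∈ I, x * y ∈ O}
  zero_mem' := by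
    intro y _
    rw [zero_mul]
    exact O.zero_mem
  add_mem' := by
    intro x x' hx hx' y hy
    rw [add_mul]
    exact O.add_mem (hx _ hy) (hx' _ hy)
  smul_mem' := by
    intro r x hx y hy
    rw [smul_mul_assoc]
    exact O.smul_mem (hx _ hy) r

/-- The two-sided `O`-ideal generated by `I`: the lattice `O I O`. -/
def twoSidedClosure (O : Subalgebra (𝓞 F) (Quat a b)) (I : Submodule (𝓞 F) (Quat a b)) :
    Submodule (𝓞 F) (Quat a b) :=
  Subalgebra.toSubmodule O * I * Subalgebra.toSubmodule O

/-- The `𝓞 F`-module generated by the reduced norms of the elements of `I`. -/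
def nrdModule (I : Submodule (𝓞 F) (Quat a b)) : Submodule (𝓞 F) F :=
  Submodule.span (𝓞 F) (nrd '' (I : Set (Quat a b)))

theorem isFractional_nrdModule {I : Submodule (𝓞 F) (Quat a b)} (hI : I.FG) :
    IsFractional (𝓞 F)⁰ (nrdModule I) := by
  have hr : ∀ r : 𝓞 F, algebraMap (𝓞 F) (Quat a b) r = ⟨algebraMap (𝓞 F) F r, 0, 0, 0⟩ :=
    fun _ => rfl
  let B : Quat a b →ₗ[𝓞 F] Quat a b →ₗ[𝓞 F] F :=
    LinearMap.mk₂ (𝓞 F) (fun x y => (x * star y).re)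
      (by intros; simp; ring) (by intros; simp [Algebra.smul_def, hr]; ring)
      (by intros; simp; ring) (by intros; simp [Algebra.smul_def, hr]; ring)
  have hfg : (Submodule.map₂ B I I).FG := Submodule.FG.map₂ B hI hI
  have hle : nrdModule I ≤ Submodule.map₂ B I I := by
    refine Submodule.span_le.2 ?_
    rintro _ ⟨x, hx, rfl⟩
    exact Submodule.apply_mem_map₂ B hx hx
  have := FractionalIdeal.isFractional_of_fg (S := (𝓞 F)⁰) (P := F) hfg
  obtain ⟨d, hd, h⟩ := this
  exact ⟨d, hd, fun y hy => h y (hle hy)⟩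

open Classical in
/-- The reduced norm of a lattice, as a fractional ideal of `F`.  (By `isFractional_nrdModule` the
second case never occurs for a lattice.) -/
def nrdIdeal (I : Submodule (𝓞 F) (Quat a b)) : FractionalIdeal (𝓞 F)⁰ F :=
  if h : IsFractional (𝓞 F)⁰ (nrdModule I) then ⟨nrdModule I, h⟩ else 0

/-- The valuation `v_p(nrd(I))`. -/
def vnrd (p : HeightOneSpectrum (𝓞 F)) (I : Submodule (𝓞 F) (Quat a b)) : ℤ :=
  FractionalIdeal.count F p (nrdIdeal I)

/-! ### Ray class group and factor base -/

/-- The group of elements of `Fˣ` that are positive at all real places of `F` that ramify in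
the algebra. -/
def positiveUnits (a b : F) : Subgroup Fˣ where
  carrier := {x | ∀ (w : InfinitePlace F) (hw : w.IsReal), ¬ SplitsOver a b w.Completion →
    0 < InfinitePlace.embedding_of_isReal hw (x : F)}
  one_mem' := by
    intro w hw _
    simp
  mul_mem' := by
    intro x y hx hy w hw hs
    rw [Units.val_mul, map_mul]
    exact mul_pos (hx w hw hs) (hy w hw hs)
  inv_mem' := by
    intro x hx w hw hs
    rw [Units.val_inv_eq_inv_val, map_inv₀]
    exact inv_pos.2 (hx w hw hs)

/-- The ray class group of `F` whose modulus is the product of the real places that ramify in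
the algebra. -/
abbrev RayClassGroup (a b : F) : Type _ :=
  (FractionalIdeal (𝓞 F)⁰ F)ˣ ⧸ (positiveUnits a b).map (toPrincipalIdeal (𝓞 F) F)

/-- The class of a fractional ideal in the ray class group. -/
def rayClass (a b : F) : (FractionalIdeal (𝓞 F)⁰ F)ˣ →* RayClassGroup a b :=
  QuotientGroup.mk' _

/-- The group generated by the primes in `B`, that is the group of `B`-smooth fractional ideals. -/
def smoothGroup (B : Finset (HeightOneSpectrum (𝓞 F))) :
    Subgroup (FractionalIdeal (𝓞 F)⁰ F)ˣ :=
  Subgroup.closure {𝔞 | ∃ p ∈ B, (𝔞 : FractionalIdeal (𝓞 F)⁰ F) =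
    ((p.asIdeal : Ideal (𝓞 F)) : FractionalIdeal (𝓞 F)⁰ F)}

/-- `B` is a factor base: its primes generate the ray class group. -/
def IsFactorBase (a b : F) (B : Finset (HeightOneSpectrum (𝓞 F))) : Prop :=
  (smoothGroup B).map (rayClass a b) = ⊤

/-- An integral right `O`-ideal is `B`-smooth if its reduced norm is. -/
def IsSmooth (B : Finset (HeightOneSpectrum (𝓞 F))) (I : Submodule (𝓞 F) (Quat a b)) : Prop :=
  ∃ 𝔞 ∈ smoothGroup B, (𝔞 : FractionalIdeal (𝓞 F)⁰ F) = nrdIdeal I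

/-- The subgroup generated by the principal ideals `nrd(x)`, for `x` in `X`. -/
def nrdGroup (X : Finset (Quat a b)ˣ) : Subgroup (FractionalIdeal (𝓞 F)⁰ F)ˣ :=
  Subgroup.closure {𝔞 | ∃ x ∈ X, 𝔞 = toPrincipalIdeal (𝓞 F) F (nrdU x)}

/-! ### Reduction structures -/

/-- The completion `I_p`, as a submodule of the algebra `A ⊗ F_p`. -/
def completeAt (p : HeightOneSpectrum (𝓞 F)) (I : Submodule (𝓞 F) (Quat a b)) :
    Submodule (p.adicCompletionIntegers F) (p.adicCompletion F ⊗[F] Quat a b) :=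
  Submodule.span (p.adicCompletionIntegers F)
    ((fun x : Quat a b => (1 : p.adicCompletion F) ⊗ₜ[F] x) '' (I : Set (Quat a b)))

/-- The Bruhat-Tits tree at `p`. -/
abbrev Tree (p : HeightOneSpectrum (𝓞 F)) : Type _ :=
  BTVertex (p.adicCompletionIntegers F) (p.adicCompletion F)

/-- The action of the invertible elements of the algebra on the Bruhat-Tits tree at `p` through an
isomorphism `A ⊗ F_p ≃ M₂(F_p)`. -/
def treeAct {p : HeightOneSpectrum (𝓞 F)}
    (ι : (p.adicCompletion F ⊗[F] Quat a b) ≃ₐ[p.adicCompletion F]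
      Matrix (Fin 2) (Fin 2) (p.adicCompletion F))
    (x : (Quat a b)ˣ) (P : Tree p) : Tree p :=
  P.act (Units.map ((ι : (p.adicCompletion F ⊗[F] Quat a b) →*
      Matrix (Fin 2) (Fin 2) (p.adicCompletion F)).comp
    ((Algebra.TensorProduct.includeRight :
      Quat a b →ₐ[F] p.adicCompletion F ⊗[F] Quat a b) :
        Quat a b →* p.adicCompletion F ⊗[F] Quat a b)) x)

/-- `x` is a unit of the order `O`. -/
def IsUnitOf (O : Subalgebra (𝓞 F) (Quat a b)) (x : (Quat a b)ˣ) : Prop :=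
  (x : Quat a b) ∈ O ∧ ((x⁻¹ : (Quat a b)ˣ) : Quat a b) ∈ O

/-- A `p`-reduction structure, for a prime `p` that splits in the algebra, together with the
splitting at `p` through which the algebra acts on the tree at `p`. -/
structure PReductionStructure (O : Subalgebra (𝓞 F) (Quat a b))
    (p : HeightOneSpectrum (𝓞 F)) where
  /-- The fixed splitting at `p`. -/
  ι : (p.adicCompletion F ⊗[F] Quat a b) ≃ₐ[p.adicCompletion F]
    Matrix (Fin 2) (Fin 2) (p.adicCompletion F)
  /-- The orders `O₀ = O` and `O₁`. -/
  ord : Fin 2 → Subalgebra (𝓞 F) (Quat a b)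
  ord_zero : ord 0 = O
  ord_one : ∃ I, IsRightIdeal O I ∧ IsIntegral O I ∧
    nrdIdeal I = ((p.asIdeal : Ideal (𝓞 F)) : FractionalIdeal (𝓞 F)⁰ F) ∧ ord 1 = leftOrder I
  /-- The vertices `P₀` and `P₁`. -/
  vert : Fin 2 → Tree p
  vert_fixed : ∀ i x, IsUnitOf (ord i) x → treeAct ι x (vert i) = vert i
  /-- The elements `g`: for each vertex `P` at distance `1` from `P_i`, a unit of `O_i` that sends
  `P` to `P_{1-i}`. -/
  g : ∀ (i : Fin 2) (P : Tree p), (vert i).dist P = 1 → (Quat a b)ˣ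
  g_unit : ∀ i P h, IsUnitOf (ord i) (g i P h)
  g_act : ∀ i P h, treeAct ι (g i P h) P = vert (1 - i)

/-- A G-reduction structure. -/
structure GReductionStructure (O : Subalgebra (𝓞 F) (Quat a b))
    (B : Finset (HeightOneSpectrum (𝓞 F))) where
  /-- A `p`-reduction structure for each `p` in `B` that splits in the algebra. -/
  pred : ∀ p : HeightOneSpectrum (𝓞 F), p ∈ B → SplitsAt a b p → PReductionStructure O p
  /-- The relations. -/
  X : Finset (Quat a b)ˣ
  X_mem : ∀ x ∈ X, (x : Quat a b) ∈ O
  X_smooth : nrdGroup X ≤ smoothGroup B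
  φ : RayClassGroup a b → smoothGroup B
  /-- `φ` lifts an isomorphism from the ray class group onto the quotient of the group of smooth
  ideals by the norms of the relations; this isomorphism sends the class of a smooth ideal `𝔞` to
  `𝔞` modulo the norms of the relations. -/
  φ_lift : ∃ ψ : RayClassGroup a b ≃* smoothGroup B ⧸ (nrdGroup X).subgroupOf (smoothGroup B),
    (∀ 𝔞 : smoothGroup B, ψ (rayClass a b 𝔞) = QuotientGroup.mk 𝔞) ∧
    ∀ C, QuotientGroup.mk (φ C) = ψ C
  φ_one : φ 1 = 1

/-! ### The algorithms

An algorithm is a transition system.  A step is nondeterministic where the algorithm leaves a choice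
open, or where it calls a routine of which only the specification matters. -/

/-- The variables of the local reduction algorithm. -/
structure PState (a b : F) (p : HeightOneSpectrum (𝓞 F)) where
  c : (Quat a b)ˣ
  J : Submodule (𝓞 F) (Quat a b)
  Q : Tree p
  i : Fin 2
  k : ℤ
  r : ℤ

section PReduce

variable {O : Subalgebra (𝓞 F) (Quat a b)} {p : HeightOneSpectrum (𝓞 F)}

/-- The part of `PReduce(I, p)` before the loop.  Here `r` is the largest integer such that
`I ⊆ O p ^ r`, and `x` is a local generator: an element of `I` such that `I_p = x O_p`. -/
inductive PInit (S : PReductionStructure O p) (I : Submodule (𝓞 F) (Quat a b)) :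
    PState a b p → Prop
  | mk (r : ℤ) (x : (Quat a b)ˣ)
      (hr : IsGreatest {n : ℤ | I ≤ scale (((p.asIdeal : Ideal (𝓞 F)) :
        FractionalIdeal (𝓞 F)⁰ F) ^ n) (Subalgebra.toSubmodule O)} r)
      (hx : (x : Quat a b) ∈ I)
      (hxp : completeAt p I = completeAt p (lmul (x : Quat a b) (Subalgebra.toSubmodule O))) :
      PInit S I
        { c := 1
          J := scale (((p.asIdeal : Ideal (𝓞 F)) : FractionalIdeal (𝓞 F)⁰ F) ^ (-r)) I
          Q := treeAct S.ι x (S.vert 0)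
          i := 0
          k := vnrd p
            (scale (((p.asIdeal : Ideal (𝓞 F)) : FractionalIdeal (𝓞 F)⁰ F) ^ (-r)) I)
          r := r }

/-- One execution of the body of the loop of `PReduce`: `P` is the vertex at distance `1` from
`P_i` in the segment `P_i Q`, and `(c, J, Q)` is multiplied on the left by the element `g` of the
reduction structure that sends `P` to `P_{1-i}`. -/
inductive PBody (S : PReductionStructure O p) : PState a b p → PState a b p → Prop
  | mk (s : PState a b p) (P : Tree p) (hP : (S.vert s.i).dist P = 1)
      (hQ : (S.vert s.i).dist P + P.dist s.Q = (S.vert s.i).dist s.Q) :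
      PBody S s
        { c := S.g s.i P hP * s.c
          J := if s.i = 1 then
              scale (((p.asIdeal : Ideal (𝓞 F)) : FractionalIdeal (𝓞 F)⁰ F) ^ (-1 : ℤ))
                (lmul (S.g s.i P hP : Quat a b) s.J)
            else lmul (S.g s.i P hP : Quat a b) s.J
          Q := treeAct S.ι (S.g s.i P hP) s.Q
          i := 1 - s.i
          k := if s.i = 1 then s.k - 2 else s.k
          r := if s.i = 1 then s.r + 1 else s.r }

end PReduce

section GReduce

variable {O : Subalgebra (𝓞 F) (Quat a b)} {B : Finset (HeightOneSpectrum (𝓞 F))}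

/-- The primes of the factor base that split in the algebra. -/
abbrev SplitPrime (a b : F) (B : Finset (HeightOneSpectrum (𝓞 F))) : Type _ :=
  {p : HeightOneSpectrum (𝓞 F) // p ∈ B ∧ SplitsAt a b p}

/-- The configurations of `GReduce`. -/
inductive GState (a b : F) (B : Finset (HeightOneSpectrum (𝓞 F)))
  /-- The start, with input `I`. -/
  | start (I : Submodule (𝓞 F) (Quat a b))
  /-- The head of the `for` loop, with the set `T` of the primes that have not been treated. -/
  | loop (J : Submodule (𝓞 F) (Quat a b)) (c : (Quat a b)ˣ) (f : Fˣ)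
      (𝔄 : Submodule (𝓞 F) (Quat a b)) (T : Set (SplitPrime a b B))
  /-- The head of the `repeat` loop in the call of `PReduce` for the prime `p`. -/
  | inner (c : (Quat a b)ˣ) (f : Fˣ) (𝔄 : Submodule (𝓞 F) (Quat a b))
      (T : Set (SplitPrime a b B)) (p : SplitPrime a b B) (s : PState a b p.1)
  /-- The end, with the output. -/
  | done (J : Submodule (𝓞 F) (Quat a b)) (c : (Quat a b)ˣ) (𝔄 : Submodule (𝓞 F) (Quat a b))

/-- The steps of `GReduce`. -/
inductive GStep (S : GReductionStructure O B) : GState a b B → GState a b B → Prop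
  /-- The linear algebra and the extraction of the two-sided part.  The list `l` is an enumeration
  of the set `X`, which fixes the order in the products over `X`; `c` is the product of the
  `x ^ (e x mod 2)` and `f` the product of the `nrd(x) ^ ⌊e x / 2⌋`. -/
  | prelude (I : Submodule (𝓞 F) (Quat a b)) (𝔞 : (FractionalIdeal (𝓞 F)⁰ F)ˣ)
      (l : List (Quat a b)ˣ) (e : (Quat a b)ˣ → ℤ) (c : (Quat a b)ˣ) (f : Fˣ)
      (𝔄 J : Submodule (𝓞 F) (Quat a b))
      (h𝔞 : (𝔞 : FractionalIdeal (𝓞 F)⁰ F) = nrdIdeal I)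
      (hl : l.Nodup ∧ ∀ x, x ∈ l ↔ x ∈ S.X)
      (he : toPrincipalIdeal (𝓞 F) F (nrdU (l.map fun x => x ^ e x).prod) * 𝔞 =
        S.φ (rayClass a b 𝔞))
      (hc : c = (l.map fun x => x ^ (e x % 2)).prod)
      (hf : f = (l.map fun x => nrdU x ^ (e x / 2)).prod)
      (h𝔄 : 𝔄 = twoSidedClosure O (lmul (c : Quat a b) I))
      (hJ : J = lmul (c : Quat a b) I * idealInv O 𝔄) :
      GStep S (.start I)
        (.loop J c f (lmul (algebraMap F (Quat a b) f) 𝔄)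
          {p | nrdIdeal J ≤ ((p.1.asIdeal : Ideal (𝓞 F)) : FractionalIdeal (𝓞 F)⁰ F)})
  /-- The call of `PReduce(J, p)`, up to its loop. -/
  | call (J : Submodule (𝓞 F) (Quat a b)) (c : (Quat a b)ˣ) (f : Fˣ)
      (𝔄 : Submodule (𝓞 F) (Quat a b)) (T : Set (SplitPrime a b B)) (p : SplitPrime a b B)
      (s : PState a b p.1) (hp : p ∈ T) (hs : PInit (S.pred p.1 p.2.1 p.2.2) J s) :
      GStep S (.loop J c f 𝔄 T) (.inner c f 𝔄 (T \ {p}) p s)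
  /-- The body of the loop of `PReduce`, which is repeated until `k < 2`. -/
  | again (c : (Quat a b)ˣ) (f : Fˣ) (𝔄 : Submodule (𝓞 F) (Quat a b))
      (T : Set (SplitPrime a b B)) (p : SplitPrime a b B) (s s' : PState a b p.1)
      (hs : PBody (S.pred p.1 p.2.1 p.2.2) s s') (hk : ¬ s'.k < 2) :
      GStep S (.inner c f 𝔄 T p s) (.inner c f 𝔄 T p s')
  /-- The last execution of that body, and the return from `PReduce`. -/
  | leave (c : (Quat a b)ˣ) (f : Fˣ) (𝔄 : Submodule (𝓞 F) (Quat a b))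
      (T : Set (SplitPrime a b B)) (p : SplitPrime a b B) (s s' : PState a b p.1)
      (hs : PBody (S.pred p.1 p.2.1 p.2.2) s s') (hk : s'.k < 2) :
      GStep S (.inner c f 𝔄 T p s)
        (.loop s'.J (s'.c * c) f
          (scale (((p.1.asIdeal : Ideal (𝓞 F)) : FractionalIdeal (𝓞 F)⁰ F) ^ s'.r) 𝔄) T)
  /-- The end of the `for` loop: the algorithm returns `J`, `c f` and `𝔄`. -/
  | finish (J : Submodule (𝓞 F) (Quat a b)) (c : (Quat a b)ˣ) (f : Fˣ)
      (𝔄 : Submodule (𝓞 F) (Quat a b)) :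
      GStep S (.loop J c f 𝔄 ∅)
        (.done J (c * Units.map (algebraMap F (Quat a b) : F →* Quat a b) f) 𝔄)

/-- The specification of the output of `GReduce` on the input `I`. -/
def GSpec (O : Subalgebra (𝓞 F) (Quat a b)) (I J : Submodule (𝓞 F) (Quat a b)) (c : (Quat a b)ˣ)
    (𝔄 : Submodule (𝓞 F) (Quat a b)) : Prop :=
  IsRightIdeal O J ∧ IsIntegral O J ∧ IsTwoSidedIdeal O 𝔄 ∧ lmul (c : Quat a b) I = J * 𝔄 ∧
    (IsPrincipal O I ↔ J = Subalgebra.toSubmodule O ∧ 𝔄 = Subalgebra.toSubmodule O)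

end GReduce

end QuatIdeal

end

set_option linter.unusedSectionVars false

noncomputable section

namespace QuatIdeal

variable {F : Type*} [Field F] [NumberField F] {a b : F}

/-! ### Reduced norm and trace -/

/-! Everything is decided one prime `p` at a time, inside localizations of lattices in the algebra
(`loc`). Completions enter only to obtain matrices at split primes and anisotropy of the norm form
at the others. A right ideal `J` is locally `y O`, where `y` is an element of `J` whose reduced norm
has least valuation (`exists_isLocGen`), so `vnrd p J` is the valuation of `nrd y`.

At a nonsplit prime the local order is the set of all elements of integral norm
(`mem_ordLoc_of_not_splitsAt`). Every invertible element therefore normalizes it, and dividing by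
the two-sided closure leaves nothing of `J` there. At a split prime, coordinates are chosen in which
the local order is the ring of integral matrices. If `y` has elementary divisors `π ^ m` and `π ^
n`, then `nrd y` has valuation `m + n`, `y` moves the vertex of `O` by `|m - n|`, and `y` is
integral exactly when `m` and `n` are nonnegative (`exists_vertex`,
`PReductionStructure.exists_position`). Primitivity means `min m n = 0`, that is, distance equal to
`k = m + n`.

Each body of `PReduce` moves `Q` one step closer to the current base vertex without changing the
valuation of the norm (`dist_of_pBody`). After two bodies `m + n = k` while `|m - n| = k - 2`, so
both exponents are at least `1` and `J` can be divided by `p` (`pInvariant_of_pBody`). The loop thus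
stops with `k` equal to `0` or `1`. The multipliers are units of the local order at all other
primes, so nothing changes there. Termination follows from a lexicographic rank: untreated primes
first, then the distance (`GStep.rank_lt`).

At the end `vnrd p J` is `0` or `1` at split primes of the factor base and `0` elsewhere, and `d I =
J 𝔄`, where `nrd d` carries `nrd I` to the value of `φ` at its class. If `I = x O`, then `nrd x` is
positive at the ramified real places, the class is trivial, and `z = d x` has norm generating the
unit ideal, with `z O = J 𝔄`. A two-sided ideal has even norm valuation at a split prime
(`even_of_conj`), so parity forces `J = O`. Then `z` normalizes `O` and has unit norm at every
prime, hence is a unit of `O` (`mem_ordLoc_of_conj`), and `𝔄 = O`. The converse is immediate from `d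
I = O`. -/

theorem nrd_eq (x : Quat a b) :
    nrd x = x.re ^ 2 - a * x.imI ^ 2 - b * x.imJ ^ 2 + a * b * x.imK ^ 2 := by
  simp [nrd]
  ring

/-- The reduced trace `x ↦ x + x̄`. -/
def trd : Quat a b →ₗ[F] F where
  toFun x := 2 * x.re
  map_add' x y := by simp; ring
  map_smul' c x := by simp; ring

theorem trd_eq (x : Quat a b) : trd x = 2 * x.re := rfl

theorem self_mul_star (x : Quat a b) : x * star x = algebraMap F _ (nrd x) := by
  have h := nrd_eq x
  generalize nrd x = n at h ⊢
  ext <;> simp <;> (try rw [h]) <;> ring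

theorem star_mul_self (x : Quat a b) : star x * x = algebraMap F _ (nrd x) := by
  have h := nrd_eq x
  generalize nrd x = n at h ⊢
  ext <;> simp <;> (try rw [h]) <;> ring

theorem star_eq (x : Quat a b) : star x = algebraMap F _ (trd x) - x := by
  have h := trd_eq x
  generalize trd x = t at h ⊢
  ext <;> simp
  rw [h]
  ring

theorem nrd_algebraMap (c : F) : nrd (algebraMap F (Quat a b) c) = c ^ 2 := by
  simp [nrd_eq]

theorem nrd_smul (c : F) (x : Quat a b) : nrd (c • x) = c ^ 2 * nrd x := by
  rw [Algebra.smul_def, map_mul, nrd_algebraMap]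

theorem nrd_one_add (x : Quat a b) : nrd (1 + x) = 1 + trd x + nrd x := by
  simp [nrd_eq, trd_eq]
  ring

theorem sq_eq (x : Quat a b) : x * x = trd x • x - algebraMap F _ (nrd x) := by
  have h := trd_eq x
  have h' := nrd_eq x
  generalize trd x = t at h ⊢
  generalize nrd x = n at h' ⊢
  ext <;> simp <;> (try rw [h]) <;> (try rw [h']) <;> ring

/-- An element of nonzero reduced norm is invertible. -/
def unitOf (x : Quat a b) (hx : nrd x ≠ 0) : (Quat a b)ˣ where
  val := x
  inv := (nrd x)⁻¹ • star x
  val_inv := by rw [mul_smul_comm, self_mul_star, ← Algebra.smul_def _ (1 : Quat a b) |>.trans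
    (mul_one _), smul_smul, inv_mul_cancel₀ hx, one_smul]
  inv_val := by rw [smul_mul_assoc, star_mul_self, ← Algebra.smul_def _ (1 : Quat a b) |>.trans
    (mul_one _), smul_smul, inv_mul_cancel₀ hx, one_smul]

theorem nrd_unit_ne_zero (x : (Quat a b)ˣ) : nrd (x : Quat a b) ≠ 0 :=
  (nrdU x).ne_zero

theorem nrd_unit_inv (x : (Quat a b)ˣ) : nrd ((x⁻¹ : (Quat a b)ˣ) : Quat a b) = (nrd (x : Quat a b))⁻¹ := by
  refine eq_inv_of_mul_eq_one_left ?_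
  rw [← map_mul, Units.inv_mul, map_one]

theorem unit_inv_eq (x : (Quat a b)ˣ) :
    ((x⁻¹ : (Quat a b)ˣ) : Quat a b) = (nrd (x : Quat a b))⁻¹ • star (x : Quat a b) := by
  have h : unitOf (x : Quat a b) (nrd_unit_ne_zero x) = x := Units.ext rfl
  rw [← congrArg (fun z : (Quat a b)ˣ => ((z⁻¹ : (Quat a b)ˣ) : Quat a b)) h]
  rfl

/-! ### Valuations of fractional ideals -/

section Fractional

variable (p : HeightOneSpectrum (𝓞 F))

open WithZero in
theorem valuation_eq_exp_count {x : F} (hx : x ≠ 0) :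
    p.valuation F x = exp (-FractionalIdeal.count F p (FractionalIdeal.spanSingleton (𝓞 F)⁰ x)) := by
  classical
  have key : ∀ r : 𝓞 F, r ≠ 0 → p.valuation F (algebraMap (𝓞 F) F r) =
      exp (-FractionalIdeal.count F p
        (FractionalIdeal.spanSingleton (𝓞 F)⁰ (algebraMap (𝓞 F) F r))) := by
    intro r hr
    rw [p.valuation_of_algebraMap, p.intValuation_if_neg hr,
      ← FractionalIdeal.coeIdeal_span_singleton, FractionalIdeal.count_coe]
    simpa using hr
  obtain ⟨r, s, hs, rfl⟩ := IsFractionRing.div_surjective (A := 𝓞 F) x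
  have hs0 : s ≠ 0 := nonZeroDivisors.ne_zero hs
  have hr0 : r ≠ 0 := by rintro rfl; simp at hx
  rw [map_div₀, key r hr0, key s hs0, div_eq_mul_inv (algebraMap (𝓞 F) F r),
    ← FractionalIdeal.spanSingleton_mul_spanSingleton, ← FractionalIdeal.spanSingleton_inv,
    FractionalIdeal.count_mul, FractionalIdeal.count_inv, ← exp_sub]
  · congr 1; ring
  · simpa [FractionalIdeal.spanSingleton_eq_zero_iff] using hr0
  · simpa [FractionalIdeal.spanSingleton_eq_zero_iff] using hs0

open WithZero in
theorem valuation_le_of_mem {𝔞 : FractionalIdeal (𝓞 F)⁰ F} {x : F} (hx : x ∈ 𝔞) :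
    p.valuation F x ≤ exp (-FractionalIdeal.count F p 𝔞) := by
  rcases eq_or_ne x 0 with rfl | hx0
  · simp
  rw [valuation_eq_exp_count p hx0, exp_le_exp, neg_le_neg_iff]
  exact FractionalIdeal.count_mono F p (by simpa [FractionalIdeal.spanSingleton_eq_zero_iff] using hx0)
    ((FractionalIdeal.spanSingleton_le_iff_mem).2 hx)

open WithZero in
-- If the least valuation were not attained, every `x` in `𝔞` would generate `𝔞 𝔟` with `𝔟`
-- divisible by `p`. That gives `𝔞 ≤ 𝔞 p`, and cancelling `𝔞` yields `1 ≤ p`, which is absurd.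
theorem exists_mem_valuation_eq {𝔞 : FractionalIdeal (𝓞 F)⁰ F} (h𝔞 : 𝔞 ≠ 0) :
    ∃ x ∈ 𝔞, x ≠ 0 ∧ p.valuation F x = exp (-FractionalIdeal.count F p 𝔞) := by
  have hp0 : ((p.asIdeal : Ideal (𝓞 F)) : FractionalIdeal (𝓞 F)⁰ F) ≠ 0 := by
    simpa using p.ne_bot
  by_contra! hcon
  have hle : 𝔞 ≤ 𝔞 * (p.asIdeal : Ideal (𝓞 F)) := by
    intro x hx
    rcases eq_or_ne x 0 with rfl | hx0
    · exact FractionalIdeal.zero_mem _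
    rw [← FractionalIdeal.spanSingleton_le_iff_mem] at hx ⊢
    have h1 : 𝔞⁻¹ * FractionalIdeal.spanSingleton (𝓞 F)⁰ x ≤ 1 := by
      rw [← inv_mul_cancel₀ h𝔞]
      exact mul_le_mul_right hx _
    obtain ⟨𝔟, h𝔟⟩ := FractionalIdeal.le_one_iff_exists_coeIdeal.1 h1
    have hx' : FractionalIdeal.spanSingleton (𝓞 F)⁰ x = 𝔞 * 𝔟 := by
      rw [h𝔟, mul_inv_cancel_left₀ h𝔞]
    have h𝔟0 : (𝔟 : FractionalIdeal (𝓞 F)⁰ F) ≠ 0 := by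
      intro h0
      rw [h0, mul_zero] at hx'
      exact hx0 (FractionalIdeal.spanSingleton_eq_zero_iff.1 hx')
    have hv := hcon x ((FractionalIdeal.spanSingleton_le_iff_mem).1 hx) hx0
    rw [valuation_eq_exp_count p hx0, hx', FractionalIdeal.count_mul F p h𝔞 h𝔟0] at hv
    have h𝔟p : 𝔟 ≤ p.asIdeal := by
      classical
      by_contra hnot
      apply hv
      have hb0 : 𝔟 ≠ 0 := by simpa using h𝔟0
      rw [FractionalIdeal.count_coe F p hb0]
      have : (Associates.mk p.asIdeal).count (Associates.mk 𝔟).factors = 0 := by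
        by_contra hne
        exact hnot (Ideal.le_of_dvd
          ((Associates.count_ne_zero_iff_dvd hb0 p.irreducible).1 hne))
      rw [this]
      simp
    rw [hx']
    exact mul_le_mul_right (FractionalIdeal.coeIdeal_le_coeIdeal F |>.2 h𝔟p) _
  have h1 : (1 : FractionalIdeal (𝓞 F)⁰ F) ≤ (p.asIdeal : Ideal (𝓞 F)) := by
    have := mul_le_mul_right hle 𝔞⁻¹
    rwa [inv_mul_cancel₀ h𝔞, inv_mul_cancel_left₀ h𝔞] at this
  rw [← FractionalIdeal.coeIdeal_top, FractionalIdeal.coeIdeal_le_coeIdeal] at h1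
  exact p.isPrime.ne_top (top_le_iff.1 h1)

/-- A uniformizer of `F` at `p`. -/
theorem exists_uniformizer : ∃ π : F, π ≠ 0 ∧ p.valuation F π = WithZero.exp (-1 : ℤ) := by
  obtain ⟨π, hπ⟩ := p.valuation_exists_uniformizer F
  refine ⟨π, ?_, hπ⟩
  rintro rfl
  exact WithZero.exp_ne_zero (hπ.symm.trans (map_zero _))

end Fractional

/-! ### Localization of submodules at a prime -/

section Loc

variable (p : HeightOneSpectrum (𝓞 F))

/-- The localization of a submodule at `p`, inside the algebra. -/
def loc (M : Submodule (𝓞 F) (Quat a b)) : Submodule (𝓞 F) (Quat a b) where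
  carrier := {z | ∃ s : 𝓞 F, s ∉ p.asIdeal ∧ s • z ∈ M}
  zero_mem' := ⟨1, p.asIdeal.ne_top_iff_one.1 p.isPrime.ne_top, by simp⟩
  add_mem' := by
    rintro x y ⟨s, hs, hx⟩ ⟨t, ht, hy⟩
    refine ⟨s * t, fun h => (p.isPrime.mem_or_mem h).elim hs ht, ?_⟩
    rw [smul_add]
    refine M.add_mem ?_ ?_
    · rw [mul_comm, mul_smul]
      exact M.smul_mem _ hx
    · rw [mul_smul]
      exact M.smul_mem _ hy
  smul_mem' := by
    rintro r x ⟨s, hs, hx⟩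
    refine ⟨s, hs, ?_⟩
    rw [smul_comm]
    exact M.smul_mem _ hx

variable {p} {M N : Submodule (𝓞 F) (Quat a b)}

theorem le_loc : M ≤ loc p M := fun z hz =>
  ⟨1, p.asIdeal.ne_top_iff_one.1 p.isPrime.ne_top, by simpa using hz⟩

theorem loc_mono (h : M ≤ N) : loc p M ≤ loc p N := fun _ ⟨s, hs, hz⟩ => ⟨s, hs, h hz⟩

theorem mem_loc_of_smul_mem {s : 𝓞 F} (hs : s ∉ p.asIdeal) {z : Quat a b} (h : s • z ∈ loc p M) :
    z ∈ loc p M := by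
  obtain ⟨t, ht, h⟩ := h
  exact ⟨t * s, fun h => (p.isPrime.mem_or_mem h).elim ht hs, by rwa [mul_smul]⟩

theorem loc_le_loc (h : M ≤ loc p N) : loc p M ≤ loc p N := fun _ ⟨_, hs, hz⟩ =>
  mem_loc_of_smul_mem hs (h hz)

/-- A local-global principle. -/
theorem mem_of_forall_mem_loc {z : Quat a b} (h : ∀ p, z ∈ loc p M) : z ∈ M := by
  let c : Ideal (𝓞 F) := 
    { carrier := {r | r • z ∈ M}
      zero_mem' := by simp
      add_mem' := by
        intro r s hr hs
        simp only [Set.mem_ofPred_eq, add_smul] at *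
        exact M.add_mem hr hs
      smul_mem' := by
        intro r s hs
        simp only [Set.mem_ofPred_eq, smul_eq_mul, mul_smul] at *
        exact M.smul_mem _ hs }
  by_contra hz
  have hc : c ≠ ⊤ := by
    intro hc
    have : (1 : 𝓞 F) ∈ c := by rw [hc]; trivial
    exact hz (by simpa [c] using this)
  obtain ⟨m, hm, hcm⟩ := Ideal.exists_le_maximal c hc
  -- The zero ideal is not a height one prime and is treated apart: then `c = 0`, which is refuted
  -- at any nonzero prime. One exists because `𝓞 F` is not a field.
  rcases eq_or_ne m ⊥ with rfl | hm0
  · obtain ⟨q⟩ : Nonempty (HeightOneSpectrum (𝓞 F)) := by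
      obtain ⟨q, hq0, hq⟩ := Ring.not_isField_iff_exists_prime.1 (RingOfIntegers.not_isField F)
      exact ⟨q, hq, hq0⟩
    obtain ⟨s, hs, hsz⟩ := h q
    have : s = 0 := by simpa using hcm (show s ∈ c from hsz)
    exact hs (this ▸ zero_mem _)
  · obtain ⟨s, hs, hsz⟩ := h ⟨m, hm.isPrime, hm0⟩
    exact hs (hcm hsz)

theorem le_of_forall_le_loc (h : ∀ p, M ≤ loc p N) : M ≤ N := fun _ hz =>
  mem_of_forall_mem_loc fun p => h p hz

theorem smul_algebra_eq (r : 𝓞 F) (z : Quat a b) : r • z = algebraMap (𝓞 F) F r • z :=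
  (algebraMap_smul F r z).symm

theorem smul_mem_loc {x : F} (hx : p.valuation F x ≤ 1) {z : Quat a b} (hz : z ∈ loc p M) :
    x • z ∈ loc p M := by
  obtain ⟨n, ⟨d, hd⟩, h⟩ := p.exists_primeCompl_mul_eq_of_integer x hx
  refine mem_loc_of_smul_mem (s := d) hd ?_
  rw [smul_algebra_eq, smul_smul, mul_comm, h, ← smul_algebra_eq]
  exact (loc p M).smul_mem _ hz

theorem exists_smul_le_of_fg (hN : N.FG) (h : N ≤ loc p M) :
    ∃ s : 𝓞 F, s ∉ p.asIdeal ∧ ∀ z ∈ N, s • z ∈ M := by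
  classical
  induction N, hN using Submodule.fg_induction with
  | singleton x =>
    obtain ⟨s, hs, hx⟩ := h (Submodule.mem_span_singleton_self x)
    refine ⟨s, hs, fun z hz => ?_⟩
    obtain ⟨r, rfl⟩ := Submodule.mem_span_singleton.1 hz
    rw [smul_comm]
    exact M.smul_mem _ hx
  | sup N₁ N₂ _ _ h₁ h₂ =>
    obtain ⟨s, hs, hs'⟩ := h₁ (le_sup_left.trans h)
    obtain ⟨t, ht, ht'⟩ := h₂ (le_sup_right.trans h)
    refine ⟨s * t, fun h => (p.isPrime.mem_or_mem h).elim hs ht, fun z hz => ?_⟩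
    obtain ⟨x, hx, y, hy, rfl⟩ := Submodule.mem_sup.1 hz
    rw [smul_add]
    refine M.add_mem ?_ ?_
    · rw [mul_comm, mul_smul]
      exact M.smul_mem _ (hs' _ hx)
    · rw [mul_smul]
      exact M.smul_mem _ (ht' _ hy)

theorem mul_mem_loc {x y : Quat a b} (hx : x ∈ loc p M) (hy : y ∈ loc p N) :
    x * y ∈ loc p (M * N) := by
  obtain ⟨s, hs, hx⟩ := hx
  obtain ⟨t, ht, hy⟩ := hy
  refine ⟨s * t, fun h => (p.isPrime.mem_or_mem h).elim hs ht, ?_⟩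
  rw [← smul_mul_smul_comm]
  exact Submodule.mul_mem_mul hx hy

theorem mem_scale {𝔞 : FractionalIdeal (𝓞 F)⁰ F} {x : F} {z : Quat a b} (hx : x ∈ 𝔞)
    (hz : z ∈ M) : x • z ∈ scale 𝔞 M := by
  rw [Algebra.smul_def]
  exact Submodule.mul_mem_mul ⟨x, hx, rfl⟩ hz

theorem scale_le {𝔞 : FractionalIdeal (𝓞 F)⁰ F} (h : ∀ x ∈ 𝔞, ∀ z ∈ M, x • z ∈ N) :
    scale 𝔞 M ≤ N := by
  refine Submodule.mul_le.2 ?_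
  rintro _ ⟨x, hx, rfl⟩ z hz
  have := h x hx z hz
  rwa [Algebra.smul_def] at this

/-- Locally at `p` a fractional ideal is generated by any element `x` with its valuation, so scaling
by the ideal becomes multiplication by `x`. -/
theorem mem_loc_scale {𝔞 : FractionalIdeal (𝓞 F)⁰ F} (h𝔞 : 𝔞 ≠ 0) {x : F}
    (hx : p.valuation F x = WithZero.exp (-FractionalIdeal.count F p 𝔞)) {z : Quat a b} :
    z ∈ loc p (scale 𝔞 M) ↔ x⁻¹ • z ∈ loc p M := by
  have hx0 : x ≠ 0 := by rintro rfl; exact WithZero.exp_ne_zero (hx.symm.trans (map_zero _))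
  constructor
  · rintro ⟨s, hs, hz⟩
    refine mem_loc_of_smul_mem hs ?_
    rw [smul_comm]
    revert hz
    generalize s • z = w
    intro hw
    have : scale 𝔞 M ≤ (loc p M).comap (LinearMap.lsmul F (Quat a b) x⁻¹ |>.restrictScalars (𝓞 F)) := by
      refine scale_le fun y hy z hz => ?_
      show x⁻¹ • y • z ∈ loc p M
      rw [smul_smul]
      refine smul_mem_loc ?_ (le_loc hz)
      rw [map_mul, map_inv₀, hx]
      exact inv_mul_le_one_of_le₀ (valuation_le_of_mem p hy) zero_le
    exact this hw
  · intro h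
    obtain ⟨y, hy, hy0, hyv⟩ := exists_mem_valuation_eq p h𝔞
    have : y • x⁻¹ • z ∈ loc p (scale 𝔞 M) := by
      obtain ⟨s, hs, h⟩ := h
      exact ⟨s, hs, by rw [smul_comm]; exact mem_scale hy h⟩
    have h2 := smul_mem_loc (x := x * y⁻¹) (p := p) (by simp [hx, hyv]) this
    rwa [smul_smul, smul_smul, inv_mul_cancel_right₀ hy0, mul_inv_cancel₀ hx0,
      one_smul] at h2

end Loc

/-! ### Lattices and orders -/

section Lattice

variable {M N I : Submodule (𝓞 F) (Quat a b)}

theorem exists_smul_mem_of_isLattice (hM : Submodule.IsLattice F M) (x : Quat a b) :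
    ∃ r : 𝓞 F, r ≠ 0 ∧ r • x ∈ M := by
  have hx : x ∈ Submodule.span F (M : Set (Quat a b)) := by
    rw [hM.span_eq_top]; trivial
  induction hx using Submodule.span_induction with
  | mem x h => exact ⟨1, one_ne_zero, by simpa using h⟩
  | zero => exact ⟨1, one_ne_zero, by simp⟩
  | add x y _ _ hx hy =>
    obtain ⟨r, hr, hx⟩ := hx
    obtain ⟨s, hs, hy⟩ := hy
    refine ⟨r * s, mul_ne_zero hr hs, ?_⟩
    rw [smul_add]
    refine M.add_mem ?_ ?_
    · rw [mul_comm, mul_smul]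
      exact M.smul_mem _ hx
    · rw [mul_smul]
      exact M.smul_mem _ hy
  | smul c x _ hx =>
    obtain ⟨r, hr, hx⟩ := hx
    obtain ⟨n, d, hd, rfl⟩ := IsFractionRing.div_surjective (A := 𝓞 F) c
    have hd0 := nonZeroDivisors.ne_zero hd
    refine ⟨d * r, mul_ne_zero hd0 hr, ?_⟩
    have : (d * r) • (algebraMap (𝓞 F) F n / algebraMap (𝓞 F) F d) • x = n • r • x := by
      have hd0' : algebraMap (𝓞 F) F d ≠ 0 := by simpa using hd0
      rw [smul_algebra_eq, smul_algebra_eq n, smul_algebra_eq r, smul_smul, smul_smul]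
      congr 1
      rw [map_mul]
      field_simp
    rw [this]
    exact M.smul_mem _ hx

theorem exists_smul_le_of_isLattice (hM : Submodule.IsLattice F M) (hN : N.FG) :
    ∃ r : 𝓞 F, r ≠ 0 ∧ ∀ x ∈ N, r • x ∈ M := by
  induction N, hN using Submodule.fg_induction with
  | singleton x =>
    obtain ⟨s, hs, hx⟩ := exists_smul_mem_of_isLattice hM x
    refine ⟨s, hs, fun z hz => ?_⟩
    obtain ⟨r, rfl⟩ := Submodule.mem_span_singleton.1 hz
    rw [smul_comm]
    exact M.smul_mem _ hx
  | sup N₁ N₂ _ _ h₁ h₂ =>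
    obtain ⟨s, hs, hs'⟩ := h₁
    obtain ⟨t, ht, ht'⟩ := h₂
    refine ⟨s * t, mul_ne_zero hs ht, fun z hz => ?_⟩
    obtain ⟨x, hx, y, hy, rfl⟩ := Submodule.mem_sup.1 hz
    rw [smul_add]
    refine M.add_mem ?_ ?_
    · rw [mul_comm, mul_smul]
      exact M.smul_mem _ (hs' _ hx)
    · rw [mul_smul]
      exact M.smul_mem _ (ht' _ hy)

theorem algebraMap_ne_zero {r : 𝓞 F} (hr : r ≠ 0) : algebraMap (𝓞 F) F r ≠ 0 := by
  simpa using hr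

theorem fg_of_smul_le {r : 𝓞 F} (hr : r ≠ 0) (hM : M.FG) (h : ∀ x ∈ N, r • x ∈ M) : N.FG := by
  refine Submodule.fg_of_fg_map_injective (LinearMap.lsmul (𝓞 F) (Quat a b) r) ?_
    (Submodule.FG.of_le hM ?_)
  · intro x y hxy
    have : algebraMap (𝓞 F) F r • x = algebraMap (𝓞 F) F r • y := by
      rw [← smul_algebra_eq, ← smul_algebra_eq]; exact hxy
    exact smul_right_injective _ (algebraMap_ne_zero hr) this
  · rintro _ ⟨x, hx, rfl⟩
    exact h x hx

theorem isLattice_of_forall (hN : N.FG) (h : ∀ x, ∃ r : 𝓞 F, r ≠ 0 ∧ r • x ∈ N) :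
    Submodule.IsLattice F N := by
  refine ⟨hN, eq_top_iff.2 fun x _ => ?_⟩
  obtain ⟨r, hr, hx⟩ := h x
  have := Submodule.smul_mem _ (algebraMap (𝓞 F) F r)⁻¹ (Submodule.subset_span (R := F) hx)
  rwa [smul_algebra_eq, smul_smul, inv_mul_cancel₀ (algebraMap_ne_zero hr), one_smul] at this

theorem isLattice_of_le {r : 𝓞 F} (hr : r ≠ 0) (hM : Submodule.IsLattice F M) (hMN : M ≤ N)
    (h : ∀ x ∈ N, r • x ∈ M) : Submodule.IsLattice F N :=
  isLattice_of_forall (fg_of_smul_le hr hM.fg h) fun x =>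
    (exists_smul_mem_of_isLattice hM x).imp fun _ h => ⟨h.1, hMN h.2⟩

/-- If `r · 1` lies in `I`, then `r` times the right order lies in `I`, which bounds it. Conversely
`I x` is finitely generated, so some multiple of `x` preserves `I`. -/
theorem isOrder_rightOrder (hI : Submodule.IsLattice F I) : IsOrder (rightOrder I) := by
  refine isLattice_of_forall ?_ fun x => ?_
  · obtain ⟨r, hr, h1⟩ := exists_smul_mem_of_isLattice hI 1
    refine fg_of_smul_le hr hI.fg fun x hx => ?_
    have := hx _ h1
    rwa [smul_mul_assoc, one_mul] at this
  · obtain ⟨r, hr, h⟩ := exists_smul_le_of_isLattice hI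
      (hI.fg.map (LinearMap.mulRight (𝓞 F) x))
    refine ⟨r, hr, fun y hy => ?_⟩
    rw [mul_smul_comm]
    exact h _ ⟨y, hy, rfl⟩

theorem isOrder_leftOrder (hI : Submodule.IsLattice F I) : IsOrder (leftOrder I) := by
  refine isLattice_of_forall ?_ fun x => ?_
  · obtain ⟨r, hr, h1⟩ := exists_smul_mem_of_isLattice hI 1
    refine fg_of_smul_le hr hI.fg fun x hx => ?_
    have := hx _ h1
    rwa [mul_smul_comm, mul_one] at this
  · obtain ⟨r, hr, h⟩ := exists_smul_le_of_isLattice hI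
      (hI.fg.map (LinearMap.mulLeft (𝓞 F) x))
    refine ⟨r, hr, fun y hy => ?_⟩
    rw [smul_mul_assoc]
    exact h _ ⟨y, hy, rfl⟩

theorem isLattice_lmul (hI : Submodule.IsLattice F I) (c : (Quat a b)ˣ) :
    Submodule.IsLattice F (lmul (c : Quat a b) I) := by
  refine isLattice_of_forall (hI.fg.map _) fun x => ?_
  obtain ⟨r, hr, h⟩ := exists_smul_mem_of_isLattice hI (((c⁻¹ : (Quat a b)ˣ) : Quat a b) * x)
  refine ⟨r, hr, _, h, ?_⟩
  simp

theorem mem_lmul {c : (Quat a b)ˣ} {z : Quat a b} :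
    z ∈ lmul (c : Quat a b) I ↔ ((c⁻¹ : (Quat a b)ˣ) : Quat a b) * z ∈ I := by
  constructor
  · rintro ⟨y, hy, rfl⟩
    simpa using hy
  · intro h
    exact ⟨_, h, by simp⟩

theorem lmul_mul (c d : Quat a b) : lmul (c * d) I = lmul c (lmul d I) := by
  ext z
  simp [lmul]

theorem isLattice_mul (hM : Submodule.IsLattice F M) (hN : Submodule.IsLattice F N) :
    Submodule.IsLattice F (M * N) := by
  refine isLattice_of_forall (hM.fg.mul hN.fg) fun x => ?_
  obtain ⟨r, hr, h⟩ := exists_smul_mem_of_isLattice hM x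
  obtain ⟨s, hs, h1⟩ := exists_smul_mem_of_isLattice hN 1
  refine ⟨r * s, mul_ne_zero hr hs, ?_⟩
  have := Submodule.mul_mem_mul h h1
  rwa [smul_mul_smul_comm, mul_one] at this

theorem fg_scale {𝔞 : FractionalIdeal (𝓞 F)⁰ F} (hM : M.FG) : (scale 𝔞 M).FG :=
  ((FractionalIdeal.fg_of_isNoetherianRing le_rfl 𝔞).map _).mul hM

theorem isLattice_scale {𝔞 : FractionalIdeal (𝓞 F)⁰ F} (h𝔞 : 𝔞 ≠ 0)
    (hM : Submodule.IsLattice F M) : Submodule.IsLattice F (scale 𝔞 M) := by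
  refine isLattice_of_forall (fg_scale hM.fg) fun x => ?_
  obtain ⟨r, hr, h⟩ := exists_smul_mem_of_isLattice hM x
  obtain ⟨s, hs, h1⟩ := FractionalIdeal.exists_ne_zero_mem_isInteger h𝔞
  refine ⟨s * r, mul_ne_zero hs hr, ?_⟩
  rw [mul_smul, smul_algebra_eq s]
  exact mem_scale h1 h

end Lattice

/-! ### Orders: integrality of norms, the conjugation, local maximality. -/

section Order

variable {O : Subalgebra (𝓞 F) (Quat a b)} {I : Submodule (𝓞 F) (Quat a b)}
  {p : HeightOneSpectrum (𝓞 F)}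

theorem le_rightOrder_iff : O ≤ rightOrder I ↔ I * Subalgebra.toSubmodule O ≤ I := by
  rw [Submodule.mul_le]
  exact ⟨fun h x hx y hy => h hy x hx, fun h y hy x hx => h x hx y hy⟩

theorem le_leftOrder_iff : O ≤ leftOrder I ↔ Subalgebra.toSubmodule O * I ≤ I := by
  rw [Submodule.mul_le]
  exact ⟨fun h x hx y hy => h hx y hy, fun h y hy x hx => h y hy x hx⟩

/-- Maximality reduces the equality of the right order with `O` to stability of `I` under right
multiplication by `O`. All later ideals are recognized in this way. -/
theorem isRightIdeal_of_le (hO : IsMaximalOrder O) (hI : Submodule.IsLattice F I)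
    (h : O ≤ rightOrder I) : IsRightIdeal O I :=
  ⟨hI, hO.2 _ (isOrder_rightOrder hI) h⟩

theorem isTwoSidedIdeal_of_le (hO : IsMaximalOrder O) (hI : Submodule.IsLattice F I)
    (h : O ≤ leftOrder I) (h' : O ≤ rightOrder I) : IsTwoSidedIdeal O I :=
  ⟨isRightIdeal_of_le hO hI h', hO.2 _ (isOrder_leftOrder hI) h⟩

theorem IsRightIdeal.mul_mem (hI : IsRightIdeal O I) {x y : Quat a b} (hx : x ∈ I) (hy : y ∈ O) :
    x * y ∈ I := by
  rw [← hI.2] at hy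
  exact hy x hx

theorem IsTwoSidedIdeal.mul_mem_left (hI : IsTwoSidedIdeal O I) {x y : Quat a b} (hx : x ∈ O)
    (hy : y ∈ I) : x * y ∈ I := by
  rw [← hI.2] at hx
  exact hx y hy

theorem nrdModule_fg (hI : I.FG) : (nrdModule I).FG :=
  FractionalIdeal.fg_of_isNoetherianRing (S := (𝓞 F)⁰) (P := F) le_rfl
    ⟨nrdModule I, isFractional_nrdModule hI⟩

/-- The reduced norms of the elements of an order are integers. -/
theorem exists_nrd_eq (hO : IsOrder O) {x : Quat a b} (hx : x ∈ O) :
    ∃ r : 𝓞 F, algebraMap (𝓞 F) F r = nrd x := by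
  -- By multiplicativity, `nrd x` stabilizes the finitely generated module spanned by the norms from
  -- `O`. That module contains `1`, so `nrd x` is integral by the determinant trick.
  refine IsIntegralClosure.isIntegral_iff.1 (isIntegral_of_smul_mem_submodule
    (nrdModule (Subalgebra.toSubmodule O)) ?_ (nrdModule_fg hO.fg) (nrd x) ?_)
  · intro h
    have : (1 : F) ∈ nrdModule (Subalgebra.toSubmodule O) :=
      Submodule.subset_span ⟨1, O.one_mem, map_one _⟩
    rw [h] at this
    exact one_ne_zero this
  · intro n hn
    induction hn using Submodule.span_induction with
    | mem n h =>
      obtain ⟨y, hy, rfl⟩ := h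
      rw [smul_eq_mul, ← map_mul]
      exact Submodule.subset_span ⟨_, O.mul_mem hx hy, rfl⟩
    | zero => simp
    | add y z _ _ hy hz => rw [smul_add]; exact add_mem hy hz
    | smul r y _ hy => rw [smul_comm]; exact Submodule.smul_mem _ _ hy

theorem exists_trd_eq (hO : IsOrder O) {x : Quat a b} (hx : x ∈ O) :
    ∃ r : 𝓞 F, algebraMap (𝓞 F) F r = trd x := by
  obtain ⟨r, hr⟩ := exists_nrd_eq hO hx
  obtain ⟨s, hs⟩ := exists_nrd_eq hO (O.add_mem O.one_mem hx)
  refine ⟨s - 1 - r, ?_⟩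
  rw [map_sub, map_sub, map_one, hr, hs, nrd_one_add]
  ring

theorem star_mem_of_isOrder (hO : IsOrder O) {x : Quat a b} (hx : x ∈ O) : star x ∈ O := by
  obtain ⟨r, hr⟩ := exists_trd_eq hO hx
  rw [star_eq, ← hr, ← IsScalarTower.algebraMap_apply (𝓞 F) F (Quat a b)]
  exact O.sub_mem (O.algebraMap_mem r) hx

/-- The localization at `p` of an order. -/
abbrev ordLoc (p : HeightOneSpectrum (𝓞 F)) (O : Subalgebra (𝓞 F) (Quat a b)) :
    Submodule (𝓞 F) (Quat a b) :=
  loc p (Subalgebra.toSubmodule O)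

theorem mul_mem_ordLoc {x y : Quat a b} (hx : x ∈ ordLoc p O) (hy : y ∈ ordLoc p O) :
    x * y ∈ ordLoc p O := by
  have h : Subalgebra.toSubmodule O * Subalgebra.toSubmodule O ≤ Subalgebra.toSubmodule O :=
    Submodule.mul_le.2 fun x hx y hy => O.mul_mem hx hy
  exact loc_mono h (mul_mem_loc hx hy)

theorem one_mem_ordLoc : (1 : Quat a b) ∈ ordLoc p O := le_loc O.one_mem

theorem valuation_eq_one_of_notMem {s : 𝓞 F} (hs : s ∉ p.asIdeal) :
    p.valuation F (algebraMap (𝓞 F) F s) = 1 := by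
  rw [p.valuation_eq_one_iff_notMem]
  exact hs

theorem valuation_nrd_smul {s : 𝓞 F} (hs : s ∉ p.asIdeal) (z : Quat a b) :
    p.valuation F (nrd (s • z)) = p.valuation F (nrd z) := by
  rw [smul_algebra_eq, nrd_smul, map_mul, map_pow, valuation_eq_one_of_notMem hs, one_pow, one_mul]

theorem valuation_nrd_le_one (hO : IsOrder O) {z : Quat a b} (hz : z ∈ ordLoc p O) :
    p.valuation F (nrd z) ≤ 1 := by
  obtain ⟨s, hs, hz⟩ := hz
  obtain ⟨r, hr⟩ := exists_nrd_eq hO hz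
  rw [← valuation_nrd_smul hs, ← hr]
  exact p.valuation_le_one r

theorem star_mem_ordLoc (hO : IsOrder O) {z : Quat a b} (hz : z ∈ ordLoc p O) :
    star z ∈ ordLoc p O := by
  obtain ⟨s, hs, hz⟩ := hz
  refine ⟨s, hs, ?_⟩
  have := star_mem_of_isOrder hO hz
  rwa [smul_algebra_eq, star_eq, map_smul, smul_eq_mul, map_mul, ← Algebra.smul_def, ← smul_sub,
    ← star_eq, ← smul_algebra_eq] at this

theorem inv_mem_ordLoc (hO : IsOrder O) {z : (Quat a b)ˣ} (hz : (z : Quat a b) ∈ ordLoc p O)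
    (hn : p.valuation F (nrd (z : Quat a b)) = 1) :
    ((z⁻¹ : (Quat a b)ˣ) : Quat a b) ∈ ordLoc p O := by
  rw [unit_inv_eq]
  exact smul_mem_loc (by simp [hn]) (star_mem_ordLoc hO hz)

/-- The ideal of denominators of `x` is `p ^ n c'` with `c'` prime to `p`. Any `s` in `c'` outside
`p` clears the denominators away from `p`, since at `q ≠ p` an element of `p ^ n` outside `q`
removes the rest. -/
theorem exists_notMem_forall_ne_mem_loc {M : Submodule (𝓞 F) (Quat a b)}
    (hM : Submodule.IsLattice F M) (p : HeightOneSpectrum (𝓞 F)) (x : Quat a b) :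
    ∃ s : 𝓞 F, s ∉ p.asIdeal ∧ ∀ q ≠ p, s • x ∈ loc q M := by
  let c : Ideal (𝓞 F) := M.comap (LinearMap.toSpanSingleton (𝓞 F) (Quat a b) x)
  have hc : c ≠ 0 := by
    obtain ⟨r, hr, h⟩ := exists_smul_mem_of_isLattice hM x
    intro hc
    have : r ∈ c := h
    rw [hc] at this
    exact hr this
  obtain ⟨n, c', hc', h⟩ := WfDvdMonoid.max_power_factor hc p.irreducible
  obtain ⟨s, hs, hsp⟩ : ∃ s ∈ c', s ∉ p.asIdeal := by
    by_contra! hcon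
    exact hc' (Ideal.dvd_iff_le.2 hcon)
  refine ⟨s, hsp, fun q hq => ?_⟩
  obtain ⟨r, hr, hrq⟩ : ∃ r ∈ p.asIdeal ^ n, r ∉ q.asIdeal := by
    by_contra! hcon
    have hle : p.asIdeal ≤ q.asIdeal := q.isPrime.le_of_pow_le hcon
    exact hq (HeightOneSpectrum.ext (p.isMaximal.eq_of_le q.isPrime.ne_top hle)).symm
  refine ⟨r, hrq, ?_⟩
  have : r * s ∈ c := by
    rw [h]
    exact Ideal.mul_mem_mul hr hs
  rw [← mul_smul]
  exact this

/-- A maximal order is locally maximal. -/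
theorem le_ordLoc_of_isMaximalOrder (hO : IsMaximalOrder O) {S : Subalgebra (𝓞 F) (Quat a b)}
    (hS : O ≤ S) {t : 𝓞 F} (ht : t ≠ 0) (h : ∀ x ∈ S, t • x ∈ ordLoc p O) :
    Subalgebra.toSubmodule S ≤ ordLoc p O := by
  -- The ring `O'` glues `S` at `p` with `O` at the other primes. The bound `t` makes it an order,
  -- so maximality gives `O' = O`.
  let O' : Subalgebra (𝓞 F) (Quat a b) :=
    { carrier := {x | x ∈ S ∧ ∀ q ≠ p, x ∈ ordLoc q O}
      mul_mem' := fun hx hy =>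
        ⟨S.mul_mem hx.1 hy.1, fun q hq => mul_mem_ordLoc (hx.2 q hq) (hy.2 q hq)⟩
      add_mem' := fun hx hy =>
        ⟨S.add_mem hx.1 hy.1, fun q hq => add_mem (hx.2 q hq) (hy.2 q hq)⟩
      algebraMap_mem' := fun r =>
        ⟨S.algebraMap_mem r, fun q _ => le_loc (O.algebraMap_mem r)⟩ }
  have hOO' : O ≤ O' := fun x hx => ⟨hS hx, fun q _ => le_loc hx⟩
  have hO' : O' = O := by
    refine hO.2 O' (isLattice_of_le ht hO.1 hOO' fun x hx => ?_) hOO'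
    refine mem_of_forall_mem_loc fun q => ?_
    rcases eq_or_ne q p with rfl | hq
    · exact h x hx.1
    · exact Submodule.smul_mem _ _ (hx.2 q hq)
  intro x hx
  obtain ⟨s, hs, hsx⟩ := exists_notMem_forall_ne_mem_loc hO.1 p x
  refine ⟨s, hs, ?_⟩
  rw [← hO']
  exact ⟨S.smul_mem hx s, hsx⟩

/-- The dual of an order for the trace form is bounded. -/
theorem exists_smul_mem_of_trd (ha : a ≠ 0) (hb : b ≠ 0) (hO : IsOrder O)
    (p : HeightOneSpectrum (𝓞 F)) :
    ∃ t : 𝓞 F, t ≠ 0 ∧ ∀ x, (∀ o ∈ O, p.valuation F (trd (x * o)) ≤ 1) → t • x ∈ ordLoc p O := by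
  -- The family `e` is `1, i, j, k`, and `e'` is its dual basis for the trace form.
  let e : Fin 4 → Quat a b := ![1, ⟨0, 1, 0, 0⟩, ⟨0, 0, 1, 0⟩, ⟨0, 0, 0, 1⟩]
  let e' : Fin 4 → Quat a b := ![⟨1 / 2, 0, 0, 0⟩, ⟨0, 1 / (2 * a), 0, 0⟩, ⟨0, 0, 1 / (2 * b), 0⟩,
    ⟨0, 0, 0, -1 / (2 * a * b)⟩]
  have he : ∀ x, x = ∑ i, trd (x * e i) • e' i := by
    intro x
    simp only [Fin.sum_univ_four, e, e', trd_eq]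
    ext <;> simp <;> field_simp
  obtain ⟨r, hr, h⟩ := exists_smul_le_of_isLattice hO (N := Submodule.span (𝓞 F) (Set.range e ∪ Set.range e'))
    (Submodule.fg_span (Set.toFinite _))
  -- One factor `r` brings `e i` into `O`, so that the trace hypothesis applies; the other brings
  -- `e' i` into `O`.
  refine ⟨r * r, mul_ne_zero hr hr, fun x hx => ?_⟩
  have : (r * r) • x = ∑ i, trd (x * (r • e i)) • (r • e' i) := by
    conv_lhs => rw [he x]
    rw [Finset.smul_sum]
    refine Finset.sum_congr rfl fun i _ => ?_
    rw [smul_algebra_eq, smul_algebra_eq, smul_algebra_eq, mul_smul_comm, map_smul, smul_smul,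
      smul_smul, map_mul, smul_eq_mul]
    congr 1
    ring
  rw [this]
  refine Submodule.sum_mem _ fun i _ => smul_mem_loc (hx _ ?_) (le_loc ?_)
  · exact h _ (Submodule.subset_span (Or.inl ⟨i, rfl⟩))
  · exact h _ (Submodule.subset_span (Or.inr ⟨i, rfl⟩))

end Order

/-! ### Splitting and the norm form -/

section Split

variable {K : Type*} [Field K] [Algebra F K]

/-- The algebra acts on `K[√a]` with basis `1, √a`: `i` is multiplication by `√a`, and `j` is
conjugation followed by multiplication by `u + v √a`, whose square is the norm `b`. This action is
injective, hence bijective because both sides have dimension four. -/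
theorem splitsOver_of_eq_norm (ha : a ≠ 0) (hb : b ≠ 0) {u v : K}
    (h : algebraMap F K b = u ^ 2 - algebraMap F K a * v ^ 2) : SplitsOver a b K := by
  have : CharZero K := charZero_of_injective_algebraMap (algebraMap F K).injective
  have ha' : algebraMap F K a ≠ 0 := by simpa using ha
  have hb' : algebraMap F K b ≠ 0 := by simpa using hb
  generalize hα : algebraMap F K a = α at *
  generalize hβ : algebraMap F K b = β at *
  let B : QuaternionAlgebra.Basis (Matrix (Fin 2) (Fin 2) K) a 0 b :=
    { i := !![0, α; 1, 0]
      j := !![u, -(α * v); v, -u]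
      k := !![α * v, -(α * u); u, -(α * v)]
      i_mul_i := by
        rw [zero_smul, add_zero, ← algebraMap_smul K a, ← algebraMap_smul K, hα]
        ext i j; fin_cases i <;> fin_cases j <;> simp [Matrix.mul_apply, Matrix.smul_apply]
      j_mul_j := by
        rw [← algebraMap_smul K b, hβ, h]
        ext i j; fin_cases i <;> fin_cases j <;> simp <;> ring
      i_mul_j := by
        ext i j; fin_cases i <;> fin_cases j <;> simp
      j_mul_i := by
        rw [zero_smul, zero_sub]
        ext i j; fin_cases i <;> fin_cases j <;> simp <;> ring }
  let f : K ⊗[F] Quat a b →ₐ[K] Matrix (Fin 2) (Fin 2) K :=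
    Algebra.TensorProduct.lift (Algebra.ofId K _) B.liftHom (fun x y => Algebra.commutes x _)
  let e := Algebra.TensorProduct.basis K (QuaternionAlgebra.basisOneIJK a 0 b)
  have hf : ∀ z, f z = e.repr z 0 • 1 + e.repr z 1 • B.i + e.repr z 2 • B.j + e.repr z 3 • B.k := by
    intro z
    conv_lhs => rw [← e.sum_repr z]
    rw [map_sum, Fin.sum_univ_four]
    simp only [map_smul, e, Algebra.TensorProduct.basis_apply, f]
    congr 1 <;> [congr 1; skip] <;> [congr 1; skip; skip] <;>
    · congr 1
      simp [QuaternionAlgebra.basisOneIJK, QuaternionAlgebra.Basis.liftHom,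
        QuaternionAlgebra.Basis.lift]
  have hinj : Function.Injective f := by
    refine (injective_iff_map_eq_zero f).2 fun z hz => ?_
    rw [hf] at hz
    refine e.repr.map_eq_zero_iff.1 ?_
    generalize e.repr z = c at hz
    have h00 := congrFun (congrFun hz 0) 0
    have h01 := congrFun (congrFun hz 0) 1
    have h10 := congrFun (congrFun hz 1) 0
    have h11 := congrFun (congrFun hz 1) 1
    simp [B] at h00 h01 h10 h11
    have c0 : c 0 = 0 := by linear_combination (h00 + h11) / 2
    have c1 : c 1 = 0 := by
      have : α * c 1 = 0 := by linear_combination (h01 + α * h10) / 2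
      exact (mul_eq_zero.1 this).resolve_left ha'
    have e1 : c 2 * u + c 3 * (α * v) = 0 := by linear_combination h00 - c0
    have e2 : c 2 * v + c 3 * u = 0 := by linear_combination h10 - c1
    have c2 : c 2 = 0 := by
      have : c 2 * β = 0 := by rw [h]; linear_combination u * e1 - α * v * e2
      exact (mul_eq_zero.1 this).resolve_right hb'
    have c3 : c 3 = 0 := by
      have : c 3 * β = 0 := by rw [h]; linear_combination u * e2 - v * e1
      exact (mul_eq_zero.1 this).resolve_right hb'
    ext i
    fin_cases i <;> assumption
  have hdim : Module.finrank K (K ⊗[F] Quat a b) =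
      Module.finrank K (Matrix (Fin 2) (Fin 2) K) := by
    rw [Module.finrank_baseChange, QuaternionAlgebra.finrank_eq_four]
    simp [Module.finrank_matrix]
  have hsurj : Function.Surjective f :=
    (LinearMap.injective_iff_surjective_of_finrank_eq_finrank (f := f.toLinearMap) hdim).1 hinj
  exact ⟨AlgEquiv.ofBijective f ⟨hinj, hsurj⟩⟩

theorem splitsOver_of_sq_left (ha : a ≠ 0) (hb : b ≠ 0) {r : K} (h : algebraMap F K a = r ^ 2) :
    SplitsOver a b K := by
  have : CharZero K := charZero_of_injective_algebraMap (algebraMap F K).injective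
  have hr : r ≠ 0 := by
    rintro rfl
    simp at h
    exact ha h
  -- The values solve `u - r v = 1` and `u + r v = b`, so `u ^ 2 - r ^ 2 v ^ 2 = b`.
  refine splitsOver_of_eq_norm ha hb (u := (algebraMap F K b + 1) / 2)
    (v := (algebraMap F K b - 1) / (2 * r)) ?_
  rw [h]
  field_simp
  ring

theorem splitsOver_of_sq_right (ha : a ≠ 0) (hb : b ≠ 0) {r : K} (h : algebraMap F K b = r ^ 2) :
    SplitsOver a b K :=
  splitsOver_of_eq_norm ha hb (u := r) (v := 0) (by rw [h]; ring)

/-- If the algebra does not split over `K`, its norm form is anisotropic over `K`. -/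
theorem eq_zero_of_norm_form_eq_zero (ha : a ≠ 0) (hb : b ≠ 0) (hs : ¬ SplitsOver a b K)
    {x₀ x₁ x₂ x₃ : K} (h : x₀ ^ 2 - algebraMap F K a * x₁ ^ 2 - algebraMap F K b * x₂ ^ 2 +
      algebraMap F K a * algebraMap F K b * x₃ ^ 2 = 0) :
    x₀ = 0 ∧ x₁ = 0 ∧ x₂ = 0 ∧ x₃ = 0 := by
  have hnorm := fun u v => mt (splitsOver_of_eq_norm (K := K) ha hb (u := u) (v := v)) hs
  have hsq := fun r => mt (splitsOver_of_sq_left (K := K) ha hb (r := r)) hs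
  generalize algebraMap F K a = α at *
  generalize algebraMap F K b = β at *
  have key : ∀ x y : K, x ^ 2 - α * y ^ 2 = 0 → x = 0 ∧ y = 0 := by
    intro x y hxy
    have hy : y = 0 := by
      by_contra hy
      refine hsq (x / y) ?_
      field_simp
      linear_combination -hxy
    subst hy
    simpa using hxy
  by_cases hN : x₂ ^ 2 - α * x₃ ^ 2 = 0
  · obtain ⟨rfl, rfl⟩ := key _ _ hN
    obtain ⟨rfl, rfl⟩ := key x₀ x₁ (by linear_combination h)
    simp
  · exfalso
    -- The equation says that `b` is the norm of `(x₀ + x₁ √a) / (x₂ + x₃ √a)`. These are the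
    -- coordinates of that quotient.
    refine hnorm ((x₀ * x₂ - α * x₁ * x₃) / (x₂ ^ 2 - α * x₃ ^ 2))
      ((x₁ * x₂ - x₀ * x₃) / (x₂ ^ 2 - α * x₃ ^ 2)) ?_
    field_simp
    linear_combination (-(x₂ ^ 2 - α * x₃ ^ 2)) * h

end Split

/-- The reduced norm of an invertible element is positive at the ramified real places. -/
theorem nrdU_mem_positiveUnits (ha : a ≠ 0) (hb : b ≠ 0) (x : (Quat a b)ˣ) :
    nrdU x ∈ positiveUnits a b := by
  intro w hw hs
  set σ := InfinitePlace.embedding_of_isReal hw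
  -- The completion is the real field, where a nonnegative element is a square. Ramification
  -- therefore forces `a` and `b` to be negative, and all four terms of the norm form become
  -- nonnegative.
  have hsqrt : ∀ c : F, 0 ≤ σ c → ∃ r : w.Completion, algebraMap F w.Completion c = r ^ 2 := by
    intro c hc
    let E := InfinitePlace.Completion.ringEquivRealOfIsReal hw
    refine ⟨E.symm (Real.sqrt (σ c)), E.injective ?_⟩
    rw [map_pow, E.apply_symm_apply, Real.sq_sqrt hc]
    exact InfinitePlace.Completion.extensionEmbeddingOfIsReal_coe hw _
  have hA : σ a < 0 := by
    by_contra! hc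
    obtain ⟨r, hr⟩ := hsqrt a hc
    exact hs (splitsOver_of_sq_left ha hb hr)
  have hB : σ b < 0 := by
    by_contra! hc
    obtain ⟨r, hr⟩ := hsqrt b hc
    exact hs (splitsOver_of_sq_right ha hb hr)
  have hx0 : σ (nrd (x : Quat a b)) ≠ 0 := by
    simpa using nrd_unit_ne_zero x
  refine lt_of_le_of_ne ?_ hx0.symm
  change 0 ≤ σ (nrd (x : Quat a b))
  rw [nrd_eq]
  simp only [map_add, map_sub, map_mul, map_pow]
  nlinarith [sq_nonneg (σ (x : Quat a b).re),
    mul_nonneg (neg_nonneg.2 hA.le) (sq_nonneg (σ (x : Quat a b).imI)),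
    mul_nonneg (neg_nonneg.2 hB.le) (sq_nonneg (σ (x : Quat a b).imJ)),
    mul_nonneg (mul_nonneg_of_nonpos_of_nonpos hA.le hB.le) (sq_nonneg (σ (x : Quat a b).imK))]

/-! ### Primes that do not split -/

section NonSplit

variable {p : HeightOneSpectrum (𝓞 F)}

/-- Hensel's lemma for `y ^ 2 - y + c`. -/
theorem exists_eq_sq_add {c : p.adicCompletion F} (hc : Valued.v c < 1) :
    ∃ y : p.adicCompletion F, y = y ^ 2 + c := by
  have hnorm : ∀ x y : p.adicCompletion F, ‖x‖ ≤ ‖y‖ ↔ Valued.v x ≤ Valued.v y := fun x y =>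
    Valued.toNormedField.norm_le_iff
  have hult : ∀ x y : p.adicCompletion F, ‖x‖ ≤ ‖c‖ → ‖y‖ ≤ ‖c‖ → ‖x + y‖ ≤ ‖c‖ := by
    intro x y hx hy
    rw [hnorm] at *
    exact (Valued.v.map_add _ _).trans (max_le hx hy)
  have hc1 : ‖c‖ < 1 := by
    rw [← norm_one (α := p.adicCompletion F), ← not_le, hnorm, not_le, map_one]
    exact hc
  -- Iteration of `y ↦ y ^ 2 + c` from `0` stays in the ball of radius `‖c‖`, where the map
  -- contracts distances by the factor `‖c‖ < 1`.
  let x : ℕ → p.adicCompletion F := fun n => Nat.rec 0 (fun _ y => y ^ 2 + c) n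
  have hx : ∀ n, x (n + 1) = x n ^ 2 + c := fun n => rfl
  have hle : ∀ n, ‖x n‖ ≤ ‖c‖ := by
    intro n
    induction n with
    | zero => simp [x]
    | succ n ih =>
      rw [hx]
      refine hult _ _ ?_ le_rfl
      rw [norm_pow, sq]
      exact (mul_le_mul ih (ih.trans hc1.le) (norm_nonneg _) (norm_nonneg _)).trans
        (mul_one _).le
  have hcauchy : CauchySeq x := by
    refine cauchySeq_of_le_geometric ‖c‖ ‖c‖ hc1 fun n => ?_
    induction n with
    | zero => simp [x]
    | succ n ih =>
      rw [dist_eq_norm, hx, hx (n + 1), show x n ^ 2 + c - (x (n + 1) ^ 2 + c) =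
        (x n - x (n + 1)) * (x n + x (n + 1)) by ring, norm_mul, pow_succ, ← mul_assoc]
      rw [dist_eq_norm] at ih
      exact mul_le_mul ih (hult _ _ (hle n) (hle (n + 1))) (norm_nonneg _) (by positivity)
  obtain ⟨y, hy⟩ := cauchySeq_tendsto_of_complete hcauchy
  refine ⟨y, tendsto_nhds_unique ((Filter.tendsto_add_atTop_iff_nat 1).2 hy) ?_⟩
  simp only [hx]
  exact (hy.pow 2).add_const c

theorem valued_algebraMap (x : F) :
    Valued.v (algebraMap F (p.adicCompletion F) x) = p.valuation F x :=
  HeightOneSpectrum.valuedAdicCompletion_eq_valuation' p x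

/-- Suppose the norm `n` is integral and the trace `t` is not. Then `n / t ^ 2` is small, and
Hensel's lemma gives a root `t y` of `X ^ 2 - t X + n` in the completion. Thus `x - t y` has norm
zero and vanishes by anisotropy, so `x` is a scalar. The trace of a scalar of integral norm is
integral, a contradiction. -/
theorem valuation_trd_le_one_of_not_splitsAt (ha : a ≠ 0) (hb : b ≠ 0) (hs : ¬ SplitsAt a b p)
    {x : Quat a b} (hx : p.valuation F (nrd x) ≤ 1) :
    p.valuation F (trd x) ≤ 1 := by
  by_contra! ht
  have ht0 : trd x ≠ 0 := by
    intro h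
    simp [h] at ht
  have ht0' : algebraMap F (p.adicCompletion F) (trd x) ≠ 0 := by simpa using ht0
  obtain ⟨y, hy⟩ := exists_eq_sq_add (p := p)
    (c := algebraMap F (p.adicCompletion F) (nrd x / trd x ^ 2)) (by
      rw [valued_algebraMap, map_div₀, map_pow]
      refine (div_lt_one₀ (pow_pos (zero_lt_one.trans ht) 2)).2 (hx.trans_lt ?_)
      exact one_lt_pow₀ ht two_ne_zero)
  have := eq_zero_of_norm_form_eq_zero (K := p.adicCompletion F) ha hb hs
    (x₀ := algebraMap F _ x.re - algebraMap F _ (trd x) * y)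
    (x₁ := algebraMap F _ x.imI) (x₂ := algebraMap F _ x.imJ) (x₃ := algebraMap F _ x.imK) (by
      have h1 := congrArg (algebraMap F (p.adicCompletion F)) (nrd_eq x)
      have h2 := congrArg (algebraMap F (p.adicCompletion F)) (trd_eq x)
      rw [map_div₀, map_pow] at hy
      have hy' : algebraMap F (p.adicCompletion F) (trd x) ^ 2 * y =
          algebraMap F (p.adicCompletion F) (trd x) ^ 2 * y ^ 2 + algebraMap F _ (nrd x) := by
        conv_lhs => rw [hy]
        field_simp
      simp only [map_add, map_sub, map_mul, map_pow, map_ofNat] at h1 h2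
      linear_combination -hy' - h1 + algebraMap F (p.adicCompletion F) (trd x) * y * h2)
  obtain ⟨-, h1, h2, h3⟩ := this
  simp only [map_eq_zero] at h1 h2 h3
  have hn : nrd x = x.re ^ 2 := by rw [nrd_eq, h1, h2, h3]; ring
  rw [hn, map_pow] at hx
  have hre : p.valuation F x.re ≤ 1 := by
    by_contra! h
    exact absurd (one_lt_pow₀ h two_ne_zero) hx.not_gt
  have h2 : p.valuation F 2 ≤ 1 := by
    have h : p.valuation F (algebraMap (𝓞 F) F 2) ≤ 1 := p.valuation_le_one 2
    rwa [map_ofNat (algebraMap (𝓞 F) F) 2] at h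
  rw [trd_eq, map_mul] at ht
  exact absurd (mul_le_one' h2 hre) ht.not_ge

theorem eq_zero_of_nrd_eq_zero (ha : a ≠ 0) (hb : b ≠ 0) (hs : ¬ SplitsAt a b p)
    {x : Quat a b} (hx : nrd x = 0) : x = 0 := by
  obtain ⟨h0, h1, h2, h3⟩ := eq_zero_of_norm_form_eq_zero (K := p.adicCompletion F) ha hb hs
    (x₀ := algebraMap F _ x.re)
    (x₁ := algebraMap F _ x.imI) (x₂ := algebraMap F _ x.imJ) (x₃ := algebraMap F _ x.imK) (by
      rw [nrd_eq] at hx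
      have := congrArg (algebraMap F (p.adicCompletion F)) hx
      simpa only [map_add, map_sub, map_mul, map_pow, map_zero] using this)
  simp only [map_eq_zero] at h0 h1 h2 h3
  ext <;> assumption

/-- Dividing by the summand of larger norm reduces to `nrd (1 + w) = 1 + trd w + nrd w`, where the
trace is integral by the previous lemma. Hence the elements of integral norm form a ring. -/
theorem valuation_nrd_add_le_one (ha : a ≠ 0) (hb : b ≠ 0) (hs : ¬ SplitsAt a b p)
    {x y : Quat a b} (hx : p.valuation F (nrd x) ≤ 1)
    (hy : p.valuation F (nrd y) ≤ 1) : p.valuation F (nrd (x + y)) ≤ 1 := by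
  wlog hxy : p.valuation F (nrd x) ≤ p.valuation F (nrd y) generalizing x y
  · rw [add_comm]
    exact this hy hx (le_of_not_ge hxy)
  by_cases hy0 : nrd y = 0
  · rw [eq_zero_of_nrd_eq_zero ha hb hs hy0, add_zero]
    exact hx
  let u := unitOf y hy0
  set w := x * ((u⁻¹ : (Quat a b)ˣ) : Quat a b)
  have hw : p.valuation F (nrd w) ≤ 1 := by
    rw [map_mul, nrd_unit_inv, map_mul, map_inv₀]
    exact mul_inv_le_one_of_le₀ hxy zero_le
  have : x + y = (1 + w) * y := by
    have : w * y = x := by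
      change x * _ * (u : Quat a b) = x
      rw [mul_assoc, Units.inv_mul, mul_one]
    rw [add_mul, one_mul, this, add_comm]
  rw [this, map_mul, map_mul, nrd_one_add]
  refine mul_le_one' ?_ hy
  refine (Valuation.map_add _ _ _).trans (max_le ((Valuation.map_add _ _ _).trans (max_le ?_ ?_)) hw)
  · simp
  · exact valuation_trd_le_one_of_not_splitsAt ha hb hs hw

/-- At a prime that does not split, a maximal order consists of the elements of integral norm. -/
theorem mem_ordLoc_of_not_splitsAt (ha : a ≠ 0) (hb : b ≠ 0) (hs : ¬ SplitsAt a b p)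
    {O : Subalgebra (𝓞 F) (Quat a b)} (hO : IsMaximalOrder O)
    {x : Quat a b} (hx : p.valuation F (nrd x) ≤ 1) : x ∈ ordLoc p O := by
  -- The ring of elements with integral norm contains `O` and has integral traces, so it lies in the
  -- dual of `O` and is bounded. Local maximality then applies.
  let S : Subalgebra (𝓞 F) (Quat a b) :=
    { carrier := {x | p.valuation F (nrd x) ≤ 1}
      mul_mem' := by
        intro x y hx hy
        simp only [Set.mem_ofPred_eq, map_mul] at *
        exact mul_le_one' hx hy
      add_mem' := fun hx hy => valuation_nrd_add_le_one ha hb hs hx hy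
      algebraMap_mem' := by
        intro r
        simp only [Set.mem_ofPred_eq]
        rw [IsScalarTower.algebraMap_apply (𝓞 F) F (Quat a b), nrd_algebraMap, map_pow]
        exact pow_le_one₀ zero_le (p.valuation_le_one r) }
  have hS : O ≤ S := fun x hx => valuation_nrd_le_one (p := p) hO.1 (le_loc hx)
  obtain ⟨t, ht, h⟩ := exists_smul_mem_of_trd ha hb hO.1 p
  refine le_ordLoc_of_isMaximalOrder hO hS ht (fun x hx => h x fun o ho => ?_) hx
  exact valuation_trd_le_one_of_not_splitsAt ha hb hs (S.mul_mem hx (hS ho))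

end NonSplit

/-! ### Distances in the Bruhat-Tits tree -/

section BruhatTits

variable {R K : Type*} [CommRing R] [Field K] [Algebra R K]

/-- The lattice spanned by a basis. -/
def BTLattice.ofBasis (R : Type*) {K : Type*} [CommRing R] [Field K] [Algebra R K]
    (e : Module.Basis (Fin 2) K (Fin 2 → K)) : BTLattice R K :=
  ⟨Submodule.span R {e 0, e 1}, Submodule.fg_span (Set.toFinite _), by
    rw [Submodule.span_span_of_tower, ← e.span_eq]
    congr 1
    ext x
    simp [eq_comm]⟩

theorem BTLattice.coe_ofBasis (e : Module.Basis (Fin 2) K (Fin 2 → K)) :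
    (BTLattice.ofBasis R e).1 = Submodule.span R {e 0, e 1} := rfl

/-- The basis `(w ^ m e₀, w ^ n e₁)`. -/
def scaleBasis (e : Module.Basis (Fin 2) K (Fin 2 → K)) (w : Kˣ) (m n : ℤ) :
    Module.Basis (Fin 2) K (Fin 2 → K) :=
  e.unitsSMul ![w ^ m, w ^ n]

theorem scaleBasis_zero (e : Module.Basis (Fin 2) K (Fin 2 → K)) (w : Kˣ) (m n : ℤ) :
    scaleBasis e w m n 0 = ((w : K) ^ m) • e 0 := by
  rw [scaleBasis, Module.Basis.unitsSMul_apply]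
  simp [Units.smul_def]

theorem scaleBasis_one (e : Module.Basis (Fin 2) K (Fin 2 → K)) (w : Kˣ) (m n : ℤ) :
    scaleBasis e w m n 1 = ((w : K) ^ n) • e 1 := by
  rw [scaleBasis, Module.Basis.unitsSMul_apply]
  simp [Units.smul_def]

theorem scaleBasis_scaleBasis (e : Module.Basis (Fin 2) K (Fin 2 → K)) (w : Kˣ) (m n m' n' : ℤ) :
    scaleBasis (scaleBasis e w m n) w m' n' = scaleBasis e w (m' + m) (n' + n) := by
  refine Module.Basis.eq_of_apply_eq fun i => ?_
  fin_cases i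
  · change scaleBasis _ w m' n' 0 = scaleBasis e w _ _ 0
    rw [scaleBasis_zero, scaleBasis_zero, scaleBasis_zero, smul_smul, zpow_add₀ w.ne_zero]
  · change scaleBasis _ w m' n' 1 = scaleBasis e w _ _ 1
    rw [scaleBasis_one, scaleBasis_one, scaleBasis_one, smul_smul, zpow_add₀ w.ne_zero]

theorem scaleBasis_zero_zero (e : Module.Basis (Fin 2) K (Fin 2 → K)) (w : Kˣ) :
    scaleBasis e w 0 0 = e := by
  refine Module.Basis.eq_of_apply_eq fun i => ?_
  fin_cases i
  · change scaleBasis _ w 0 0 0 = e 0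
    rw [scaleBasis_zero, zpow_zero, one_smul]
  · change scaleBasis _ w 0 0 1 = e 1
    rw [scaleBasis_one, zpow_zero, one_smul]

theorem mem_ofBasis {e : Module.Basis (Fin 2) K (Fin 2 → K)} {x : Fin 2 → K} :
    x ∈ (BTLattice.ofBasis R e).1 ↔ ∀ i, e.repr x i ∈ (algebraMap R K).range := by
  rw [BTLattice.ofBasis, Submodule.mem_span_pair]
  constructor
  · rintro ⟨r, s, rfl⟩ i
    have h : e.repr (r • e 0 + s • e 1) i =
        algebraMap R K r * e.repr (e 0) i + algebraMap R K s * e.repr (e 1) i := by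
      rw [← algebraMap_smul K r, ← algebraMap_smul K s, map_add, map_smul, map_smul]
      rfl
    rw [h]
    fin_cases i <;> simp
  · intro h
    obtain ⟨r, hr⟩ := h 0
    obtain ⟨s, hs⟩ := h 1
    refine ⟨r, s, ?_⟩
    rw [← algebraMap_smul K r, ← algebraMap_smul K s, hr, hs]
    have := e.sum_repr x
    rwa [Fin.sum_univ_two] at this

theorem repr_scaleBasis (e : Module.Basis (Fin 2) K (Fin 2 → K)) (w : Kˣ) (m n : ℤ)
    (x : Fin 2 → K) : (scaleBasis e w m n).repr x 0 = (w : K) ^ (-m) * e.repr x 0 ∧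
      (scaleBasis e w m n).repr x 1 = (w : K) ^ (-n) * e.repr x 1 := by
  simp [scaleBasis, Module.Basis.repr_unitsSMul, Units.smul_def]

theorem smul_mem_ofBasis {e : Module.Basis (Fin 2) K (Fin 2 → K)} {x : Fin 2 → K} {c : K}
    (hc : c ∈ (algebraMap R K).range) (hx : x ∈ (BTLattice.ofBasis R e).1) :
    c • x ∈ (BTLattice.ofBasis R e).1 := by
  rw [mem_ofBasis] at *
  intro i
  simpa using mul_mem hc (hx i)

theorem ofBasis_le_iff {e f : Module.Basis (Fin 2) K (Fin 2 → K)} {c : K} :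
    (∀ x ∈ (BTLattice.ofBasis R e).1, c • x ∈ (BTLattice.ofBasis R f).1) ↔
      ∀ i, c • e i ∈ (BTLattice.ofBasis R f).1 := by
  constructor
  · intro h i
    refine h _ (mem_ofBasis.2 fun j => ?_)
    by_cases hij : i = j <;> simp [hij]
  · intro h x hx
    rw [mem_ofBasis] at hx
    rw [← e.sum_repr x, Finset.smul_sum]
    refine Submodule.sum_mem _ fun i _ => ?_
    rw [smul_comm]
    exact smul_mem_ofBasis (hx i) (h i)

variable (R) in
/-- A uniformizer of `R`, as a unit of `K`. -/
def IsUnif (w : Kˣ) : Prop := ∃ ϖ : R, Irreducible ϖ ∧ algebraMap R K ϖ = w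

/-! ### Adapted bases and distances over a discrete valuation ring. -/

section DVR

variable [IsDomain R] [IsDiscreteValuationRing R] [IsFractionRing R K]

variable (R K) in
theorem exists_isUnif : ∃ w : Kˣ, IsUnif R w := by
  obtain ⟨ϖ, h⟩ := IsDiscreteValuationRing.exists_irreducible R
  have : algebraMap R K ϖ ≠ 0 := by simpa using h.ne_zero
  exact ⟨Units.mk0 _ this, ϖ, h, rfl⟩

theorem IsUnif.zpow_mem {w : Kˣ} (hw : IsUnif R w) {k : ℤ} :
    (w : K) ^ k ∈ (algebraMap R K).range ↔ 0 ≤ k := by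
  obtain ⟨ϖ, h, hϖ⟩ := hw
  constructor
  · rintro ⟨r, hr⟩
    by_contra! hk
    obtain ⟨l, hl⟩ : ∃ l : ℕ, k = -(l + 1 : ℤ) := ⟨(-k - 1).toNat, by omega⟩
    replace hr : algebraMap R K (r * ϖ ^ (l + 1)) = algebraMap R K 1 := by
      rw [map_mul, hr, map_pow, hϖ, map_one, ← zpow_natCast, ← zpow_add₀ w.ne_zero, hl]
      simp
    have := IsFractionRing.injective R K hr
    rw [pow_succ, ← mul_assoc] at this
    exact h.not_isUnit (IsUnit.of_mul_eq_one_right _ this)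
  · intro hk
    lift k to ℕ using hk
    exact ⟨ϖ ^ k, by rw [map_pow, hϖ, zpow_natCast]⟩

theorem IsUnif.exists_eq {w : Kˣ} (hw : IsUnif R w) {c : K} (hc : c ≠ 0) :
    ∃ (u : Rˣ) (k : ℤ), c = algebraMap R K u * (w : K) ^ k := by
  obtain ⟨ϖ, h, hϖ⟩ := hw
  obtain ⟨r, s, hs, rfl⟩ := IsFractionRing.div_surjective (A := R) c
  have hs0 : s ≠ 0 := nonZeroDivisors.ne_zero hs
  have hr0 : r ≠ 0 := by rintro rfl; simp at hc
  obtain ⟨m, u, rfl⟩ := IsDiscreteValuationRing.eq_unit_mul_pow_irreducible hr0 h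
  obtain ⟨n, v, rfl⟩ := IsDiscreteValuationRing.eq_unit_mul_pow_irreducible hs0 h
  refine ⟨u / v, m - n, ?_⟩
  have hv : algebraMap R K (v : R) ≠ 0 := by simp
  have huv : algebraMap R K ((u / v : Rˣ) : R) = algebraMap R K u / algebraMap R K v := by
    rw [eq_div_iff hv, ← map_mul, ← Units.val_mul, div_mul_cancel]
  rw [huv, zpow_sub₀ w.ne_zero, zpow_natCast, zpow_natCast, ← hϖ]
  simp only [map_mul, map_pow]
  rw [mul_div_mul_comm]

theorem IsUnif.zpow_mul_mem {w : Kˣ} (hw : IsUnif R w) {k l : ℤ} {c : K}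
    (h : (w : K) ^ k * c ∈ (algebraMap R K).range) (hkl : k ≤ l) :
    (w : K) ^ l * c ∈ (algebraMap R K).range := by
  have := mul_mem (hw.zpow_mem.2 (sub_nonneg.2 hkl)) h
  rwa [← mul_assoc, ← zpow_add₀ w.ne_zero, sub_add_cancel] at this

theorem eq_span_of_lattice_basis {M : Submodule R (Fin 2 → K)} (d : Module.Basis (Fin 2) R M) :
    M = Submodule.span R {(d 0 : Fin 2 → K), (d 1 : Fin 2 → K)} := by
  have h := congrArg (Submodule.map M.subtype) d.span_eq
  rw [Submodule.map_span, Submodule.map_top, Submodule.range_subtype] at h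
  refine h.symm.trans (congrArg _ ?_)
  ext x
  simp [eq_comm]

theorem exists_basis_of_lattice_basis {M : Submodule R (Fin 2 → K)} [Submodule.IsLattice K M]
    (d : Module.Basis (Fin 2) R M) :
    ∃ e : Module.Basis (Fin 2) K (Fin 2 → K), ∀ i, e i = d i :=
  ⟨d.extendOfIsLattice K, fun i => d.extendOfIsLattice_apply (K := K) i⟩

theorem exists_ofBasis_eq (L : BTLattice R K) :
    ∃ e : Module.Basis (Fin 2) K (Fin 2 → K), L = BTLattice.ofBasis R e := by
  have : Submodule.IsLattice K L.1 := ⟨L.2.1, L.2.2⟩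
  let b := Module.finBasisOfFinrankEq R L.1 (n := 2) (Submodule.IsLattice.finrank_of_pi (K := K) L.1)
  obtain ⟨e, he⟩ := exists_basis_of_lattice_basis (K := K) b
  refine ⟨e, Subtype.ext ?_⟩
  rw [BTLattice.coe_ofBasis, he, he]
  exact eq_span_of_lattice_basis b

/-- Elementary divisors. -/
theorem exists_elementary_divisors {w : Kˣ} (hw : IsUnif R w) (L L' : BTLattice R K) :
    ∃ (e : Module.Basis (Fin 2) K (Fin 2 → K)) (m n : ℤ),
      L = BTLattice.ofBasis R e ∧ L' = BTLattice.ofBasis R (scaleBasis e w m n) := by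
  have : Submodule.IsLattice K L.1 := ⟨L.2.1, L.2.2⟩
  have : Submodule.IsLattice K L'.1 := ⟨L'.2.1, L'.2.2⟩
  obtain ⟨f, hf⟩ := exists_ofBasis_eq L
  obtain ⟨f', hf'⟩ := exists_ofBasis_eq L'
  classical
  -- Smith normal form concerns sublattices, so `L'` is first multiplied by `r` into `L`. Dividing
  -- the invariant factors by `r` afterwards allows negative exponents.
  obtain ⟨r, hr, hrL⟩ : ∃ r : R, r ≠ 0 ∧ ∀ x ∈ L'.1, r • x ∈ L.1 := by
    obtain ⟨⟨r, hr⟩, h⟩ := IsLocalization.exist_integer_multiples_of_finset (nonZeroDivisors R)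
      (Finset.univ.image fun ij : Fin 2 × Fin 2 => f.repr (f' ij.1) ij.2)
    refine ⟨r, nonZeroDivisors.ne_zero hr, fun x hx => ?_⟩
    rw [hf] at *
    rw [hf'] at hx
    rw [← algebraMap_smul K r]
    revert x
    rw [ofBasis_le_iff]
    intro i
    rw [mem_ofBasis]
    intro j
    obtain ⟨y, hy⟩ := h _ (Finset.mem_image_of_mem _ (Finset.mem_univ (i, j)))
    refine ⟨y, ?_⟩
    rw [hy, map_smul, Finsupp.smul_apply]
    exact algebra_compatible_smul K r _
  let φ : L'.1 →ₗ[R] L.1 := ((LinearMap.lsmul R (Fin 2 → K) r).restrict hrL)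
  have hφ : Function.Injective φ := by
    intro x y hxy
    have h1 : r • x.1 = r • y.1 := congrArg Subtype.val hxy
    rw [← algebraMap_smul K r, ← algebraMap_smul K r y.1] at h1
    exact Subtype.ext (smul_right_injective _ (by simpa using hr) h1)
  obtain ⟨b', a, ab', hab⟩ := Submodule.exists_smith_normal_form_of_rank_eq
    (N := LinearMap.range φ)
    (Module.finBasisOfFinrankEq R L.1 (n := 2) (Submodule.IsLattice.finrank_of_pi (K := K) L.1)) (by
      rw [LinearMap.finrank_range_of_inj hφ, Submodule.IsLattice.finrank_of_pi (K := K),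
        Submodule.IsLattice.finrank_of_pi (K := K)])
  have ha : ∀ i, a i ≠ 0 := by
    intro i hi
    have := hab i
    rw [hi, zero_smul] at this
    exact ab'.ne_zero i (Subtype.ext this)
  let c := ab'.map (LinearEquiv.ofInjective φ hφ).symm
  have hc : ∀ i, r • (c i : Fin 2 → K) = a i • (b' i : Fin 2 → K) := by
    intro i
    have h1 : φ (c i) = ab' i := by
      rw [Module.Basis.map_apply, ← LinearEquiv.ofInjective_apply (h := hφ),
        LinearEquiv.apply_symm_apply]
    rw [hab] at h1
    exact congrArg Subtype.val h1
  have hr' : algebraMap R K r ≠ 0 := by simpa using hr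
  choose u k huk using fun i => hw.exists_eq (c := algebraMap R K (a i) / algebraMap R K r)
    (div_ne_zero (by simpa using ha i) hr')
  have hc' : ∀ i, (c i : Fin 2 → K) = (u i : R) • (w : K) ^ k i • (b' i : Fin 2 → K) := by
    intro i
    rw [← algebraMap_smul K (u i : R), smul_smul, ← huk, div_eq_inv_mul, mul_smul,
      algebraMap_smul, ← hc, ← algebraMap_smul K r, smul_smul, inv_mul_cancel₀ hr', one_smul]
  obtain ⟨e, he⟩ := exists_basis_of_lattice_basis (K := K) b'
  refine ⟨e, k 0, k 1, Subtype.ext ?_, Subtype.ext ?_⟩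
  · rw [BTLattice.coe_ofBasis, he, he]
    exact eq_span_of_lattice_basis b'
  · rw [BTLattice.coe_ofBasis, scaleBasis_zero, scaleBasis_one, he, he,
      eq_span_of_lattice_basis c, hc', hc', Submodule.span_insert, Submodule.span_insert,
      Submodule.span_singleton_smul_eq (u 0).isUnit, Submodule.span_singleton_smul_eq (u 1).isUnit]

/-- The scalars that are products `c c'` with `c L ⊆ L'` and `c' L' ⊆ L`. -/
def roundTrips (L L' : BTLattice R K) : Set K :=
  {z | ∃ c c', (∀ x ∈ L.1, c • x ∈ L'.1) ∧ (∀ x ∈ L'.1, c' • x ∈ L.1) ∧ z = c * c'}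

/-- A scalar `c` carries `L` into `L'` when its valuation is at least `max m n`, and `c'` carries
`L'` back when its valuation is at least `-min m n`. The products are thus the multiples of `w ^ |m
- n|`, which recovers `|m - n|` from data independent of the basis. -/
theorem roundTrips_ofBasis {w : Kˣ} (hw : IsUnif R w) (e : Module.Basis (Fin 2) K (Fin 2 → K))
    (m n : ℤ) (z : K) :
    z ∈ roundTrips (BTLattice.ofBasis R e) (BTLattice.ofBasis R (scaleBasis e w m n)) ↔
      (w : K) ^ (-((m - n).natAbs : ℤ)) * z ∈ (algebraMap R K).range := by
  have h1 : ∀ c : K, (∀ x ∈ (BTLattice.ofBasis R e).1,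
      c • x ∈ (BTLattice.ofBasis R (scaleBasis e w m n)).1) ↔
      (w : K) ^ (-max m n) * c ∈ (algebraMap R K).range := by
    intro c
    rw [ofBasis_le_iff]
    simp only [mem_ofBasis, Fin.forall_fin_two, repr_scaleBasis]
    simp
    constructor
    · rintro ⟨h1, h2⟩
      rw [← zpow_neg] at h1 h2
      rcases max_choice m n with h | h <;> rw [h, ← zpow_neg]
      exacts [h1, h2]
    · intro h
      rw [← zpow_neg] at *
      rw [← zpow_neg]
      exact ⟨hw.zpow_mul_mem h (neg_le_neg (le_max_left _ _)),
        hw.zpow_mul_mem h (neg_le_neg (le_max_right _ _))⟩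
  have h2 : ∀ c : K, (∀ x ∈ (BTLattice.ofBasis R (scaleBasis e w m n)).1,
      c • x ∈ (BTLattice.ofBasis R e).1) ↔
      (w : K) ^ (min m n) * c ∈ (algebraMap R K).range := by
    intro c
    rw [ofBasis_le_iff]
    simp only [mem_ofBasis, Fin.forall_fin_two, scaleBasis_zero, scaleBasis_one]
    simp
    simp only [mul_comm c]
    constructor
    · rintro ⟨h1, h2⟩
      rcases min_choice m n with h | h <;> rw [h]
      exacts [h1, h2]
    · intro h
      exact ⟨hw.zpow_mul_mem h (min_le_left _ _), hw.zpow_mul_mem h (min_le_right _ _)⟩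
  have hd : -((m - n).natAbs : ℤ) = -max m n + min m n := by omega
  rw [hd, zpow_add₀ w.ne_zero]
  constructor
  · rintro ⟨c, c', hc, hc', rfl⟩
    rw [h1] at hc
    rw [h2] at hc'
    have := mul_mem hc hc'
    convert! this using 1
    ring
  · intro h
    refine ⟨(w : K) ^ (max m n), (w : K) ^ (-max m n) * z, (h1 _).2 ?_, (h2 _).2 ?_, ?_⟩
    · rw [← zpow_add₀ w.ne_zero, neg_add_cancel, zpow_zero]
      exact one_mem _
    · convert! h using 1
      ring
    · rw [← mul_assoc, ← zpow_add₀ w.ne_zero, add_neg_cancel, zpow_zero, one_mul]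

theorem roundTrips_subset_of_homothetic {L M L' M' : BTLattice R K} (h : homothetic R K L M)
    (h' : homothetic R K L' M') : roundTrips L L' ⊆ roundTrips M M' := by
  obtain ⟨u, hu⟩ := h
  obtain ⟨v, hv⟩ := h'
  rintro _ ⟨c, c', hc, hc', rfl⟩
  have hu' : ∀ x, x ∈ M.1 ↔ (u : K)⁻¹ • x ∈ L.1 := by
    intro x
    rw [← SetLike.mem_coe, hu]
    constructor
    · rintro ⟨y, hy, rfl⟩
      simpa [smul_smul] using hy
    · intro h
      exact ⟨_, h, by simp [smul_smul]⟩
  have hv' : ∀ x, x ∈ M'.1 ↔ (v : K)⁻¹ • x ∈ L'.1 := by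
    intro x
    rw [← SetLike.mem_coe, hv]
    constructor
    · rintro ⟨y, hy, rfl⟩
      simpa [smul_smul] using hy
    · intro h
      exact ⟨_, h, by simp [smul_smul]⟩
  refine ⟨v * c * (u : K)⁻¹, u * c' * (v : K)⁻¹, fun x hx => ?_, fun x hx => ?_, ?_⟩
  · rw [hu'] at hx
    rw [hv', smul_smul, show (v : K)⁻¹ * (v * c * (u : K)⁻¹) = c * (u : K)⁻¹ by field_simp,
      mul_smul]
    exact hc _ hx
  · rw [hv'] at hx
    rw [hu', smul_smul, show (u : K)⁻¹ * (u * c' * (v : K)⁻¹) = c' * (v : K)⁻¹ by field_simp,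
      mul_smul]
    exact hc' _ hx
  · field_simp

theorem exists_le_of_roundTrips_subset {w w' : Kˣ} (hw : IsUnif R w) (hw' : IsUnif R w')
    {e e' : Module.Basis (Fin 2) K (Fin 2 → K)} {m n m' n' : ℤ}
    (h : roundTrips (BTLattice.ofBasis R e) (BTLattice.ofBasis R (scaleBasis e w m n)) ⊆
      roundTrips (BTLattice.ofBasis R e') (BTLattice.ofBasis R (scaleBasis e' w' m' n'))) :
    (m' - n').natAbs ≤ (m - n).natAbs := by
  have h1 := h ((roundTrips_ofBasis hw e m n ((w : K) ^ ((m - n).natAbs : ℤ))).2 (by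
    rw [← zpow_add₀ w.ne_zero, neg_add_cancel, zpow_zero]
    exact one_mem _))
  rw [roundTrips_ofBasis hw'] at h1
  obtain ⟨ϖ, hϖ, e1⟩ := hw
  obtain ⟨ϖ', hϖ', e2⟩ := id hw'
  obtain ⟨u, hu⟩ := IsDiscreteValuationRing.associated_of_irreducible R hϖ hϖ'
  have : (w' : K) ^ ((m - n).natAbs : ℤ) =
      (w : K) ^ ((m - n).natAbs : ℤ) * algebraMap R K ((u : R) ^ (m - n).natAbs) := by
    rw [← e1, ← e2, ← hu, map_mul, mul_zpow, zpow_natCast, zpow_natCast, map_pow]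
  have h2 := mul_mem h1 (show algebraMap R K ((u : R) ^ (m - n).natAbs) ∈ (algebraMap R K).range
    from ⟨_, rfl⟩)
  rw [mul_assoc, ← this, ← zpow_add₀ w'.ne_zero, hw'.zpow_mem] at h2
  omega

/-- The distance may be computed with any adapted basis. -/
theorem dist_ofBasis {w : Kˣ} (hw : IsUnif R w) (e : Module.Basis (Fin 2) K (Fin 2 → K))
    (m n : ℤ) :
    BTVertex.dist (Quotient.mk (homothetic R K) (BTLattice.ofBasis R e))
      (Quotient.mk (homothetic R K) (BTLattice.ofBasis R (scaleBasis e w m n))) =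
        (m - n).natAbs := by
  unfold BTVertex.dist
  set D := {d : ℕ | _}
  have hmem : (m - n).natAbs ∈ D := by
    obtain ⟨ϖ, hϖ, hw'⟩ := hw
    refine ⟨_, _, ϖ, e, m, n, rfl, rfl, hϖ, rfl, ?_, rfl⟩
    rw [BTLattice.coe_ofBasis, scaleBasis_zero, scaleBasis_one, hw']
  -- The set is nonempty by `hmem`, and every member equals `|m - n|`. Its infimum is therefore that
  -- value, and not the default `0` of an empty set.
  have hall : ∀ d ∈ D, d = (m - n).natAbs := by
    rintro d ⟨L, L', ϖ, e', m', n', h1, h2, hϖ, hL, hL', rfl⟩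
    have hϖ0 : algebraMap R K ϖ ≠ 0 := by simpa using hϖ.ne_zero
    have hw' : IsUnif R (Units.mk0 _ hϖ0) := ⟨ϖ, hϖ, rfl⟩
    have hL1 : L = BTLattice.ofBasis R e' := Subtype.ext hL
    have hL2 : L' = BTLattice.ofBasis R (scaleBasis e' (Units.mk0 _ hϖ0) m' n') := by
      refine Subtype.ext ?_
      rw [BTLattice.coe_ofBasis, scaleBasis_zero, scaleBasis_one]
      exact hL'
    subst hL1 hL2
    have h1' := Quotient.exact h1
    have h2' := Quotient.exact h2
    exact le_antisymm
      (exists_le_of_roundTrips_subset hw hw' (roundTrips_subset_of_homothetic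
        ((homothetic R K).symm h1') ((homothetic R K).symm h2')))
      (exists_le_of_roundTrips_subset hw' hw (roundTrips_subset_of_homothetic h1' h2'))
  exact hall _ (Nat.sInf_mem ⟨_, hmem⟩)

theorem exists_adapted_basis {w : Kˣ} (hw : IsUnif R w) (P Q : BTVertex R K) :
    ∃ (e : Module.Basis (Fin 2) K (Fin 2 → K)) (m n : ℤ),
      P = Quotient.mk (homothetic R K) (BTLattice.ofBasis R e) ∧
      Q = Quotient.mk (homothetic R K) (BTLattice.ofBasis R (scaleBasis e w m n)) := by
  induction P using Quotient.inductionOn with | _ L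
  induction Q using Quotient.inductionOn with | _ L'
  obtain ⟨e, m, n, rfl, rfl⟩ := exists_elementary_divisors hw L L'
  exact ⟨e, m, n, rfl, rfl⟩

theorem act_ofBasis (g : GL (Fin 2) K) (e : Module.Basis (Fin 2) K (Fin 2 → K)) :
    ∃ f : Module.Basis (Fin 2) K (Fin 2 → K),
      (∀ w m n, BTLattice.act g (BTLattice.ofBasis R (scaleBasis e w m n)) =
        BTLattice.ofBasis R (scaleBasis f w m n)) ∧
      ∀ i, f i = Matrix.toLin' (g : Matrix (Fin 2) (Fin 2) K) (e i) := by
  let E : (Fin 2 → K) ≃ₗ[K] (Fin 2 → K) := LinearEquiv.ofLinearMap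
    (Matrix.toLin' (g : Matrix (Fin 2) (Fin 2) K))
    (Matrix.toLin' ((g⁻¹ : GL (Fin 2) K) : Matrix (Fin 2) (Fin 2) K))
    (by rw [← Matrix.toLin'_mul, ← Units.val_mul, mul_inv_cancel, Units.val_one, Matrix.toLin'_one])
    (by rw [← Matrix.toLin'_mul, ← Units.val_mul, inv_mul_cancel, Units.val_one, Matrix.toLin'_one])
  have hE : ∀ x, E x = Matrix.toLin' (g : Matrix (Fin 2) (Fin 2) K) x := fun _ => rfl
  refine ⟨e.map E, fun w m n => Subtype.ext ?_, fun i => by simp [hE]⟩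
  rw [BTLattice.coe_ofBasis, BTLattice.act]
  simp only [BTLattice.coe_ofBasis, Submodule.map_span, Set.image_pair, scaleBasis_zero, scaleBasis_one,
    LinearMap.restrictScalars_apply, map_smul, Module.Basis.map_apply, hE]

/-- The action on the tree is by isometries. -/
theorem dist_act (g : GL (Fin 2) K) (P Q : BTVertex R K) : (P.act g).dist (Q.act g) = P.dist Q := by
  obtain ⟨w, hw⟩ := exists_isUnif R K
  obtain ⟨e, m, n, rfl, rfl⟩ := exists_adapted_basis hw P Q
  obtain ⟨f, hf, -⟩ := act_ofBasis (R := R) g e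
  rw [dist_ofBasis hw]
  have h0 := hf w 0 0
  rw [scaleBasis_zero_zero, scaleBasis_zero_zero] at h0
  change BTVertex.dist (Quotient.mk _ (BTLattice.act g _)) (Quotient.mk _ (BTLattice.act g _)) = _
  rw [h0, hf, dist_ofBasis hw]

/-- In a basis adapted to `P` and `Q`, with `Q` in position `(m, n)`, the step in the direction of
the larger exponent shortens the distance by one. -/
theorem exists_neighbour_towards {P Q : BTVertex R K} (h : P.dist Q ≠ 0) :
    ∃ P' : BTVertex R K, P.dist P' = 1 ∧ P.dist P' + P'.dist Q = P.dist Q := by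
  obtain ⟨w, hw⟩ := exists_isUnif R K
  obtain ⟨e, m, n, rfl, rfl⟩ := exists_adapted_basis hw P Q
  rw [dist_ofBasis hw] at *
  rcases le_total m n with hmn | hmn
  · refine ⟨Quotient.mk _ (BTLattice.ofBasis R (scaleBasis e w 0 1)), ?_⟩
    have : scaleBasis e w m n = scaleBasis (scaleBasis e w 0 1) w m (n - 1) := by
      rw [scaleBasis_scaleBasis]; simp
    rw [this, dist_ofBasis hw, dist_ofBasis hw]
    omega
  · refine ⟨Quotient.mk _ (BTLattice.ofBasis R (scaleBasis e w 1 0)), ?_⟩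
    have : scaleBasis e w m n = scaleBasis (scaleBasis e w 1 0) w (m - 1) n := by
      rw [scaleBasis_scaleBasis]; simp
    rw [this, dist_ofBasis hw, dist_ofBasis hw]
    omega

/-- The opposite step, lowering the coordinate with the larger exponent, lengthens the distance.
Together with the previous lemma it serves to locate `P₀`. -/
theorem exists_neighbour_away (P Q : BTVertex R K) :
    ∃ P' : BTVertex R K, P.dist P' = 1 ∧ P'.dist Q = P.dist Q + 1 := by
  obtain ⟨w, hw⟩ := exists_isUnif R K
  obtain ⟨e, m, n, rfl, rfl⟩ := exists_adapted_basis hw P Q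
  rw [dist_ofBasis hw]
  rcases le_total m n with hmn | hmn
  · refine ⟨Quotient.mk _ (BTLattice.ofBasis R (scaleBasis e w 0 (-1))), ?_⟩
    have : scaleBasis e w m n = scaleBasis (scaleBasis e w 0 (-1)) w m (n + 1) := by
      rw [scaleBasis_scaleBasis]; simp
    rw [this, dist_ofBasis hw, dist_ofBasis hw]
    omega
  · refine ⟨Quotient.mk _ (BTLattice.ofBasis R (scaleBasis e w (-1) 0)), ?_⟩
    have : scaleBasis e w m n = scaleBasis (scaleBasis e w (-1) 0) w (m + 1) n := by
      rw [scaleBasis_scaleBasis]; simp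
    rw [this, dist_ofBasis hw, dist_ofBasis hw]
    omega

theorem eq_of_dist_eq_zero {P Q : BTVertex R K} (h : P.dist Q = 0) : P = Q := by
  obtain ⟨w, hw⟩ := exists_isUnif R K
  obtain ⟨e, m, n, rfl, rfl⟩ := exists_adapted_basis hw P Q
  rw [dist_ofBasis hw] at h
  obtain rfl : m = n := by omega
  refine Quotient.sound ⟨w ^ m, ?_⟩
  ext x
  simp only [SetLike.mem_coe, Set.mem_image]
  constructor
  · intro hx
    refine ⟨(w : K) ^ (-m) • x, ?_, ?_⟩
    · rw [mem_ofBasis] at *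
      simp only [Fin.forall_fin_two, repr_scaleBasis] at hx
      simpa [Fin.forall_fin_two] using hx
    · simp only [Units.val_zpow_eq_zpow_val]
      rw [smul_smul, ← zpow_add₀ w.ne_zero, add_neg_cancel, zpow_zero, one_smul]
  · rintro ⟨y, hy, rfl⟩
    rw [mem_ofBasis] at *
    simp only [Fin.forall_fin_two, repr_scaleBasis]
    have hm : (w : K) ^ m ≠ 0 := zpow_ne_zero _ w.ne_zero
    simpa [Fin.forall_fin_two, hm] using hy

variable (R K) in
/-- The vertex of the standard lattice. -/
def stdVertex : BTVertex R K :=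
  Quotient.mk (homothetic R K) (BTLattice.ofBasis R (Pi.basisFun K (Fin 2)))

theorem det_mem_range {X : Matrix (Fin 2) (Fin 2) K}
    (h : ∀ i j, X i j ∈ (algebraMap R K).range) : X.det ∈ (algebraMap R K).range := by
  rw [Matrix.det_fin_two]
  exact sub_mem (mul_mem (h _ _) (h _ _)) (mul_mem (h _ _) (h _ _))

theorem exists_det_eq_unit {e f : Module.Basis (Fin 2) K (Fin 2 → K)}
    (h : BTLattice.ofBasis R e = BTLattice.ofBasis R f) :
    ∃ u : Rˣ, (e.toMatrix f).det = algebraMap R K u := by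
  have key : ∀ e f : Module.Basis (Fin 2) K (Fin 2 → K),
      BTLattice.ofBasis R e = BTLattice.ofBasis R f →
      (e.toMatrix f).det ∈ (algebraMap R K).range := by
    intro e f h
    refine det_mem_range fun i j => ?_
    have : f j ∈ (BTLattice.ofBasis R e).1 := by
      rw [h, mem_ofBasis]
      intro i
      by_cases hij : j = i <;> simp [hij]
    exact mem_ofBasis.1 this i
  obtain ⟨r, hr⟩ := key e f h
  obtain ⟨s, hs⟩ := key f e h.symm
  have hrs : r * s = 1 := by
    apply IsFractionRing.injective R K
    rw [map_mul, hr, hs, ← Matrix.det_mul, Module.Basis.toMatrix_mul_toMatrix_flip,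
      Matrix.det_one, map_one]
  exact ⟨⟨r, s, hrs, by rw [mul_comm, hrs]⟩, hr.symm⟩

/-- The position of the lattice `X R ^ 2` relative to `R ^ 2`. -/
theorem exists_dist_stdVertex {w : Kˣ} (hw : IsUnif R w) (X : GL (Fin 2) K) :
    ∃ (m n : ℤ) (u : Rˣ), (stdVertex R K).dist ((stdVertex R K).act X) = (m - n).natAbs ∧
      (X : Matrix (Fin 2) (Fin 2) K).det = algebraMap R K u * (w : K) ^ (m + n) ∧
      ∀ k : ℤ, (∀ i j, (w : K) ^ (-k) * X i j ∈ (algebraMap R K).range) ↔ k ≤ m ∧ k ≤ n := by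
  obtain ⟨f, hf, hfX⟩ := act_ofBasis (R := R) X (Pi.basisFun K (Fin 2))
  have h0 := hf w 0 0
  rw [scaleBasis_zero_zero, scaleBasis_zero_zero] at h0
  obtain ⟨e, m, n, he, he'⟩ := exists_elementary_divisors hw
    (BTLattice.ofBasis R (Pi.basisFun K (Fin 2))) (BTLattice.ofBasis R f)
  obtain ⟨u, hu⟩ := exists_det_eq_unit he
  obtain ⟨v, hv⟩ := exists_det_eq_unit he'.symm
  refine ⟨m, n, u * v, ?_, ?_, fun k => ?_⟩
  · change BTVertex.dist (Quotient.mk _ _) (Quotient.mk _ (BTLattice.act X _)) = _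
    rw [h0, he', he, dist_ofBasis hw]
  · have hX : (X : Matrix (Fin 2) (Fin 2) K) = (Pi.basisFun K (Fin 2)).toMatrix f := by
      ext i j
      simp [Module.Basis.toMatrix_apply, hfX]
    have hs : (e.toMatrix (scaleBasis e w m n)).det = (w : K) ^ (m + n) := by
      rw [Matrix.det_fin_two]
      simp [Module.Basis.toMatrix_apply, scaleBasis_zero, scaleBasis_one, zpow_add₀ w.ne_zero]
    -- The change of basis passes through `e` and its scaled form. The two outer factors relate
    -- bases of one and the same lattice and have unit determinant.
    rw [hX, ← Module.Basis.toMatrix_mul_toMatrix _ e, Matrix.det_mul, hu,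
      ← Module.Basis.toMatrix_mul_toMatrix _ (scaleBasis e w m n), Matrix.det_mul, hv, hs]
    rw [Units.val_mul, map_mul]
    ring
  · have h1 : (∀ i j, (w : K) ^ (-k) * X i j ∈ (algebraMap R K).range) ↔
        ∀ x ∈ (BTLattice.ofBasis R f).1,
          (w : K) ^ (-k) • x ∈ (BTLattice.ofBasis R (Pi.basisFun K (Fin 2))).1 := by
      rw [ofBasis_le_iff, forall_comm]
      refine forall_congr' fun j => ?_
      rw [mem_ofBasis]
      simp [hfX]
    rw [h1, he, he', ofBasis_le_iff]
    simp only [mem_ofBasis, Fin.forall_fin_two, scaleBasis_zero, scaleBasis_one]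
    rw [← sub_nonneg (b := k), ← sub_nonneg (b := k), ← hw.zpow_mem, ← hw.zpow_mem]
    simp [zpow_sub₀ w.ne_zero, div_eq_inv_mul]

end DVR

end BruhatTits

/-! ### Matrix representations at a split prime -/

section Split

variable {p : HeightOneSpectrum (𝓞 F)} {O : Subalgebra (𝓞 F) (Quat a b)}

theorem exists_valued_sub_lt (c : p.adicCompletion F) {γ : WithZero (Multiplicative ℤ)}
    (hγ : γ ≠ 0) : ∃ x : F, Valued.v (algebraMap F (p.adicCompletion F) x - c) < γ := by
  obtain ⟨r, hr⟩ := HeightOneSpectrum.valuedAdicCompletion_surjective F p γ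
  have hr0 : r ≠ 0 := by
    rintro rfl
    exact hγ (by rw [← hr, map_zero])
  have ho : IsOpen {y : p.adicCompletion F | Valued.v (y - c) < γ} := by
    have h := (Valued.isOpen_ball (p.adicCompletion F) (Valued.v.restrict r)).preimage
      (f := fun y : p.adicCompletion F => y - c) (by fun_prop)
    simpa [Valuation.restrict_lt_iff, hr] using h
  obtain ⟨x, hx⟩ := (HeightOneSpectrum.denseRange_algebraMap (K := F) p).exists_mem_open ho
    ⟨c, by simpa using zero_lt_iff.2 hγ⟩
  exact ⟨x, hx⟩

/-- The representation attached to a splitting. -/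
def rep (ι : (p.adicCompletion F ⊗[F] Quat a b) ≃ₐ[p.adicCompletion F]
    Matrix (Fin 2) (Fin 2) (p.adicCompletion F)) :
    Quat a b →ₐ[F] Matrix (Fin 2) (Fin 2) (p.adicCompletion F) :=
  (ι.toAlgHom.restrictScalars F).comp Algebra.TensorProduct.includeRight

variable (ι : (p.adicCompletion F ⊗[F] Quat a b) ≃ₐ[p.adicCompletion F]
    Matrix (Fin 2) (Fin 2) (p.adicCompletion F))

theorem rep_apply (x : Quat a b) : rep ι x = ι (1 ⊗ₜ x) := rfl

theorem exists_eq_algebraMap_of_rep {x : Quat a b} {l : p.adicCompletion F}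
    (h : rep ι x = l • 1) : ∃ c : F, x = algebraMap F _ c := by
  have h1 : (1 : p.adicCompletion F) ⊗ₜ[F] x = l ⊗ₜ[F] (1 : Quat a b) := by
    apply ι.injective
    rw [← rep_apply, h, ← mul_one l, ← smul_eq_mul, ← TensorProduct.smul_tmul', map_smul,
      ← Algebra.TensorProduct.one_def, map_one]
    simp
  have h2 := fun i => DFunLike.congr_fun (congrArg
    (Algebra.TensorProduct.basis (p.adicCompletion F) (QuaternionAlgebra.basisOneIJK a 0 b)).repr h1) i
  refine ⟨x.re, ?_⟩
  have e1 := h2 1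
  have e2 := h2 2
  have e3 := h2 3
  simp [QuaternionAlgebra.coe_basisOneIJK_repr] at e1 e2 e3
  ext <;> simp [e1, e2, e3]

theorem mul_self_fin_two {R : Type*} [CommRing R] (X : Matrix (Fin 2) (Fin 2) R) :
    X * X = X.trace • X - X.det • 1 := by
  ext i j
  fin_cases i <;> fin_cases j <;>
    simp [Matrix.mul_apply, Matrix.trace_fin_two, Matrix.det_fin_two] <;> ring

/-- The matrix is annihilated both by its characteristic polynomial and by `X ^ 2 - trd X + nrd`. If
it is not scalar, the two monic quadratics must agree; if it is, `x` lies in `F` and the values are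
computed. -/
theorem rep_trd_nrd (x : Quat a b) :
    (rep ι x).trace = algebraMap F _ (trd x) ∧ (rep ι x).det = algebraMap F _ (nrd x) := by
  by_cases hx : ∃ l : p.adicCompletion F, rep ι x = l • 1
  · obtain ⟨l, hl⟩ := hx
    obtain ⟨c, rfl⟩ := exists_eq_algebraMap_of_rep ι hl
    rw [AlgHom.commutes, nrd_algebraMap, trd_eq]
    simp [Matrix.trace_fin_two, Matrix.det_fin_two, Matrix.algebraMap_matrix_apply, sq, two_mul]
  · have h := congrArg (rep ι) (sq_eq x)
    rw [map_mul, map_sub, map_smul, AlgHom.commutes] at h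
    set X := rep ι x with hX
    set t := algebraMap F (p.adicCompletion F) (trd x) with ht
    set n := algebraMap F (p.adicCompletion F) (nrd x) with hn
    have hc := mul_self_fin_two X
    have h' : (t - X.trace) • X = (n - X.det) • 1 := by
      have h3 : X * X = t • X - n • 1 := by
        rw [h, ht, algebraMap_smul, hn, Algebra.algebraMap_eq_smul_one, algebraMap_smul]
      rw [h3] at hc
      rw [sub_smul, sub_smul, sub_eq_sub_iff_sub_eq_sub, hc]
    have htr : t - X.trace = 0 := by
      by_contra hne
      refine hx ⟨(t - X.trace)⁻¹ * (n - X.det), ?_⟩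
      rw [mul_smul, ← h', smul_smul, inv_mul_cancel₀ hne, one_smul]
    rw [htr, zero_smul] at h'
    have := congrFun (congrFun h' 0) 0
    simp at this
    exact ⟨(sub_eq_zero.1 htr).symm, (sub_eq_zero.1 this.symm).symm⟩

/-- Density of the algebra in the matrices. For a pure tensor the coefficient is approximated in
`F`, with a precision that absorbs the entries of the fixed matrix. -/
theorem exists_rep_sub_lt (M : Matrix (Fin 2) (Fin 2) (p.adicCompletion F))
    {γ : WithZero (Multiplicative ℤ)} (hγ : γ ≠ 0) :
    ∃ x : Quat a b, ∀ i j, Valued.v ((rep ι x - M) i j) < γ := by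
  obtain ⟨y, rfl⟩ := ι.surjective M
  induction y using TensorProduct.induction_on with
  | zero => exact ⟨0, by simpa using zero_lt_iff.2 hγ⟩
  | tmul c z =>
    let δ : Fin 2 → Fin 2 → WithZero (Multiplicative ℤ) := fun i j => Valued.v (rep ι z i j)
    obtain ⟨ε, hε, hεδ⟩ : ∃ ε ≠ 0, ∀ i j, ε * δ i j ≤ γ := by
      let μ : WithZero (Multiplicative ℤ) := max 1 (max (max (δ 0 0) (δ 0 1)) (max (δ 1 0) (δ 1 1)))
      have hμ : μ ≠ 0 := (lt_of_lt_of_le zero_lt_one (le_max_left _ _)).ne'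
      refine ⟨γ * μ⁻¹, mul_ne_zero hγ (inv_ne_zero hμ), fun i j => ?_⟩
      have : δ i j ≤ μ := by fin_cases i <;> fin_cases j <;> simp [μ]
      calc γ * μ⁻¹ * δ i j ≤ γ * μ⁻¹ * μ := by gcongr
        _ = γ := by rw [mul_assoc, inv_mul_cancel₀ hμ, mul_one]
    obtain ⟨d, hd⟩ := exists_valued_sub_lt c hε
    refine ⟨d • z, fun i j => ?_⟩
    have h1 : rep ι (d • z) - ι (c ⊗ₜ z) = (algebraMap F _ d - c) • rep ι z := by
      have h2 : ι (c ⊗ₜ z) = c • rep ι z := by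
        rw [rep_apply ι z, ← map_smul, TensorProduct.smul_tmul', smul_eq_mul, mul_one]
      rw [(rep ι).map_smul_of_tower, sub_smul, algebraMap_smul, h2]
    rw [h1, Matrix.smul_apply, smul_eq_mul, map_mul]
    rcases eq_or_ne (δ i j) 0 with h0 | h0
    · change _ * δ i j < γ
      rw [h0, mul_zero]
      exact zero_lt_iff.2 hγ
    · exact lt_of_lt_of_le (mul_lt_mul_of_pos_right hd (zero_lt_iff.2 h0)) (hεδ i j)
  | add y z hy hz =>
    obtain ⟨u, hu⟩ := hy
    obtain ⟨w, hw⟩ := hz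
    refine ⟨u + w, fun i j => ?_⟩
    rw [map_add, map_add, add_sub_add_comm, Matrix.add_apply]
    exact Valuation.map_add_lt _ (hu i j) (hw i j)

/-- A matrix with integral entries. -/
def IsIntegralMatrix (X : Matrix (Fin 2) (Fin 2) (p.adicCompletion F)) : Prop :=
  ∀ i j, Valued.v (X i j) ≤ 1

theorem valued_le_one_iff (x : p.adicCompletion F) : Valued.v x ≤ 1 ↔
    x ∈ (algebraMap (p.adicCompletionIntegers F) (p.adicCompletion F)).range :=
  ⟨fun h => ⟨⟨x, h⟩, rfl⟩, by rintro ⟨y, rfl⟩; exact y.2⟩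

theorem IsIntegralMatrix.mul {X Y : Matrix (Fin 2) (Fin 2) (p.adicCompletion F)}
    (hX : IsIntegralMatrix X) (hY : IsIntegralMatrix Y) : IsIntegralMatrix (X * Y) := fun i j => by
  rw [Matrix.mul_apply, Fin.sum_univ_two]
  refine Valuation.map_add_le _ ?_ ?_ <;> rw [map_mul] <;> exact mul_le_one' (hX _ _) (hY _ _)

theorem IsIntegralMatrix.add {X Y : Matrix (Fin 2) (Fin 2) (p.adicCompletion F)}
    (hX : IsIntegralMatrix X) (hY : IsIntegralMatrix Y) : IsIntegralMatrix (X + Y) := fun i j =>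
  Valuation.map_add_le _ (hX i j) (hY i j)

theorem IsIntegralMatrix.smul {X : Matrix (Fin 2) (Fin 2) (p.adicCompletion F)}
    (hX : IsIntegralMatrix X) {c : F} (hc : p.valuation F c ≤ 1) : IsIntegralMatrix (c • X) :=
  fun i j => by
  rw [Matrix.smul_apply, Algebra.smul_def, map_mul, valued_algebraMap]
  exact mul_le_one' hc (hX i j)

/-- Some conjugate of a splitting is integral on a given order. -/
theorem exists_conj_isIntegralMatrix (hO : IsOrder O) :
    ∃ (ι' : (p.adicCompletion F ⊗[F] Quat a b) ≃ₐ[p.adicCompletion F]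
      Matrix (Fin 2) (Fin 2) (p.adicCompletion F)) (h : GL (Fin 2) (p.adicCompletion F)),
      (∀ x, rep ι' x = (↑(h⁻¹) : Matrix (Fin 2) (Fin 2) (p.adicCompletion F)) * rep ι x * (h : Matrix (Fin 2) (Fin 2) (p.adicCompletion F))) ∧
      ∀ o ∈ O, IsIntegralMatrix (rep ι' o) := by
  classical
  obtain ⟨T, hT⟩ := hO.fg
  let E : Fin 2 → Fin 2 → p.adicCompletion F := fun k => Pi.single k 1
  -- `Λ` is the lattice generated by the images of the standard basis vectors under `O`. It is
  -- stable under `O`, which is therefore integral in any basis of `Λ`.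
  let Λ : Submodule (p.adicCompletionIntegers F) (Fin 2 → p.adicCompletion F) :=
    Submodule.span _ ((fun q : Quat a b × Fin 2 => Matrix.toLin' (rep ι q.1) (E q.2)) ''
      ((T : Set (Quat a b)) ×ˢ Set.univ))
  have hsm : ∀ (r : 𝓞 F) (v : Fin 2 → p.adicCompletion F), v ∈ Λ →
      (algebraMap F (p.adicCompletion F) (algebraMap (𝓞 F) F r)) • v ∈ Λ := by
    intro r v hv
    exact Λ.smul_mem (algebraMap (𝓞 F) (p.adicCompletionIntegers F) r) hv
  have hrs : ∀ (r : 𝓞 F) x, rep ι (r • x) =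
      (algebraMap F (p.adicCompletion F) (algebraMap (𝓞 F) F r)) • rep ι x := by
    intro r x
    rw [smul_algebra_eq, (rep ι).map_smul_of_tower,
      ← algebraMap_smul (p.adicCompletion F) (algebraMap (𝓞 F) F r)]
  have hmem : ∀ o ∈ O, ∀ k, Matrix.toLin' (rep ι o) (E k) ∈ Λ := by
    intro o ho k
    change o ∈ Subalgebra.toSubmodule O at ho
    rw [← hT] at ho
    induction ho using Submodule.span_induction with
    | mem x hx => exact Submodule.subset_span ⟨(x, k), ⟨hx, trivial⟩, rfl⟩
    | zero => simp
    | add x y _ _ hx hy =>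
      rw [map_add, map_add, LinearMap.add_apply]
      exact add_mem hx hy
    | smul r x _ hx =>
      rw [hrs, map_smul, LinearMap.smul_apply]
      exact hsm r _ hx
  have hTO : ∀ x ∈ T, x ∈ O := fun x hx => by
    change x ∈ Subalgebra.toSubmodule O
    rw [← hT]
    exact Submodule.subset_span hx
  have hΛ : ∀ o ∈ O, ∀ v ∈ Λ, Matrix.toLin' (rep ι o) v ∈ Λ := by
    intro o ho v hv
    induction hv using Submodule.span_induction with
    | mem v hv =>
      obtain ⟨⟨x, k⟩, ⟨hx, -⟩, rfl⟩ := hv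
      have := hmem (o * x) (O.mul_mem ho (hTO x hx)) k
      rwa [map_mul, Matrix.toLin'_mul] at this
    | zero => simp
    | add x y _ _ hx hy =>
      rw [map_add]
      exact add_mem hx hy
    | smul r x _ hx =>
      rw [LinearMap.map_smul_of_tower]
      exact Λ.smul_mem r hx
  have hE : ∀ k, E k ∈ Λ := fun k => by
    have := hmem 1 O.one_mem k
    rwa [map_one, Matrix.toLin'_one] at this
  obtain ⟨e, he⟩ := exists_ofBasis_eq (R := p.adicCompletionIntegers F) ⟨Λ, Submodule.fg_span
    ((T.finite_toSet.prod Set.finite_univ).image _), by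
      rw [eq_top_iff, ← (Pi.basisFun (p.adicCompletion F) (Fin 2)).span_eq]
      refine Submodule.span_mono ?_
      rintro _ ⟨k, rfl⟩
      rw [Pi.basisFun_apply]
      exact hE k⟩
  let h : GL (Fin 2) (p.adicCompletion F) :=
    ⟨(Pi.basisFun (p.adicCompletion F) (Fin 2)).toMatrix e, e.toMatrix (Pi.basisFun _ _),
      Module.Basis.toMatrix_mul_toMatrix_flip _ _, Module.Basis.toMatrix_mul_toMatrix_flip _ _⟩
  let ι' := ι.trans (MulSemiringAction.toAlgEquiv (p.adicCompletion F)
    (Matrix (Fin 2) (Fin 2) (p.adicCompletion F)) (ConjAct.toConjAct h⁻¹))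
  have hι' : ∀ x, rep ι' x = (↑(h⁻¹) : Matrix (Fin 2) (Fin 2) (p.adicCompletion F)) * rep ι x *
      (h : Matrix (Fin 2) (Fin 2) (p.adicCompletion F)) := by
    intro x
    change (ConjAct.toConjAct h⁻¹) • rep ι x = _
    rw [ConjAct.units_smul_def, ConjAct.ofConjAct_toConjAct, inv_inv]
  refine ⟨ι', h, hι', fun o ho i j => ?_⟩
  have h1 : rep ι' o = LinearMap.toMatrix e e (Matrix.toLin' (rep ι o)) := by
    rw [hι', ← basis_toMatrix_mul_linearMap_toMatrix_mul_basis_toMatrix e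
      (Pi.basisFun (p.adicCompletion F) (Fin 2)) e (Pi.basisFun (p.adicCompletion F) (Fin 2)),
      LinearMap.toMatrix_eq_toMatrix', LinearMap.toMatrix'_toLin']
    rfl
  rw [h1, LinearMap.toMatrix_apply, valued_le_one_iff]
  have h2 : e j ∈ (BTLattice.ofBasis (p.adicCompletionIntegers F) e).1 := by
    rw [mem_ofBasis]
    intro i
    by_cases hij : j = i <;> simp [hij]
  rw [← he] at h2
  have h3 := hΛ o ho _ h2
  have h4 : Matrix.toLin' (rep ι o) (e j) ∈ (BTLattice.ofBasis (p.adicCompletionIntegers F) e).1 := by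
    rw [← he]
    exact h3
  exact mem_ofBasis.1 h4 i

variable {ι}

/-- A representation that is integral on a maximal order detects it. -/
theorem mem_ordLoc_iff (ha : a ≠ 0) (hb : b ≠ 0) (hO : IsMaximalOrder O)
    (hι : ∀ o ∈ O, IsIntegralMatrix (rep ι o)) {x : Quat a b} :
    x ∈ ordLoc p O ↔ IsIntegralMatrix (rep ι x) := by
  have hr : ∀ (r : 𝓞 F), p.valuation F (algebraMap (𝓞 F) F r) ≤ 1 := p.valuation_le_one
  constructor
  · rintro ⟨s, hs, hx⟩
    have h1 := (hι _ hx).smul (c := (algebraMap (𝓞 F) F s)⁻¹)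
      (by rw [map_inv₀, valuation_eq_one_of_notMem hs, inv_one])
    have hs0 : algebraMap (𝓞 F) F s ≠ 0 := by
      intro h0
      have := valuation_eq_one_of_notMem (F := F) hs
      rw [h0, map_zero] at this
      exact zero_ne_one this
    rwa [smul_algebra_eq, (rep ι).map_smul_of_tower, inv_smul_smul₀ hs0] at h1
  · intro hx
    -- Elements with integral matrix form a ring containing `O`. Their products with `O` have
    -- integral trace, so the ring is bounded, and local maximality applies.
    let S : Subalgebra (𝓞 F) (Quat a b) :=
      { carrier := {x | IsIntegralMatrix (rep ι x)}
        mul_mem' := fun hx hy => by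
          rw [Set.mem_ofPred_eq, map_mul]
          exact IsIntegralMatrix.mul hx hy
        add_mem' := fun hx hy => by
          rw [Set.mem_ofPred_eq, map_add]
          exact IsIntegralMatrix.add hx hy
        algebraMap_mem' := fun r => hι _ (O.algebraMap_mem r) }
    obtain ⟨t, ht, h⟩ := exists_smul_mem_of_trd ha hb hO.1 p
    refine le_ordLoc_of_isMaximalOrder hO (S := S) hι ht (fun x hx => h x fun o ho => ?_) hx
    have h1 := hx.mul (hι o ho)
    rw [← map_mul] at h1
    rw [← valued_algebraMap, ← (rep_trd_nrd ι _).1, Matrix.trace_fin_two]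
    exact Valuation.map_add_le _ (h1 0 0) (h1 1 1)

/-- Matrix units can be approximated by elements of the order. -/
theorem exists_rep_sub_single_lt (ha : a ≠ 0) (hb : b ≠ 0) (hO : IsMaximalOrder O)
    (hι : ∀ o ∈ O, IsIntegralMatrix (rep ι o)) (i j : Fin 2)
    {γ : WithZero (Multiplicative ℤ)} (hγ : γ ≠ 0) :
    ∃ x ∈ ordLoc p O, ∀ k l, Valued.v ((rep ι x - Matrix.single i j (1 : p.adicCompletion F)) k l) < γ := by
  -- Precision at least `1` keeps `x` itself integral.
  obtain ⟨x, hx⟩ := exists_rep_sub_lt ι (Matrix.single i j 1) (γ := min γ 1)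
    (by rcases min_choice γ 1 with h | h <;> simp [h, hγ])
  refine ⟨x, (mem_ordLoc_iff ha hb hO hι).2 ?_, fun k l => (hx k l).trans_le (min_le_left _ _)⟩
  have h1 : IsIntegralMatrix (rep ι x - Matrix.single i j 1) := fun k l =>
    (hx k l).le.trans (min_le_right _ _)
  have h2 : IsIntegralMatrix (Matrix.single i j (1 : p.adicCompletion F)) := fun k l => by
    rw [Matrix.single_apply]
    split_ifs <;> simp
  have := h1.add h2
  rwa [sub_add_cancel] at this

end Split

/-! ### Local generators -/

section LocalGenerators

variable {p : HeightOneSpectrum (𝓞 F)} {O : Subalgebra (𝓞 F) (Quat a b)}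
  {I J : Submodule (𝓞 F) (Quat a b)}

theorem exists_ne_zero_forall_mul_le_one {α : Type*} [Finite α]
    (f : α → WithZero (Multiplicative ℤ)) : ∃ γ ≠ 0, ∀ i, γ * f i ≤ 1 := by
  cases nonempty_fintype α
  rcases isEmpty_or_nonempty α with h | h
  · exact ⟨1, one_ne_zero, fun i => h.elim i⟩
  obtain ⟨i, hi⟩ := Finite.exists_max f
  refine ⟨(max 1 (f i))⁻¹, inv_ne_zero (lt_of_lt_of_le zero_lt_one (le_max_left _ _)).ne', fun j => ?_⟩
  exact inv_mul_le_one_of_le₀ ((hi j).trans (le_max_right _ _)) zero_le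

/-- Membership in a maximal order, locally, through traces and norms. -/
theorem mem_ordLoc_of_trd_nrd (ha : a ≠ 0) (hb : b ≠ 0) (hO : IsMaximalOrder O) {z : Quat a b}
    (ht : ∀ o ∈ O, p.valuation F (trd (z * o)) ≤ 1) (hn : p.valuation F (nrd z) ≤ 1) :
    z ∈ ordLoc p O := by
  by_cases hs : SplitsAt a b p
  swap
  · exact mem_ordLoc_of_not_splitsAt ha hb hs hO hn
  obtain ⟨ι₀⟩ := hs
  obtain ⟨ι, -, -, hι⟩ := exists_conj_isIntegralMatrix ι₀ hO.1
  rw [mem_ordLoc_iff ha hb hO hι]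
  intro i j
  obtain ⟨γ, hγ, hγz⟩ := exists_ne_zero_forall_mul_le_one
    (fun q : Fin 2 × Fin 2 => Valued.v (rep ι z q.1 q.2))
  -- The entry `z i j` is the trace of `z` times the matrix unit at `(j, i)`, which is approximated
  -- by an element of `O` up to a `p`-unit. Only traces matter here; only the norm was used at a
  -- nonsplit prime.
  obtain ⟨x, ⟨s, hs, hsx⟩, hx⟩ := exists_rep_sub_single_lt ha hb hO hι j i hγ
  have h1 : Valued.v ((rep ι z * rep ι x).trace) ≤ 1 := by
    have h2 := ht _ hsx
    rw [mul_smul_comm, smul_algebra_eq, map_smul, smul_eq_mul, map_mul,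
      valuation_eq_one_of_notMem hs, one_mul] at h2
    rwa [← map_mul, (rep_trd_nrd ι _).1, valued_algebraMap]
  have h3 : Valued.v ((rep ι z * (rep ι x - Matrix.single j i (1 : p.adicCompletion F))).trace) ≤ 1 := by
    have : ∀ k l, Valued.v (rep ι z k l *
        (rep ι x - Matrix.single j i (1 : p.adicCompletion F)) l k) ≤ 1 := fun k l => by
      rw [map_mul, mul_comm]
      exact (mul_le_mul_left (hx l k).le _).trans (hγz (k, l))
    rw [Matrix.trace_fin_two, Matrix.mul_apply, Matrix.mul_apply, Fin.sum_univ_two, Fin.sum_univ_two]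
    exact Valuation.map_add_le _ (Valuation.map_add_le _ (this _ _) (this _ _))
      (Valuation.map_add_le _ (this _ _) (this _ _))
  have h4 : rep ι z i j = (rep ι z * rep ι x).trace -
      (rep ι z * (rep ι x - Matrix.single j i (1 : p.adicCompletion F))).trace := by
    rw [mul_sub, Matrix.trace_sub, sub_sub_cancel, Matrix.trace_mul_single]
    simp
  rw [h4]
  exact Valuation.map_sub_le _ h1 h3

/-- Elements that normalize a maximal order at a split prime. -/
theorem exists_nrd_eq_sq_of_conj (ha : a ≠ 0) (hb : b ≠ 0) (hO : IsMaximalOrder O)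
    {ι : (p.adicCompletion F ⊗[F] Quat a b) ≃ₐ[p.adicCompletion F]
      Matrix (Fin 2) (Fin 2) (p.adicCompletion F)}
    (hι : ∀ o ∈ O, IsIntegralMatrix (rep ι o)) {x : (Quat a b)ˣ}
    (hx : ∀ o ∈ O, ((x⁻¹ : (Quat a b)ˣ) : Quat a b) * o * x ∈ ordLoc p O) :
    ∃ i j, (∀ k l, Valued.v (rep ι x k l) ≤ Valued.v (rep ι x i j)) ∧
      p.valuation F (nrd (x : Quat a b)) = Valued.v (rep ι x i j) ^ 2 := by
  set X := rep ι (x : Quat a b) with hX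
  set Y := rep ι ((x⁻¹ : (Quat a b)ˣ) : Quat a b) with hY
  have hdet : Valued.v X.det = p.valuation F (nrd (x : Quat a b)) := by
    rw [(rep_trd_nrd ι _).2, valued_algebraMap]
  have hYX : Y * X = 1 := by rw [hX, hY, ← map_mul, Units.inv_mul, map_one]
  have hd0 : X.det ≠ 0 := by
    rw [(rep_trd_nrd ι _).2]
    simpa using nrd_unit_ne_zero x
  -- Conjugation is tested on approximations of the matrix units: the `(k, l)` entry of `Y E_ij X`
  -- is `Y k i * X j l`.
  have h1 : ∀ k i j l, Valued.v (Y k i * X j l) ≤ 1 := by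
    intro k i j l
    obtain ⟨γ, hγ, hγz⟩ := exists_ne_zero_forall_mul_le_one
      (fun q : Fin 2 × Fin 2 => Valued.v (Y k q.1 * X q.2 l))
    obtain ⟨o, ⟨s, hs, hso⟩, ho⟩ := exists_rep_sub_single_lt ha hb hO hι i j hγ
    have h2 : ((x⁻¹ : (Quat a b)ˣ) : Quat a b) * o * x ∈ ordLoc p O := by
      refine mem_loc_of_smul_mem hs ?_
      have := hx _ hso
      rwa [mul_smul_comm, smul_mul_assoc] at this
    have h3 := (mem_ordLoc_iff ha hb hO hι).1 h2 k l
    rw [map_mul, map_mul, ← hX, ← hY] at h3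
    have h4 : Y * rep ι o * X = Y * (rep ι o - Matrix.single i j (1 : p.adicCompletion F)) * X +
        Y * Matrix.single i j (1 : p.adicCompletion F) * X := by
      rw [← add_mul, ← mul_add, sub_add_cancel]
    have h5 : Valued.v ((Y * (rep ι o - Matrix.single i j (1 : p.adicCompletion F)) * X) k l) ≤ 1 := by
      have : ∀ u v, Valued.v (Y k u *
          (rep ι o - Matrix.single i j (1 : p.adicCompletion F)) u v * X v l) ≤ 1 := fun u v => by
        rw [mul_right_comm, map_mul, mul_comm]
        exact (mul_le_mul_left (ho u v).le _).trans (hγz (u, v))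
      rw [Matrix.mul_apply, Fin.sum_univ_two, Matrix.mul_apply, Matrix.mul_apply, Fin.sum_univ_two,
        Fin.sum_univ_two, add_mul, add_mul]
      exact Valuation.map_add_le _ (Valuation.map_add_le _ (this _ _) (this _ _))
        (Valuation.map_add_le _ (this _ _) (this _ _))
    have h6 : (Y * Matrix.single i j (1 : p.adicCompletion F) * X) k l = Y k i * X j l := by
      fin_cases i <;> fin_cases j <;> simp [Matrix.mul_apply, Matrix.single_apply]
    rw [← h6, eq_sub_of_add_eq' h4.symm]
    exact Valuation.map_sub_le _ h3 h5
  have hYe : Y = X.det⁻¹ • X.adjugate := by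
    rw [← Matrix.inv_eq_left_inv hYX, Matrix.inv_def, Ring.inverse_eq_inv']
  -- Since `Y` is the adjugate of `X` over its determinant, every product of two entries of `X` is
  -- bounded by the determinant. The reverse bound by the square of the largest entry is the
  -- determinant formula.
  have h2 : ∀ i j k l, Valued.v (X i j) * Valued.v (X k l) ≤ Valued.v X.det := by
    have h3 : ∀ k i j l, Valued.v (X.adjugate k i) * Valued.v (X j l) ≤ Valued.v X.det := by
      intro k i j l
      have := h1 k i j l
      rw [hYe, Matrix.smul_apply, smul_eq_mul, mul_assoc, map_mul, map_inv₀, map_mul] at this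
      rwa [inv_mul_le_iff₀ (zero_lt_iff.2 ((Valuation.ne_zero_iff _).2 hd0)), mul_one] at this
    rw [Matrix.adjugate_fin_two] at h3
    intro i j k l
    fin_cases i <;> fin_cases j
    · simpa using h3 1 1 k l
    · simpa using h3 0 1 k l
    · simpa using h3 1 0 k l
    · simpa using h3 0 0 k l
  obtain ⟨⟨i, j⟩, hij⟩ := Finite.exists_max (fun q : Fin 2 × Fin 2 => Valued.v (X q.1 q.2))
  refine ⟨i, j, fun k l => hij (k, l), ?_⟩
  rw [← hdet]
  refine le_antisymm ?_ (by rw [sq]; exact h2 i j i j)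
  rw [Matrix.det_fin_two, sq]
  refine Valuation.map_sub_le _ ?_ ?_ <;> rw [map_mul]
  · exact mul_le_mul' (hij (0, 0)) (hij (1, 1))
  · exact mul_le_mul' (hij (0, 1)) (hij (1, 0))

/-- At a split prime the square of the largest entry has the valuation of the norm, here `1`, so all
entries are integral. At a nonsplit prime integral norm is enough. -/
theorem mem_ordLoc_of_conj (ha : a ≠ 0) (hb : b ≠ 0) (hO : IsMaximalOrder O) {x : (Quat a b)ˣ}
    (hx : ∀ o ∈ O, ((x⁻¹ : (Quat a b)ˣ) : Quat a b) * o * x ∈ ordLoc p O)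
    (hn : p.valuation F (nrd (x : Quat a b)) = 1) : (x : Quat a b) ∈ ordLoc p O := by
  by_cases hs : SplitsAt a b p
  swap
  · exact mem_ordLoc_of_not_splitsAt ha hb hs hO hn.le
  obtain ⟨ι₀⟩ := hs
  obtain ⟨ι, -, -, hι⟩ := exists_conj_isIntegralMatrix ι₀ hO.1
  rw [mem_ordLoc_iff ha hb hO hι]
  obtain ⟨i, j, h, h'⟩ := exists_nrd_eq_sq_of_conj ha hb hO hι hx
  intro k l
  refine (h k l).trans ?_
  rw [hn] at h'
  exact ((pow_eq_one_iff_of_nonneg zero_le two_ne_zero).1 h'.symm).le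

/-- The norm of a normalizing element has the valuation of a square. This parity is what separates
`J` from its two-sided cofactor at the end. -/
theorem even_of_conj (ha : a ≠ 0) (hb : b ≠ 0) (hO : IsMaximalOrder O) {x : (Quat a b)ˣ}
    (hs : SplitsAt a b p)
    (hx : ∀ o ∈ O, ((x⁻¹ : (Quat a b)ˣ) : Quat a b) * o * x ∈ ordLoc p O) {n : ℤ}
    (hn : p.valuation F (nrd (x : Quat a b)) = WithZero.exp n) : Even n := by
  obtain ⟨ι₀⟩ := hs
  obtain ⟨ι, -, -, hι⟩ := exists_conj_isIntegralMatrix ι₀ hO.1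
  obtain ⟨i, j, h, h'⟩ := exists_nrd_eq_sq_of_conj ha hb hO hι hx
  rw [hn] at h'
  have h0 : Valued.v (rep ι x i j) ≠ 0 := by
    intro h0
    rw [h0] at h'
    simp at h'
  rw [← WithZero.exp_log h0, ← WithZero.exp_nsmul, WithZero.exp_inj] at h'
  exact ⟨_, by rw [h', two_nsmul]⟩

/-- `y` generates the right ideal `J` at `p`. -/
structure IsLocGen (O : Subalgebra (𝓞 F) (Quat a b)) (p : HeightOneSpectrum (𝓞 F))
    (J : Submodule (𝓞 F) (Quat a b)) (y : (Quat a b)ˣ) : Prop where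
  mem : (y : Quat a b) ∈ loc p J
  inv_mul_mem : ∀ z ∈ J, ((y⁻¹ : (Quat a b)ˣ) : Quat a b) * z ∈ ordLoc p O

theorem nrdIdeal_coe (hJ : J.FG) : ((nrdIdeal J : FractionalIdeal (𝓞 F)⁰ F) : Submodule (𝓞 F) F) =
    nrdModule J := by
  have h : nrdIdeal J = ⟨nrdModule J, isFractional_nrdModule hJ⟩ :=
    dif_pos (isFractional_nrdModule hJ)
  rw [h]
  rfl

theorem nrd_mem_nrdIdeal (hJ : J.FG) {z : Quat a b} (hz : z ∈ J) : nrd z ∈ nrdIdeal J := by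
  rw [← FractionalIdeal.mem_coe, nrdIdeal_coe hJ]
  exact Submodule.subset_span ⟨z, hz, rfl⟩

theorem nrdIdeal_ne_zero (hJ : Submodule.IsLattice F J) : nrdIdeal J ≠ 0 := by
  obtain ⟨r, hr, h⟩ := exists_smul_mem_of_isLattice hJ 1
  intro h0
  have h1 := nrd_mem_nrdIdeal hJ.fg h
  rw [h0, FractionalIdeal.mem_zero_iff, smul_algebra_eq, nrd_smul, map_one, mul_one] at h1
  exact algebraMap_ne_zero hr (pow_eq_zero_iff two_ne_zero |>.1 h1)

theorem valuation_nrd_le (hJ : J.FG) {z : Quat a b} (hz : z ∈ loc p J) :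
    p.valuation F (nrd z) ≤ WithZero.exp (-vnrd p J) := by
  obtain ⟨s, hs, hz⟩ := hz
  rw [← valuation_nrd_smul hs z]
  exact valuation_le_of_mem p (nrd_mem_nrdIdeal hJ hz)

/-- The norm ideal is spanned by norms. If all of them missed the least valuation, so would the
whole span, by the ultrametric inequality. -/
theorem exists_valuation_nrd_eq (hJ : Submodule.IsLattice F J) :
    ∃ z ∈ J, p.valuation F (nrd z) = WithZero.exp (-vnrd p J) := by
  by_contra! hcon
  obtain ⟨x, hx, -, hxv⟩ := exists_mem_valuation_eq p (nrdIdeal_ne_zero hJ)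
  rw [← FractionalIdeal.mem_coe, nrdIdeal_coe hJ.fg] at hx
  refine hxv.not_lt ?_
  clear hxv
  induction hx using Submodule.span_induction with
  | mem x hx =>
    obtain ⟨z, hz, rfl⟩ := hx
    exact lt_of_le_of_ne (valuation_nrd_le hJ.fg (le_loc hz)) (hcon z hz)
  | zero => simp
  | add x y _ _ hx hy => exact Valuation.map_add_lt _ hx hy
  | smul r x _ hx =>
    rw [Algebra.smul_def, map_mul]
    exact (mul_le_of_le_one_left' (p.valuation_le_one r)).trans_lt hx

/-- Take `y` in `J` whose norm has least valuation `vnrd p J`. For `z` in `J` and `o` in `O`, the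
elements `y⁻¹ z`, `y⁻¹ z o` and `y⁻¹ (y + z o)` have integral norm. Expanding `nrd (1 + y⁻¹ z o)`
makes `trd (y⁻¹ z o)` integral too, and `mem_ordLoc_of_trd_nrd` puts `y⁻¹ z` in the local order. -/
theorem exists_isLocGen (ha : a ≠ 0) (hb : b ≠ 0) (hO : IsMaximalOrder O)
    (hJ : IsRightIdeal O J) (p : HeightOneSpectrum (𝓞 F)) :
    ∃ y : (Quat a b)ˣ, (y : Quat a b) ∈ J ∧ IsLocGen O p J y := by
  obtain ⟨y, hy, hyv⟩ := exists_valuation_nrd_eq (p := p) hJ.1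
  have hy0 : nrd y ≠ 0 := by
    intro h0
    rw [h0, map_zero] at hyv
    exact WithZero.exp_ne_zero hyv.symm
  refine ⟨unitOf y hy0, hy, le_loc hy, fun z hz => ?_⟩
  set u := unitOf y hy0 with hu
  have huv : p.valuation F (nrd (u : Quat a b)) = WithZero.exp (-vnrd p J) := hyv
  have key : ∀ z ∈ J, p.valuation F (nrd (((u⁻¹ : (Quat a b)ˣ) : Quat a b) * z)) ≤ 1 := by
    intro z hz
    rw [map_mul, nrd_unit_inv, map_mul, map_inv₀, huv]
    exact inv_mul_le_one_of_le₀ (valuation_nrd_le hJ.1.fg (le_loc hz)) zero_le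
  refine mem_ordLoc_of_trd_nrd ha hb hO (fun o ho => ?_) (key z hz)
  rw [mul_assoc]
  have hzo := hJ.mul_mem hz ho
  have h1 := key _ (J.add_mem hy hzo)
  have h2 := key _ hzo
  have h3 : ((u⁻¹ : (Quat a b)ˣ) : Quat a b) * (y + z * o) =
      1 + ((u⁻¹ : (Quat a b)ˣ) : Quat a b) * (z * o) := by
    rw [mul_add]
    congr 1
    exact u.inv_mul
  rw [h3, nrd_one_add] at h1
  have := Valuation.map_sub_le _ (Valuation.map_sub_le _ h1 h2) (map_one (p.valuation F)).le
  convert this using 2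
  ring

namespace IsLocGen

variable {y : (Quat a b)ˣ}

theorem inv_mul_mem_of_loc (hy : IsLocGen O p J y) {z : Quat a b} (hz : z ∈ loc p J) :
    ((y⁻¹ : (Quat a b)ˣ) : Quat a b) * z ∈ ordLoc p O := by
  obtain ⟨s, hs, hz⟩ := hz
  refine mem_loc_of_smul_mem hs ?_
  rw [← mul_smul_comm]
  exact hy.inv_mul_mem _ hz

theorem mul_mem_loc (hy : IsLocGen O p J y) (hJ : IsRightIdeal O J) {z : Quat a b}
    (hz : z ∈ ordLoc p O) : (y : Quat a b) * z ∈ loc p J := by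
  have h := QuatIdeal.mul_mem_loc hy.mem hz
  refine loc_mono ?_ h
  rw [← le_rightOrder_iff, hJ.2]

theorem valuation_nrd (hy : IsLocGen O p J y) (hO : IsOrder O) (hJ : Submodule.IsLattice F J) :
    p.valuation F (nrd (y : Quat a b)) = WithZero.exp (-vnrd p J) := by
  refine le_antisymm (valuation_nrd_le hJ.fg hy.mem) ?_
  obtain ⟨z, hz, hzv⟩ := exists_valuation_nrd_eq (p := p) hJ
  have h := valuation_nrd_le_one hO (hy.inv_mul_mem z hz)
  rwa [map_mul, nrd_unit_inv, map_mul, map_inv₀, hzv, inv_mul_le_iff₀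
    (zero_lt_iff.2 ((Valuation.ne_zero_iff _).2 (nrd_unit_ne_zero y))), mul_one] at h

theorem lmul (hy : IsLocGen O p J y) (c : (Quat a b)ˣ) :
    IsLocGen O p (lmul (c : Quat a b) J) (c * y) := by
  constructor
  · obtain ⟨s, hs, h⟩ := hy.mem
    refine ⟨s, hs, ?_⟩
    rw [mem_lmul, Units.val_mul, mul_smul_comm, Units.inv_mul_cancel_left]
    exact h
  · intro z hz
    rw [mul_inv_rev, Units.val_mul, mul_assoc]
    exact hy.inv_mul_mem _ (mem_lmul.1 hz)

theorem conj_mem (hy : IsLocGen O p J y) (hJ : IsTwoSidedIdeal O J) {o : Quat a b} (ho : o ∈ O) :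
    ((y⁻¹ : (Quat a b)ˣ) : Quat a b) * o * y ∈ ordLoc p O := by
  obtain ⟨s, hs, h⟩ := hy.mem
  refine mem_loc_of_smul_mem hs ?_
  rw [← mul_smul_comm, mul_assoc]
  exact hy.inv_mul_mem _ (hJ.mul_mem_left ho h)

end IsLocGen

/-! ### Norms of ideals -/

theorem vnrd_lmul (ha : a ≠ 0) (hb : b ≠ 0) (hO : IsMaximalOrder O) (hJ : IsRightIdeal O J)
    (c : (Quat a b)ˣ) : WithZero.exp (-vnrd p (lmul (c : Quat a b) J)) =
      p.valuation F (nrd (c : Quat a b)) * WithZero.exp (-vnrd p J) := by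
  obtain ⟨y, -, hy⟩ := exists_isLocGen ha hb hO hJ p
  rw [← hy.valuation_nrd hO.1 hJ.1, ← (hy.lmul c).valuation_nrd hO.1 (isLattice_lmul hJ.1 c),
    Units.val_mul, map_mul, map_mul]

theorem vnrd_nonneg (hO : IsOrder O) (hJ : Submodule.IsLattice F J) (h : IsIntegral O J) :
    0 ≤ vnrd p J := by
  obtain ⟨z, hz, hzv⟩ := exists_valuation_nrd_eq (p := p) hJ
  have := valuation_nrd_le_one hO (le_loc (p := p) (h hz))
  rw [hzv, ← WithZero.exp_zero, WithZero.exp_le_exp] at this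
  omega

theorem vnrd_le (hJ : Submodule.IsLattice F J) {z : Quat a b} (hz : z ∈ loc p J) {n : ℤ}
    (h : p.valuation F (nrd z) = WithZero.exp (-n)) : vnrd p J ≤ n := by
  have := valuation_nrd_le hJ.fg hz
  rw [h, WithZero.exp_le_exp] at this
  omega

theorem le_asIdeal_iff {𝔞 : FractionalIdeal (𝓞 F)⁰ F} (h𝔞 : 𝔞 ≠ 0)
    (h : ∀ x ∈ 𝔞, ∃ r : 𝓞 F, algebraMap (𝓞 F) F r = x) :
    𝔞 ≤ ((p.asIdeal : Ideal (𝓞 F)) : FractionalIdeal (𝓞 F)⁰ F) ↔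
      1 ≤ FractionalIdeal.count F p 𝔞 := by
  constructor
  · intro hle
    have := FractionalIdeal.count_mono F p h𝔞 hle
    rwa [FractionalIdeal.count_self] at this
  · intro hc x hx
    obtain ⟨r, rfl⟩ := h x hx
    rw [FractionalIdeal.mem_coeIdeal]
    refine ⟨r, ?_, rfl⟩
    have h1 := valuation_le_of_mem p hx
    rw [← p.valuation_lt_one_iff_mem (K := F)]
    refine h1.trans_lt ?_
    rw [← WithZero.exp_zero, WithZero.exp_lt_exp]
    omega

theorem nrdIdeal_le_asIdeal_iff (hO : IsOrder O) (hJ : Submodule.IsLattice F J)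
    (h : IsIntegral O J) :
    nrdIdeal J ≤ ((p.asIdeal : Ideal (𝓞 F)) : FractionalIdeal (𝓞 F)⁰ F) ↔ 1 ≤ vnrd p J := by
  refine le_asIdeal_iff (nrdIdeal_ne_zero hJ) fun x hx => ?_
  rw [← FractionalIdeal.mem_coe, nrdIdeal_coe hJ.fg] at hx
  have : nrdModule J ≤ LinearMap.range (Algebra.linearMap (𝓞 F) F) := by
    refine Submodule.span_le.2 ?_
    rintro _ ⟨z, hz, rfl⟩
    obtain ⟨r, hr⟩ := exists_nrd_eq hO (h hz)
    exact ⟨r, hr⟩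
  exact this hx

theorem count_eq_zero_of_mem_smoothGroup {B : Finset (HeightOneSpectrum (𝓞 F))} (hp : p ∉ B)
    {𝔞 : (FractionalIdeal (𝓞 F)⁰ F)ˣ} (h : 𝔞 ∈ smoothGroup B) :
    FractionalIdeal.count F p (𝔞 : FractionalIdeal (𝓞 F)⁰ F) = 0 := by
  induction h using Subgroup.closure_induction with
  | mem 𝔞 h =>
    obtain ⟨q, hq, h⟩ := h
    rw [h, FractionalIdeal.count_maximal_coprime]
    rintro rfl
    exact hp hq
  | one => rw [Units.val_one, FractionalIdeal.count_one]
  | mul x y _ _ hx hy =>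
    rw [Units.val_mul, FractionalIdeal.count_mul F p x.ne_zero y.ne_zero, hx, hy, add_zero]
  | inv x _ hx => rw [Units.val_inv_eq_inv_val, FractionalIdeal.count_inv, hx, neg_zero]

theorem valuation_eq_exp_count_toPrincipalIdeal (x : Fˣ) :
    p.valuation F (x : F) = WithZero.exp (-FractionalIdeal.count F p
      (toPrincipalIdeal (𝓞 F) F x : FractionalIdeal (𝓞 F)⁰ F)) := by
  rw [valuation_eq_exp_count p x.ne_zero, coe_toPrincipalIdeal]

/-! ### Products with scalars -/

section Products

variable {M N : Submodule (𝓞 F) (Quat a b)} {𝔞 𝔟 : FractionalIdeal (𝓞 F)⁰ F}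

theorem lmul_mul_eq (c : Quat a b) : lmul c M * N = lmul c (M * N) := by
  apply le_antisymm
  · rw [Submodule.mul_le]
    rintro _ ⟨m, hm, rfl⟩ n hn
    exact ⟨m * n, Submodule.mul_mem_mul hm hn, (mul_assoc c m n).symm⟩
  · rw [lmul, Submodule.map_le_iff_le_comap, Submodule.mul_le]
    intro m hm n hn
    change c * (m * n) ∈ lmul c M * N
    rw [← mul_assoc]
    exact Submodule.mul_mem_mul ⟨m, hm, rfl⟩ hn

theorem mul_lmul_algebraMap (f : F) : M * lmul (algebraMap F (Quat a b) f) N =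
    lmul (algebraMap F (Quat a b) f) (M * N) := by
  apply le_antisymm
  · rw [Submodule.mul_le]
    rintro m hm _ ⟨n, hn, rfl⟩
    refine ⟨m * n, Submodule.mul_mem_mul hm hn, ?_⟩
    change algebraMap F (Quat a b) f * (m * n) = m * (algebraMap F (Quat a b) f * n)
    rw [← mul_assoc, ← mul_assoc, Algebra.commutes]
  · rw [lmul, Submodule.map_le_iff_le_comap, Submodule.mul_le]
    intro m hm n hn
    change algebraMap F (Quat a b) f * (m * n) ∈ M * lmul (algebraMap F (Quat a b) f) N
    rw [← mul_assoc, Algebra.commutes, mul_assoc]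
    exact Submodule.mul_mem_mul hm ⟨n, hn, rfl⟩

theorem scale_mul_eq : scale 𝔞 M * N = scale 𝔞 (M * N) := by
  rw [scale, scale, mul_assoc]

theorem mul_scale_eq : M * scale 𝔞 N = scale 𝔞 (M * N) := by
  apply le_antisymm
  · rw [Submodule.mul_le]
    intro m hm n hn
    have : scale 𝔞 N ≤ (scale 𝔞 (M * N)).comap (LinearMap.mulLeft (𝓞 F) m) := by
      refine scale_le fun x hx z hz => ?_
      change m * x • z ∈ scale 𝔞 (M * N)
      rw [mul_smul_comm]
      exact mem_scale hx (Submodule.mul_mem_mul hm hz)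
    exact this hn
  · refine scale_le fun x hx z hz => ?_
    have : M * N ≤ (M * scale 𝔞 N).comap
        ((LinearMap.lsmul F (Quat a b) x).restrictScalars (𝓞 F)) := by
      rw [Submodule.mul_le]
      intro m hm n hn
      change x • (m * n) ∈ M * scale 𝔞 N
      rw [← mul_smul_comm]
      exact Submodule.mul_mem_mul hm (mem_scale hx hn)
    exact this hz

theorem scale_scale : scale 𝔞 (scale 𝔟 M) = scale (𝔞 * 𝔟) M := by
  rw [scale, scale, scale, ← mul_assoc, FractionalIdeal.coe_mul, ← Submodule.map_mul]

theorem scale_one : scale 1 M = M := by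
  rw [scale, FractionalIdeal.coe_one, Submodule.map_one, one_mul]

theorem scale_lmul (c : Quat a b) : scale 𝔞 (lmul c M) = lmul c (scale 𝔞 M) := by
  apply le_antisymm
  · refine scale_le ?_
    rintro x hx _ ⟨m, hm, rfl⟩
    exact ⟨x • m, mem_scale hx hm, mul_smul_comm _ _ _⟩
  · rw [lmul, Submodule.map_le_iff_le_comap]
    refine scale_le fun x hx z hz => ?_
    change c * x • z ∈ scale 𝔞 (lmul c M)
    rw [mul_smul_comm]
    exact mem_scale hx ⟨z, hz, rfl⟩

theorem scale_mono (h : M ≤ N) : scale 𝔞 M ≤ scale 𝔞 N := scale_le fun _ hx _ hz => mem_scale hx (h hz)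

end Products

/-! ### Completions and local generators -/

theorem completeAt_eq_of_isLocGen {y : (Quat a b)ˣ} (hy : IsLocGen O p J y)
    (hJ : IsRightIdeal O J) (hyJ : (y : Quat a b) ∈ J) :
    completeAt p J = completeAt p (lmul (y : Quat a b) (Subalgebra.toSubmodule O)) := by
  apply le_antisymm
  · refine Submodule.span_le.2 ?_
    rintro _ ⟨z, hz, rfl⟩
    obtain ⟨s, hs, h⟩ := hy.inv_mul_mem z hz
    have hv : Valued.v (algebraMap F (p.adicCompletion F) (algebraMap (𝓞 F) F s)) = 1 := by
      rw [valued_algebraMap, valuation_eq_one_of_notMem hs]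
    have hs0 : algebraMap F (p.adicCompletion F) (algebraMap (𝓞 F) F s) ≠ 0 := by
      intro h0
      rw [h0, map_zero] at hv
      exact zero_ne_one hv
    let u : p.adicCompletionIntegers F :=
      ⟨(algebraMap F (p.adicCompletion F) (algebraMap (𝓞 F) F s))⁻¹, by
        rw [HeightOneSpectrum.mem_adicCompletionIntegers, map_inv₀, hv, inv_one]⟩
    have h1 : (1 : p.adicCompletion F) ⊗ₜ[F] (s • z) ∈
        completeAt p (QuatIdeal.lmul (y : Quat a b) (Subalgebra.toSubmodule O)) := by
      refine Submodule.subset_span ⟨_, ?_, rfl⟩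
      change s • z ∈ QuatIdeal.lmul (y : Quat a b) (Subalgebra.toSubmodule O)
      rw [mem_lmul, mul_smul_comm]
      exact h
    have h2 := Submodule.smul_mem _ u h1
    have h3 : u • ((1 : p.adicCompletion F) ⊗ₜ[F] (s • z)) = (1 : p.adicCompletion F) ⊗ₜ[F] z := by
      change (algebraMap F (p.adicCompletion F) (algebraMap (𝓞 F) F s))⁻¹ •
        ((1 : p.adicCompletion F) ⊗ₜ[F] (s • z)) = _
      rw [smul_algebra_eq, ← TensorProduct.smul_tmul, TensorProduct.smul_tmul',
        Algebra.algebraMap_eq_smul_one, smul_eq_mul, ← Algebra.algebraMap_eq_smul_one,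
        inv_mul_cancel₀ hs0]
    rw [h3] at h2
    exact h2
  · refine Submodule.span_mono (Set.image_mono ?_)
    rintro _ ⟨o, ho, rfl⟩
    exact hJ.mul_mem hyJ ho

/-- The algorithm chooses its generator by a condition on completions. It descends to the
localization because the elements of the completed algebra that become integral matrices after
multiplication by `y⁻¹` form a module over the completed integers. -/
theorem isLocGen_of_completeAt_eq (ha : a ≠ 0) (hb : b ≠ 0) (hO : IsMaximalOrder O)
    (hs : SplitsAt a b p) {y : (Quat a b)ˣ} (hyJ : (y : Quat a b) ∈ J)
    (h : completeAt p J = completeAt p (lmul (y : Quat a b) (Subalgebra.toSubmodule O))) :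
    IsLocGen O p J y := by
  refine ⟨le_loc hyJ, fun z hz => ?_⟩
  obtain ⟨ι₀⟩ := hs
  obtain ⟨ι, -, -, hι⟩ := exists_conj_isIntegralMatrix ι₀ hO.1
  rw [mem_ordLoc_iff ha hb hO hι, map_mul]
  have h1 : (1 : p.adicCompletion F) ⊗ₜ[F] z ∈
      completeAt p (lmul (y : Quat a b) (Subalgebra.toSubmodule O)) := by
    rw [← h]
    exact Submodule.subset_span ⟨z, hz, rfl⟩
  rw [rep_apply ι z]
  generalize (1 : p.adicCompletion F) ⊗ₜ[F] z = t at h1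
  induction h1 using Submodule.span_induction with
  | mem t ht =>
    obtain ⟨_, ⟨o, ho, rfl⟩, rfl⟩ := ht
    change IsIntegralMatrix (_ * rep ι ((y : Quat a b) * o))
    rw [← map_mul, Units.inv_mul_cancel_left]
    exact hι o ho
  | zero =>
    intro i j
    simp
  | add x y _ _ hx hy =>
    rw [map_add, mul_add]
    exact hx.add hy
  | smul r x _ hx =>
    have h2 : ι (r • x) = (r : p.adicCompletion F) • ι x := map_smul ι (r : p.adicCompletion F) x
    rw [h2, mul_smul_comm]
    intro i j
    rw [Matrix.smul_apply, smul_eq_mul, map_mul]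
    exact mul_le_one' r.2 (hx i j)

end LocalGenerators

/-! ### The tree at a split prime -/

section Tree

variable {p : HeightOneSpectrum (𝓞 F)} {O : Subalgebra (𝓞 F) (Quat a b)}

theorem BTVertex.act_mul {R K : Type*} [CommRing R] [Field K] [Algebra R K] (g h : GL (Fin 2) K)
    (P : BTVertex R K) : P.act (g * h) = (P.act h).act g := by
  induction P using Quotient.ind with
  | _ L =>
    refine congrArg (Quotient.mk _) (Subtype.ext ?_)
    simp only [BTLattice.act]
    rw [← Submodule.map_comp, Units.val_mul, Matrix.toLin'_mul]
    rfl

theorem BTVertex.act_one {R K : Type*} [CommRing R] [Field K] [Algebra R K]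
    (P : BTVertex R K) : P.act 1 = P := by
  induction P using Quotient.ind with
  | _ L =>
    refine congrArg (Quotient.mk _) (Subtype.ext ?_)
    simp only [BTLattice.act]
    rw [Units.val_one, Matrix.toLin'_one]
    exact Submodule.map_id _

theorem BTVertex.act_of_eq_smul {R K : Type*} [CommRing R] [Field K] [Algebra R K]
    {g : GL (Fin 2) K} {u : Kˣ} (h : (g : Matrix (Fin 2) (Fin 2) K) = (u : K) • 1)
    (P : BTVertex R K) : P.act g = P := by
  induction P using Quotient.ind with
  | _ L =>
    have h1 : (homothetic R K).r L (BTLattice.act g L) := by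
      refine ⟨u, ?_⟩
      simp only [BTLattice.act]
      rw [h, map_smul, Matrix.toLin'_one]
      rfl
    exact (Quotient.sound h1).symm

/-- The matrix of an invertible element of the algebra. -/
def repU (ι : (p.adicCompletion F ⊗[F] Quat a b) ≃ₐ[p.adicCompletion F]
    Matrix (Fin 2) (Fin 2) (p.adicCompletion F)) :
    (Quat a b)ˣ →* GL (Fin 2) (p.adicCompletion F) :=
  Units.map (rep ι : Quat a b →* Matrix (Fin 2) (Fin 2) (p.adicCompletion F))

variable (ι : (p.adicCompletion F ⊗[F] Quat a b) ≃ₐ[p.adicCompletion F]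
    Matrix (Fin 2) (Fin 2) (p.adicCompletion F))

theorem coe_repU (x : (Quat a b)ˣ) :
    (repU ι x : Matrix (Fin 2) (Fin 2) (p.adicCompletion F)) = rep ι x := rfl

theorem treeAct_eq (x : (Quat a b)ˣ) (P : Tree p) : treeAct ι x P = P.act (repU ι x) := rfl

theorem treeAct_mul (x y : (Quat a b)ˣ) (P : Tree p) :
    treeAct ι (x * y) P = treeAct ι x (treeAct ι y P) := by
  rw [treeAct_eq, treeAct_eq, treeAct_eq, map_mul, BTVertex.act_mul]

theorem dist_treeAct (x : (Quat a b)ˣ) (P Q : Tree p) :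
    (treeAct ι x P).dist (treeAct ι x Q) = P.dist Q := dist_act _ P Q

/-- The scalar `x`, as an invertible element of the algebra. -/
abbrev scalarUnit (a b : F) (x : Fˣ) : (Quat a b)ˣ :=
  Units.map (algebraMap F (Quat a b) : F →* Quat a b) x

theorem treeAct_scalarUnit (x : Fˣ) (P : Tree p) : treeAct ι (scalarUnit a b x) P = P := by
  rw [treeAct_eq]
  refine BTVertex.act_of_eq_smul (u := Units.map (algebraMap F (p.adicCompletion F)) x) ?_ P
  rw [coe_repU]
  change rep ι (algebraMap F _ (x : F)) = (algebraMap F (p.adicCompletion F) (x : F)) • 1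
  rw [AlgHom.commutes, Algebra.algebraMap_eq_smul_one, algebraMap_smul]

theorem valued_unit (u : (p.adicCompletionIntegers F)ˣ) :
    Valued.v ((u : p.adicCompletionIntegers F) : p.adicCompletion F) = 1 := by
  refine le_antisymm (u : p.adicCompletionIntegers F).2 ?_
  have h1 : ((u : p.adicCompletionIntegers F) : p.adicCompletion F) *
      ((u⁻¹ : (p.adicCompletionIntegers F)ˣ) : p.adicCompletionIntegers F) = 1 := by
    exact_mod_cast congrArg Subtype.val u.mul_inv
  have h2 := congrArg (Valued.v (R := p.adicCompletion F)) h1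
  rw [map_mul, map_one] at h2
  rw [← h2]
  exact mul_le_of_le_one_right' ((u⁻¹ : (p.adicCompletionIntegers F)ˣ) :
    p.adicCompletionIntegers F).2

theorem isUnif_of_valuation {x : Fˣ} (hx : p.valuation F (x : F) = WithZero.exp (-1 : ℤ)) :
    IsUnif (p.adicCompletionIntegers F)
      (Units.map (algebraMap F (p.adicCompletion F) : F →* p.adicCompletion F) x) := by
  have hv : Valued.v (algebraMap F (p.adicCompletion F) (x : F)) = WithZero.exp (-1 : ℤ) := by
    rw [valued_algebraMap, hx]
  refine ⟨⟨algebraMap F (p.adicCompletion F) (x : F), ?_⟩, ?_, rfl⟩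
  · rw [HeightOneSpectrum.mem_adicCompletionIntegers, hv, ← WithZero.exp_zero, WithZero.exp_le_exp]
    omega
  have hunit : ∀ z : p.adicCompletionIntegers F, IsUnit z ↔
      Valued.v (z : p.adicCompletion F) = 1 := by
    intro z
    constructor
    · rintro ⟨u, rfl⟩
      exact valued_unit u
    · intro h
      have h0 : (z : p.adicCompletion F) ≠ 0 := by
        intro h0
        rw [h0, map_zero] at h
        exact zero_ne_one h
      refine IsUnit.of_mul_eq_one ⟨(z : p.adicCompletion F)⁻¹, ?_⟩ (Subtype.ext ?_)
      · rw [HeightOneSpectrum.mem_adicCompletionIntegers, map_inv₀, h, inv_one]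
      · exact mul_inv_cancel₀ h0
  constructor
  · rw [hunit]
    intro h
    have := hv.symm.trans h
    rw [← WithZero.exp_zero, WithZero.exp_inj] at this
    omega
  · intro y z h
    rw [hunit, hunit]
    have h1 : Valued.v (y : p.adicCompletion F) * Valued.v (z : p.adicCompletion F) =
        WithZero.exp (-1 : ℤ) := by
      rw [← map_mul, ← hv]
      exact congrArg Valued.v (congrArg Subtype.val h).symm
    have hy0 : Valued.v (y : p.adicCompletion F) ≠ 0 := by
      intro h0
      rw [h0, zero_mul] at h1
      exact WithZero.exp_ne_zero h1.symm
    have hz0 : Valued.v (z : p.adicCompletion F) ≠ 0 := by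
      intro h0
      rw [h0, mul_zero] at h1
      exact WithZero.exp_ne_zero h1.symm
    have hy : Valued.v (y : p.adicCompletion F) ≤ 1 := y.2
    have hz : Valued.v (z : p.adicCompletion F) ≤ 1 := z.2
    rw [← WithZero.exp_log hy0, ← WithZero.exp_log hz0, ← WithZero.exp_add, WithZero.exp_inj] at h1
    rw [← WithZero.exp_log hy0] at hy ⊢
    rw [← WithZero.exp_log hz0] at hz ⊢
    rw [← WithZero.exp_zero] at hy hz ⊢
    rw [WithZero.exp_le_exp] at hy hz
    rw [WithZero.exp_inj, WithZero.exp_inj]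
    omega

variable {ι}

/-- The vertex of the order `O`, and the position of `y` relative to it. -/
theorem exists_vertex (ha : a ≠ 0) (hb : b ≠ 0) (hO : IsMaximalOrder O) {π : Fˣ}
    (hπ : p.valuation F (π : F) = WithZero.exp (-1 : ℤ)) :
    ∃ P : Tree p, ∀ y : (Quat a b)ˣ, ∃ m n : ℤ, P.dist (treeAct ι y P) = (m - n).natAbs ∧
      p.valuation F (nrd (y : Quat a b)) = WithZero.exp (-(m + n)) ∧
      ((y : Quat a b) ∈ ordLoc p O ↔ 0 ≤ m ∧ 0 ≤ n) ∧
      ((π : F)⁻¹ • (y : Quat a b) ∈ ordLoc p O ↔ 1 ≤ m ∧ 1 ≤ n) := by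
  obtain ⟨ι', h, hι', hint⟩ := exists_conj_isIntegralMatrix ι hO.1
  have hw := isUnif_of_valuation hπ
  -- After conjugation by `h` the local order consists of the integral matrices, which belong to the
  -- standard vertex. In the original coordinates its vertex is the translate by `h`.
  refine ⟨(stdVertex _ _).act h, fun y => ?_⟩
  obtain ⟨m, n, u, h1, h2, h3⟩ := exists_dist_stdVertex hw (repU ι' y)
  have h4 : repU ι' y = h⁻¹ * repU ι y * h := Units.ext (hι' y)
  have h5 : ∀ x : Quat a b, x ∈ ordLoc p O ↔ ∀ i j, rep ι' x i j ∈
      (algebraMap (p.adicCompletionIntegers F) (p.adicCompletion F)).range := by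
    intro x
    rw [mem_ordLoc_iff ha hb hO hint]
    exact forall₂_congr fun i j => valued_le_one_iff _
  refine ⟨m, n, ?_, ?_, ?_, ?_⟩
  · rw [← h1, h4, BTVertex.act_mul, BTVertex.act_mul, treeAct_eq]
    conv_rhs => rw [← dist_act h, ← BTVertex.act_mul h h⁻¹, mul_inv_cancel, BTVertex.act_one]
  · rw [coe_repU, (rep_trd_nrd ι' _).2] at h2
    have h6 := congrArg Valued.v h2
    have hu : Valued.v (algebraMap (p.adicCompletionIntegers F) (p.adicCompletion F)
        (u : p.adicCompletionIntegers F)) = 1 := valued_unit u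
    rw [valued_algebraMap, map_mul, hu, one_mul, map_zpow₀] at h6
    rw [h6]
    change Valued.v (algebraMap F (p.adicCompletion F) (π : F)) ^ (m + n) = _
    rw [valued_algebraMap, hπ, ← WithZero.exp_zsmul]
    congr 1
    simp
  · rw [h5, ← h3]
    simp [coe_repU]
  · rw [h5, ← h3]
    refine forall₂_congr fun i j => ?_
    rw [(rep ι').map_smul_of_tower, Matrix.smul_apply, Algebra.smul_def, map_inv₀, zpow_neg_one,
      coe_repU]
    rfl

end Tree

/-! ### The local reduction algorithm -/

section PReduce

variable {p q : HeightOneSpectrum (𝓞 F)} {O : Subalgebra (𝓞 F) (Quat a b)}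
  {I J : Submodule (𝓞 F) (Quat a b)}

/-- The fractional ideal attached to a prime. -/
abbrev primeIdeal (p : HeightOneSpectrum (𝓞 F)) : FractionalIdeal (𝓞 F)⁰ F :=
  ((p.asIdeal : Ideal (𝓞 F)) : FractionalIdeal (𝓞 F)⁰ F)

theorem primeIdeal_ne_zero : primeIdeal p ≠ 0 := by
  simpa [primeIdeal] using p.ne_bot

theorem count_primeIdeal_zpow (n : ℤ) : FractionalIdeal.count F p (primeIdeal p ^ n) = n :=
  FractionalIdeal.count_zpow_self F p n

theorem count_primeIdeal_zpow_of_ne (h : q ≠ p) (n : ℤ) :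
    FractionalIdeal.count F q (primeIdeal p ^ n) = 0 := by
  rw [FractionalIdeal.count_zpow, FractionalIdeal.count_maximal_coprime F q h.symm, mul_zero]

theorem isRightIdeal_lmul (hO : IsMaximalOrder O) (hJ : IsRightIdeal O J) (c : (Quat a b)ˣ) :
    IsRightIdeal O (lmul (c : Quat a b) J) := by
  refine isRightIdeal_of_le hO (isLattice_lmul hJ.1 c) ?_
  rw [le_rightOrder_iff, lmul_mul_eq]
  exact Submodule.map_mono (le_rightOrder_iff.1 hJ.2.ge)

theorem isRightIdeal_scale (hO : IsMaximalOrder O) (hJ : IsRightIdeal O J)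
    {𝔞 : FractionalIdeal (𝓞 F)⁰ F} (h𝔞 : 𝔞 ≠ 0) : IsRightIdeal O (scale 𝔞 J) := by
  refine isRightIdeal_of_le hO (isLattice_scale h𝔞 hJ.1) ?_
  rw [le_rightOrder_iff, scale_mul_eq]
  exact scale_mono (le_rightOrder_iff.1 hJ.2.ge)

theorem isTwoSidedIdeal_scale (hO : IsMaximalOrder O) (hJ : IsTwoSidedIdeal O J)
    {𝔞 : FractionalIdeal (𝓞 F)⁰ F} (h𝔞 : 𝔞 ≠ 0) : IsTwoSidedIdeal O (scale 𝔞 J) := by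
  refine isTwoSidedIdeal_of_le hO (isLattice_scale h𝔞 hJ.1.1) ?_
    (isRightIdeal_scale hO hJ.1 h𝔞).2.ge
  rw [le_leftOrder_iff, mul_scale_eq]
  exact scale_mono (le_leftOrder_iff.1 hJ.2.ge)

theorem IsLocGen.scale {y : (Quat a b)ˣ} (hy : IsLocGen O p J y)
    {𝔞 : FractionalIdeal (𝓞 F)⁰ F} (h𝔞 : 𝔞 ≠ 0) {x : Fˣ}
    (hx : p.valuation F (x : F) = WithZero.exp (-FractionalIdeal.count F p 𝔞)) :
    IsLocGen O p (scale 𝔞 J) (scalarUnit a b x * y) := by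
  have h1 : ((scalarUnit a b x * y : (Quat a b)ˣ) : Quat a b) = (x : F) • (y : Quat a b) := by
    rw [Algebra.smul_def]
    rfl
  have h2 : (((scalarUnit a b x * y)⁻¹ : (Quat a b)ˣ) : Quat a b) =
      (x : F)⁻¹ • ((y⁻¹ : (Quat a b)ˣ) : Quat a b) := by
    rw [mul_inv_rev, Units.val_mul, ← map_inv, ← Units.val_inv_eq_inv_val, Algebra.smul_def]
    exact (Algebra.commutes _ _).symm
  constructor
  · rw [mem_loc_scale h𝔞 hx, h1, inv_smul_smul₀ x.ne_zero]
    exact hy.mem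
  · intro z hz
    have := (mem_loc_scale h𝔞 hx).1 (le_loc hz)
    rw [h2, smul_mul_assoc, ← mul_smul_comm]
    exact hy.inv_mul_mem_of_loc this

theorem exists_unit_valuation_eq (p : HeightOneSpectrum (𝓞 F)) (n : ℤ) :
    ∃ x : Fˣ, p.valuation F (x : F) = WithZero.exp n := by
  obtain ⟨π, hπ, hv⟩ := exists_uniformizer p
  refine ⟨Units.mk0 π hπ ^ (-n), ?_⟩
  rw [Units.val_zpow_eq_zpow_val, map_zpow₀, Units.val_mk0, hv, ← WithZero.exp_zsmul]
  simp

theorem vnrd_scale (ha : a ≠ 0) (hb : b ≠ 0) (hO : IsMaximalOrder O) (hJ : IsRightIdeal O J)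
    {𝔞 : FractionalIdeal (𝓞 F)⁰ F} (h𝔞 : 𝔞 ≠ 0) :
    vnrd p (scale 𝔞 J) = vnrd p J + 2 * FractionalIdeal.count F p 𝔞 := by
  obtain ⟨y, -, hy⟩ := exists_isLocGen ha hb hO hJ p
  obtain ⟨x, hx⟩ := exists_unit_valuation_eq p (-FractionalIdeal.count F p 𝔞)
  have h1 := (hy.scale h𝔞 hx).valuation_nrd hO.1 (isLattice_scale h𝔞 hJ.1)
  rw [Units.val_mul, map_mul, map_mul, hy.valuation_nrd hO.1 hJ.1] at h1
  change p.valuation F (nrd (algebraMap F _ (x : F))) * _ = _ at h1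
  rw [nrd_algebraMap, map_pow, hx, ← WithZero.exp_nsmul, ← WithZero.exp_add, WithZero.exp_inj] at h1
  simp only [nsmul_eq_mul, Nat.cast_ofNat] at h1
  omega

/-- `J` is not contained in `p O`. -/
def IsPrimitiveAt (O : Subalgebra (𝓞 F) (Quat a b)) (p : HeightOneSpectrum (𝓞 F))
    (J : Submodule (𝓞 F) (Quat a b)) : Prop :=
  ¬ J ≤ loc p (scale (primeIdeal p) (Subalgebra.toSubmodule O))

theorem zpow_primeIdeal_le {n : ℤ} (hn : 1 ≤ n) : primeIdeal p ^ n ≤ primeIdeal p := by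
  obtain ⟨m, rfl⟩ := Int.eq_ofNat_of_zero_le (by omega : 0 ≤ n)
  rw [zpow_natCast, ← FractionalIdeal.coeIdeal_pow]
  rw [primeIdeal, FractionalIdeal.coeIdeal_le_coeIdeal]
  exact Ideal.pow_le_self (by omega)

/-- `GReduce` calls `PReduce` only on ideals that are primitive at `p`, so the initial division by
`p ^ r` is trivial. -/
theorem isGreatest_zero (h : IsIntegral O J) (hp : IsPrimitiveAt O p J) :
    IsGreatest {n : ℤ | J ≤ scale (primeIdeal p ^ n) (Subalgebra.toSubmodule O)} 0 := by
  constructor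
  · rw [Set.mem_ofPred_eq, zpow_zero, scale_one]
    exact h
  · intro n hn
    by_contra! hlt
    refine hp (le_trans hn (le_trans ?_ le_loc))
    exact scale_le fun x hx z hz => mem_scale (zpow_primeIdeal_le hlt hx) hz

theorem mem_ordLoc_mul_loc_scale {x z : Quat a b} (hx : x ∈ ordLoc p O)
    (hz : z ∈ loc p (scale (primeIdeal p) (Subalgebra.toSubmodule O))) :
    x * z ∈ loc p (scale (primeIdeal p) (Subalgebra.toSubmodule O)) := by
  have h := mul_mem_loc hx hz
  rw [mul_scale_eq] at h
  refine loc_mono (scale_mono ?_) h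
  rw [Submodule.mul_le]
  exact fun _ h1 _ h2 => O.mul_mem h1 h2

/-- The left order of an ideal of norm `p` agrees with `O` away from `p`. -/
theorem mem_ordLoc_of_mem_leftOrder (hO : IsMaximalOrder O) (hI : IsRightIdeal O I)
    (hint : IsIntegral O I) (hn : nrdIdeal I = primeIdeal p) (hq : q ≠ p) {g : Quat a b}
    (hg : g ∈ leftOrder I) : g ∈ ordLoc q O := by
  obtain ⟨s, hs, hsq⟩ : ∃ s ∈ p.asIdeal, s ∉ q.asIdeal := by
    by_contra! hcon
    exact hq (HeightOneSpectrum.ext (p.isMaximal.eq_of_le q.isPrime.ne_top hcon).symm)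
  have hs' : algebraMap (𝓞 F) F s ∈ nrdModule I := by
    rw [← nrdIdeal_coe hI.1.fg, hn]
    exact (FractionalIdeal.mem_coeIdeal _).2 ⟨s, hs, rfl⟩
  -- Since `nrd z = z z̄` with `z̄` in `O`, the norm ideal `p` lies in `I`. For `s` in `p` outside
  -- `q`, the element `s g` then lies in `I`, hence in `O`.
  have key : ∀ x ∈ nrdModule I, algebraMap F (Quat a b) x ∈ I := by
    intro x hx
    induction hx using Submodule.span_induction with
    | mem x hx =>
      obtain ⟨z, hz, rfl⟩ := hx
      rw [← self_mul_star]
      exact hI.mul_mem hz (star_mem_of_isOrder hO.1 (hint hz))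
    | zero =>
      rw [map_zero]
      exact I.zero_mem
    | add x y _ _ hx hy =>
      rw [map_add]
      exact I.add_mem hx hy
    | smul r x _ hx =>
      have : algebraMap F (Quat a b) (r • x) = r • algebraMap F (Quat a b) x := by
        rw [Algebra.smul_def, map_mul, smul_algebra_eq, Algebra.smul_def]
      rw [this]
      exact I.smul_mem r hx
  refine ⟨s, hsq, hint ?_⟩
  have := hg _ (key _ hs')
  rwa [← Algebra.commutes, ← Algebra.smul_def, ← smul_algebra_eq] at this

theorem toPrincipalIdeal_nrdU_of_isUnitOf {O' : Subalgebra (𝓞 F) (Quat a b)} (hO' : IsOrder O')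
    {g : (Quat a b)ˣ} (hg : IsUnitOf O' g) : toPrincipalIdeal (𝓞 F) F (nrdU g) = 1 := by
  obtain ⟨r, hr⟩ := exists_nrd_eq hO' hg.1
  obtain ⟨s, hs⟩ := exists_nrd_eq hO' hg.2
  have hrs : r * s = 1 := by
    apply FaithfulSMul.algebraMap_injective (𝓞 F) F
    rw [map_mul, hr, hs, ← map_mul, Units.mul_inv, map_one, map_one]
  apply Units.ext
  rw [coe_toPrincipalIdeal, Units.val_one]
  change FractionalIdeal.spanSingleton _ (nrd (g : Quat a b)) = 1
  rw [← hr, ← FractionalIdeal.coeIdeal_span_singleton,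
    Ideal.span_singleton_eq_top.2 (IsUnit.of_mul_eq_one s hrs), FractionalIdeal.coeIdeal_top]

end PReduce

/-! ### The loop invariant of the local reduction. -/

section PReduceInvariant

variable {p q : HeightOneSpectrum (𝓞 F)} {O : Subalgebra (𝓞 F) (Quat a b)}
  {J J₀ : Submodule (𝓞 F) (Quat a b)}

namespace PReductionStructure

variable (S : PReductionStructure O p)

theorem isOrder_ord (hO : IsMaximalOrder O) (i : Fin 2) : IsOrder (S.ord i) := by
  fin_cases i
  · change IsOrder (S.ord 0)
    rw [S.ord_zero]
    exact hO.1
  · obtain ⟨I, hI, -, -, h⟩ := S.ord_one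
    change IsOrder (S.ord 1)
    rw [h]
    exact isOrder_leftOrder hI.1

theorem mem_ordLoc_of_mem_ord (hO : IsMaximalOrder O) (hq : q ≠ p) (i : Fin 2) {g : Quat a b}
    (hg : g ∈ S.ord i) : g ∈ ordLoc q O := by
  fin_cases i
  · change g ∈ S.ord 0 at hg
    rw [S.ord_zero] at hg
    exact le_loc hg
  · obtain ⟨I, hI, hint, hn, h⟩ := S.ord_one
    change g ∈ S.ord 1 at hg
    rw [h] at hg
    exact mem_ordLoc_of_mem_leftOrder hO hI hint hn hq hg

/-- The position of `y` relative to the vertex of `O`. -/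
theorem exists_position (ha : a ≠ 0) (hb : b ≠ 0) (hO : IsMaximalOrder O) {π : Fˣ}
    (hπ : p.valuation F (π : F) = WithZero.exp (-1 : ℤ)) (y : (Quat a b)ˣ) :
    ∃ m n : ℤ, (S.vert 0).dist (treeAct S.ι y (S.vert 0)) = (m - n).natAbs ∧
      p.valuation F (nrd (y : Quat a b)) = WithZero.exp (-(m + n)) ∧
      ((y : Quat a b) ∈ ordLoc p O ↔ 0 ≤ m ∧ 0 ≤ n) ∧
      ((π : F)⁻¹ • (y : Quat a b) ∈ ordLoc p O ↔ 1 ≤ m ∧ 1 ≤ n) := by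
  obtain ⟨P, hP⟩ := exists_vertex (ι := S.ι) ha hb hO hπ
  -- The structure only requires `P₀` to be fixed by the units of `O`; it has to be identified with
  -- the vertex `P` of `O`. Such units also fix `P`, since they and their inverses have nonnegative
  -- elementary exponents, which forces all of these to vanish.
  suffices h : S.vert 0 = P by
    rw [h]
    exact hP y
  have hfix : ∀ g, IsUnitOf (S.ord 0) g → treeAct S.ι g P = P := by
    intro g hg
    obtain ⟨m, n, h1, h2, h3, -⟩ := hP g
    obtain ⟨m', n', h1', h2', h3', -⟩ := hP g⁻¹
    rw [S.ord_zero] at hg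
    have h4 := h3.1 (le_loc hg.1)
    have h5 := h3'.1 (le_loc hg.2)
    rw [nrd_unit_inv, map_inv₀, h2, ← WithZero.exp_neg, WithZero.exp_inj] at h2'
    refine (eq_of_dist_eq_zero ?_).symm
    rw [h1]
    omega
  by_contra hne
  have hd : (S.vert 0).dist P ≠ 0 := fun h => hne (eq_of_dist_eq_zero h)
  obtain ⟨P', h1, h2⟩ := exists_neighbour_towards hd
  obtain ⟨P'', h3, h4⟩ := exists_neighbour_away (S.vert 0) P
  -- Every neighbour of `P₀` is sent to `P₁` by a unit fixing `P`, so all neighbours are equally far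
  -- from `P`. If `P₀ ≠ P`, one is closer and one is farther.
  have key : ∀ (P' : Tree p) (h : (S.vert 0).dist P' = 1), (S.vert 1).dist P = P'.dist P := by
    intro P' h
    have h5 := S.g_act 0 P' h
    have h6 := dist_treeAct S.ι (S.g 0 P' h) P' P
    rw [h5, hfix _ (S.g_unit 0 P' h)] at h6
    exact h6
  have h5 := key P' h1
  have h6 := key P'' h3
  omega

end PReductionStructure

/-- The invariant of the loop of `PReduce`, for the input `J₀`. -/
structure PInvariant (S : PReductionStructure O p) (J₀ : Submodule (𝓞 F) (Quat a b))
    (s : PState a b p) : Prop where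
  isRightIdeal : IsRightIdeal O s.J
  isIntegral : IsIntegral O s.J
  nrd_c : toPrincipalIdeal (𝓞 F) F (nrdU s.c) = 1
  c_mem : ∀ q ≠ p, (s.c : Quat a b) ∈ ordLoc q O ∧ ((s.c⁻¹ : (Quat a b)ˣ) : Quat a b) ∈ ordLoc q O
  eq : lmul (s.c : Quat a b) J₀ = scale (primeIdeal p ^ s.r) s.J
  exists_gen : ∃ y : (Quat a b)ˣ, IsLocGen O p s.J y ∧ s.Q = treeAct S.ι y (S.vert 0) ∧
    p.valuation F (nrd (y : Quat a b)) = WithZero.exp (-s.k)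
  dist : ((S.vert s.i).dist s.Q : ℤ) = s.k - (s.i : ℕ)

theorem PInvariant.k_eq {S : PReductionStructure O p} {s : PState a b p} (h : PInvariant S J₀ s)
    (hO : IsMaximalOrder O) : vnrd p s.J = s.k := by
  obtain ⟨y, hy, -, hv⟩ := h.exists_gen
  rw [hy.valuation_nrd hO.1 h.isRightIdeal.1, WithZero.exp_inj] at hv
  omega

theorem lmul_one : lmul 1 J = J := by
  ext z
  simp [lmul]

theorem exists_pInit (ha : a ≠ 0) (hb : b ≠ 0) (hO : IsMaximalOrder O)
    (S : PReductionStructure O p) (hJ : IsRightIdeal O J) (hint : IsIntegral O J)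
    (hp : IsPrimitiveAt O p J) : ∃ s, PInit S J s := by
  obtain ⟨y, hyJ, hy⟩ := exists_isLocGen ha hb hO hJ p
  exact ⟨_, .mk 0 y (isGreatest_zero hint hp) hyJ (completeAt_eq_of_isLocGen hy hJ hyJ)⟩

/-- The generator `x` is integral and not divisible by `p`, so its smaller exponent is `0`. Hence
the initial distance `|m - n|` equals `m + n = k`. -/
theorem pInvariant_of_pInit (ha : a ≠ 0) (hb : b ≠ 0) (hO : IsMaximalOrder O)
    {S : PReductionStructure O p} (hJ : IsRightIdeal O J) (hint : IsIntegral O J)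
    (hp : IsPrimitiveAt O p J) {s : PState a b p} (hs : PInit S J s) :
    PInvariant S J s ∧ s.i = 0 ∧ s.k = vnrd p J := by
  obtain ⟨r, x, hr, hx, hxp⟩ := hs
  obtain rfl : r = 0 := hr.unique (isGreatest_zero hint hp)
  have hg := isLocGen_of_completeAt_eq ha hb hO ⟨S.ι⟩ hx hxp
  have hJ' : scale (primeIdeal p ^ (-0 : ℤ)) J = J := by
    rw [neg_zero, zpow_zero, scale_one]
  have hv := hg.valuation_nrd hO.1 hJ.1
  obtain ⟨π, hπ⟩ := exists_unit_valuation_eq p (-1)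
  obtain ⟨m, n, h1, h2, h3, h4⟩ := S.exists_position ha hb hO hπ x
  refine ⟨⟨?_, ?_, ?_, ?_, ?_, ⟨x, ?_, rfl, ?_⟩, ?_⟩, rfl, ?_⟩
  · simpa only [hJ'] using hJ
  · simpa only [hJ'] using hint
  · simp
  · intro q _
    simp [one_mem_ordLoc]
  · change lmul ((1 : (Quat a b)ˣ) : Quat a b) J =
      scale (primeIdeal p ^ (0 : ℤ)) (scale (primeIdeal p ^ (-0 : ℤ)) J)
    rw [hJ', Units.val_one, lmul_one, zpow_zero, scale_one]
  · simpa only [hJ'] using hg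
  · simpa only [hJ'] using hv
  · change (((S.vert 0).dist (treeAct S.ι x (S.vert 0)) : ℕ) : ℤ) =
      vnrd p (scale (primeIdeal p ^ (-0 : ℤ)) J) - ((0 : Fin 2) : ℕ)
    rw [hJ', h1]
    rw [h2, WithZero.exp_inj] at hv
    have hx1 := h3.1 (le_loc (hint hx))
    have hx2 : ¬ ((π : F)⁻¹ • (x : Quat a b) ∈ ordLoc p O) := by
      intro hcon
      refine hp fun z hz => ?_
      rw [mem_loc_scale primeIdeal_ne_zero (x := (π : F))
        (by rw [hπ, FractionalIdeal.count_self])]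
      have := mul_mem_ordLoc hcon (hg.inv_mul_mem z hz)
      rwa [smul_mul_assoc, Units.mul_inv_cancel_left] at this
    rw [h4] at hx2
    simp only [Fin.val_zero]
    omega
  · change vnrd p (scale (primeIdeal p ^ (-0 : ℤ)) J) = vnrd p J
    rw [hJ']

theorem exists_pBody {S : PReductionStructure O p} {s : PState a b p} (h : PInvariant S J₀ s)
    (hk : 1 ≤ s.k - (s.i : ℕ)) : ∃ s', PBody S s s' := by
  obtain ⟨P, hP, hQ⟩ := exists_neighbour_towards (P := S.vert s.i) (Q := s.Q) (by
    have := h.dist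
    omega)
  exact ⟨_, .mk s P hP hQ⟩

/-- The element `g` is an isometry taking `P` to the other base vertex, so the new distance is that
from `P` to `Q`, and `P` lies one step along the segment. -/
theorem dist_of_pBody {S : PReductionStructure O p} {s s' : PState a b p} (hs : PBody S s s') :
    (S.vert s'.i).dist s'.Q + 1 = (S.vert s.i).dist s.Q := by
  obtain ⟨P, hP, hQ⟩ := hs
  change (S.vert (1 - s.i)).dist (treeAct S.ι (S.g s.i P hP) s.Q) + 1 = _
  rw [← S.g_act s.i P hP, dist_treeAct]
  omega

theorem isIntegral_of_isLocGen {y : (Quat a b)ˣ} (hy : IsLocGen O p J y)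
    (hyO : (y : Quat a b) ∈ ordLoc p O) : J ≤ ordLoc p O := fun z hz => by
  have := mul_mem_ordLoc hyO (hy.inv_mul_mem z hz)
  rwa [Units.mul_inv_cancel_left] at this

theorem lmul_le_ordLoc (hJ : IsIntegral O J) {g : Quat a b} (hg : g ∈ ordLoc q O) :
    lmul g J ≤ ordLoc q O := by
  rintro _ ⟨z, hz, rfl⟩
  exact mul_mem_ordLoc hg (le_loc (hJ hz))

/-- The distance is `k - i`: a body with `i = 0` shortens it at constant `k`, and one with `i = 1`
shortens it while `k` drops by `2`. With `i = 0` integrality is clear because `g` is a unit of `O`;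
with `i = 1` it must be recovered from the tree. -/
theorem pInvariant_of_pBody (ha : a ≠ 0) (hb : b ≠ 0) (hO : IsMaximalOrder O)
    {S : PReductionStructure O p} {s s' : PState a b p} (h : PInvariant S J₀ s)
    (hs : PBody S s s') : PInvariant S J₀ s' := by
  have hd := dist_of_pBody hs
  have hdist := h.dist
  obtain ⟨P, hP, hQ⟩ := hs
  obtain ⟨c, J, Q, i, k, r⟩ := s
  set g := S.g i P hP with hg
  have hgu : IsUnitOf (S.ord i) g := S.g_unit i P hP
  have hgn := toPrincipalIdeal_nrdU_of_isUnitOf (S.isOrder_ord hO i) hgu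
  have hgv : p.valuation F (nrd (g : Quat a b)) = 1 := by
    have := valuation_eq_exp_count_toPrincipalIdeal (p := p) (nrdU g)
    rw [hgn, Units.val_one, FractionalIdeal.count_one, neg_zero, WithZero.exp_zero] at this
    exact this
  have hgq : ∀ q ≠ p, (g : Quat a b) ∈ ordLoc q O ∧ ((g⁻¹ : (Quat a b)ˣ) : Quat a b) ∈ ordLoc q O :=
    fun q hq => ⟨S.mem_ordLoc_of_mem_ord hO hq i hgu.1, S.mem_ordLoc_of_mem_ord hO hq i hgu.2⟩
  have hcq : ∀ q ≠ p, ((g * c : (Quat a b)ˣ) : Quat a b) ∈ ordLoc q O ∧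
      (((g * c)⁻¹ : (Quat a b)ˣ) : Quat a b) ∈ ordLoc q O := by
    intro q hq
    rw [mul_inv_rev, Units.val_mul, Units.val_mul]
    exact ⟨mul_mem_ordLoc (hgq q hq).1 (h.c_mem q hq).1,
      mul_mem_ordLoc (h.c_mem q hq).2 (hgq q hq).2⟩
  have hcn : toPrincipalIdeal (𝓞 F) F (nrdU (g * c)) = 1 := by
    rw [map_mul, map_mul, hgn, one_mul]
    exact h.nrd_c
  have hright := isRightIdeal_lmul hO h.isRightIdeal g
  obtain ⟨y, hy, hyQ, hyv⟩ := h.exists_gen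
  have heq : lmul ((g * c : (Quat a b)ˣ) : Quat a b) J₀ =
      scale (primeIdeal p ^ r) (lmul (g : Quat a b) J) := by
    rw [Units.val_mul, lmul_mul, scale_lmul]
    exact congrArg _ h.eq
  have hQ' : treeAct S.ι g Q = treeAct S.ι (g * y) (S.vert 0) := by
    rw [treeAct_mul]
    exact congrArg _ hyQ
  have hgy : p.valuation F (nrd ((g * y : (Quat a b)ˣ) : Quat a b)) = WithZero.exp (-k) := by
    rw [Units.val_mul, map_mul, map_mul, hgv, one_mul]
    exact hyv
  fin_cases i
  · refine ⟨hright, ?_, hcn, hcq, heq, ⟨g * y, hy.lmul g, hQ', hgy⟩, ?_⟩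
    · rintro _ ⟨z, hz, rfl⟩
      refine O.mul_mem ?_ (h.isIntegral hz)
      have := hgu.1
      change _ ∈ S.ord 0 at this
      rwa [S.ord_zero] at this
    · simp at hd hdist ⊢
      omega
  · have hne := zpow_ne_zero (-1) (primeIdeal_ne_zero (p := p))
    obtain ⟨π, hπ⟩ := exists_unit_valuation_eq p (-1)
    obtain ⟨x, hx⟩ := exists_unit_valuation_eq p 1
    have hgen := (hy.lmul g).scale hne (x := x) (by rw [hx, count_primeIdeal_zpow, neg_neg])
    have hv : p.valuation F (nrd ((scalarUnit a b x * (g * y) : (Quat a b)ˣ) : Quat a b)) =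
        WithZero.exp (-(k - 2)) := by
      rw [Units.val_mul, map_mul, map_mul, hgy]
      change p.valuation F (nrd (algebraMap F _ (x : F))) * _ = _
      rw [nrd_algebraMap, map_pow, hx, ← WithZero.exp_nsmul, ← WithZero.exp_add]
      congr 1
      simp
      ring
    have hQ'' : treeAct S.ι g Q = treeAct S.ι (scalarUnit a b x * (g * y)) (S.vert 0) := by
      rw [treeAct_mul, treeAct_scalarUnit, hQ']
    have hd' : ((S.vert 0).dist (treeAct S.ι g Q) : ℤ) = k - 2 := by
      change (S.vert 0).dist (treeAct S.ι g Q) + 1 = (S.vert 1).dist Q at hd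
      change ((S.vert 1).dist Q : ℤ) = k - 1 at hdist
      omega
    refine ⟨isRightIdeal_scale hO hright hne, ?_, hcn, hcq, ?_, ⟨_, hgen, hQ'', hv⟩, ?_⟩
    -- At `p` the new generator has `m + n = k - 2 = |m - n|`, so both exponents are nonnegative. At
    -- `q ≠ p` the factor `p⁻¹` is trivial and `g` lies in the local order.
    · refine le_of_forall_le_loc fun q => ?_
      rcases eq_or_ne q p with rfl | hq
      · refine isIntegral_of_isLocGen hgen ?_
        obtain ⟨m, n, h1, h2, h3, -⟩ := S.exists_position ha hb hO hπ (scalarUnit a b x * (g * y))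
        rw [← hQ''] at h1
        rw [h2, WithZero.exp_inj] at hv
        rw [h3]
        omega
      · intro z hz
        have := (mem_loc_scale hne (x := 1) (by
          rw [map_one, count_primeIdeal_zpow_of_ne hq, neg_zero, WithZero.exp_zero])).1 (le_loc hz)
        rw [inv_one, one_smul] at this
        exact loc_le_loc (lmul_le_ordLoc h.isIntegral (hgq q hq).1) this
    · change lmul ((g * c : (Quat a b)ˣ) : Quat a b) J₀ =
        scale (primeIdeal p ^ (r + 1)) (scale (primeIdeal p ^ (-1 : ℤ)) (lmul (g : Quat a b) J))
      rw [scale_scale, ← zpow_add₀ primeIdeal_ne_zero, add_neg_cancel_right, heq]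
    · change ((S.vert 0).dist (treeAct S.ι g Q) : ℤ) = k - 2 - ((0 : Fin 2) : ℕ)
      rw [hd']
      simp

end PReduceInvariant

/-! ### Effect of the local reduction at the other primes. -/

section Exit

variable {p q : HeightOneSpectrum (𝓞 F)} {O : Subalgebra (𝓞 F) (Quat a b)}
  {J J₀ 𝔄 : Submodule (𝓞 F) (Quat a b)}

theorem PInvariant.vnrd_of_ne {S : PReductionStructure O p} {s : PState a b p}
    (h : PInvariant S J₀ s) (ha : a ≠ 0) (hb : b ≠ 0) (hO : IsMaximalOrder O)
    (hJ₀ : IsRightIdeal O J₀) (hq : q ≠ p) : vnrd q s.J = vnrd q J₀ := by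
  have h1 := vnrd_lmul (p := q) ha hb hO hJ₀ s.c
  have h2 := valuation_eq_exp_count_toPrincipalIdeal (p := q) (nrdU s.c)
  rw [h.nrd_c, Units.val_one, FractionalIdeal.count_one, neg_zero, WithZero.exp_zero] at h2
  change q.valuation F (nrd (s.c : Quat a b)) = 1 at h2
  rw [h2, one_mul, WithZero.exp_inj, h.eq, vnrd_scale ha hb hO h.isRightIdeal
    (zpow_ne_zero _ primeIdeal_ne_zero), count_primeIdeal_zpow_of_ne hq] at h1
  omega

/-- At `q ≠ p` the multiplier is a unit of the local order, so divisibility by `q` is unaffected.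
Primes still to be treated stay primitive. -/
theorem PInvariant.isPrimitiveAt_of_ne {S : PReductionStructure O p} {s : PState a b p}
    (h : PInvariant S J₀ s) (hq : q ≠ p) (hJ₀ : IsPrimitiveAt O q J₀) :
    IsPrimitiveAt O q s.J := by
  intro hle
  refine hJ₀ fun z hz => ?_
  have h1 : (s.c : Quat a b) * z ∈ scale (primeIdeal p ^ s.r) s.J := by
    rw [← h.eq]
    exact ⟨z, hz, rfl⟩
  have h2 := (mem_loc_scale (zpow_ne_zero _ primeIdeal_ne_zero) (x := 1) (by
    rw [map_one, count_primeIdeal_zpow_of_ne hq, neg_zero, WithZero.exp_zero])).1 (le_loc h1)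
  rw [inv_one, one_smul] at h2
  have := mem_ordLoc_mul_loc_scale (h.c_mem q hq).2 (loc_le_loc hle h2)
  rwa [Units.inv_mul_cancel_left] at this

end Exit

/-! ### Two-sided ideals -/

section TwoSided

variable {p : HeightOneSpectrum (𝓞 F)} {O : Subalgebra (𝓞 F) (Quat a b)}
  {J J₀ 𝔄 : Submodule (𝓞 F) (Quat a b)}

theorem one_mem_toSubmodule : (1 : Quat a b) ∈ Subalgebra.toSubmodule O := O.one_mem

theorem toSubmodule_mul_self : Subalgebra.toSubmodule O * Subalgebra.toSubmodule O =
    Subalgebra.toSubmodule O :=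
  le_antisymm (Submodule.mul_le.2 fun _ h1 _ h2 => O.mul_mem h1 h2) fun x hx => by
    have := Submodule.mul_mem_mul hx (one_mem_toSubmodule (O := O))
    rwa [mul_one] at this

theorem isTwoSidedIdeal_twoSidedClosure (hO : IsMaximalOrder O) (hJ : Submodule.IsLattice F J) :
    IsTwoSidedIdeal O (twoSidedClosure O J) := by
  refine isTwoSidedIdeal_of_le hO (isLattice_mul (isLattice_mul hO.1 hJ) hO.1) ?_ ?_
  · rw [le_leftOrder_iff, twoSidedClosure, ← mul_assoc, ← mul_assoc, toSubmodule_mul_self]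
  · rw [le_rightOrder_iff, twoSidedClosure, mul_assoc, toSubmodule_mul_self]

theorem le_twoSidedClosure : J ≤ twoSidedClosure O J := fun x hx => by
  have := Submodule.mul_mem_mul (Submodule.mul_mem_mul (one_mem_toSubmodule (O := O)) hx)
    (one_mem_toSubmodule (O := O))
  rwa [one_mul, mul_one] at this

theorem twoSidedClosure_le (h : Subalgebra.toSubmodule O * 𝔄 ≤ 𝔄)
    (h' : 𝔄 * Subalgebra.toSubmodule O ≤ 𝔄) (hJ : J ≤ 𝔄) : twoSidedClosure O J ≤ 𝔄 :=
  (mul_le_mul' ((mul_le_mul' le_rfl hJ).trans h) le_rfl).trans h'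

theorem isLattice_idealInv (hO : IsOrder O) (h𝔄 : Submodule.IsLattice F 𝔄) :
    Submodule.IsLattice F (idealInv O 𝔄) := by
  obtain ⟨r, hr, h1⟩ := exists_smul_mem_of_isLattice h𝔄 1
  refine isLattice_of_forall (fg_of_smul_le hr hO.fg fun x hx => ?_) fun x => ?_
  · have := hx _ h1
    rwa [mul_smul_comm, mul_one] at this
  · obtain ⟨s, hs, h⟩ := exists_smul_le_of_isLattice hO (N := lmul x 𝔄) (h𝔄.fg.map _)
    refine ⟨s, hs, fun y hy => ?_⟩
    rw [smul_mul_assoc]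
    exact h _ ⟨y, hy, rfl⟩

theorem IsLocGen.inv_mem_loc_idealInv {w : (Quat a b)ˣ} (hw : IsLocGen O p 𝔄 w) (h𝔄 : 𝔄.FG) :
    ((w⁻¹ : (Quat a b)ˣ) : Quat a b) ∈ loc p (idealInv O 𝔄) := by
  obtain ⟨s, hs, h⟩ := exists_smul_le_of_fg (p := p) (N := QuatIdeal.lmul ((w⁻¹ : (Quat a b)ˣ) : Quat a b) 𝔄)
    (M := Subalgebra.toSubmodule O) (h𝔄.map _) (by
      rintro _ ⟨z, hz, rfl⟩
      exact hw.inv_mul_mem z hz)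
  refine ⟨s, hs, fun y hy => ?_⟩
  rw [smul_mul_assoc]
  exact h _ ⟨y, hy, rfl⟩

theorem idealInv_mul_le (h𝔄 : Subalgebra.toSubmodule O * 𝔄 ≤ 𝔄) :
    idealInv O 𝔄 * Subalgebra.toSubmodule O ≤ idealInv O 𝔄 := by
  rw [Submodule.mul_le]
  intro x hx o ho y hy
  rw [mul_assoc]
  exact hx _ (h𝔄 (Submodule.mul_mem_mul ho hy))

/-- Locally the inverse contains `w⁻¹` for a generator `w`, so `1` lies in the product at every
prime. -/
theorem idealInv_mul_self (ha : a ≠ 0) (hb : b ≠ 0) (hO : IsMaximalOrder O)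
    (h𝔄 : IsTwoSidedIdeal O 𝔄) : idealInv O 𝔄 * 𝔄 = Subalgebra.toSubmodule O := by
  refine le_antisymm (Submodule.mul_le.2 fun x hx y hy => hx y hy) fun o ho => ?_
  have h1 : (1 : Quat a b) ∈ idealInv O 𝔄 * 𝔄 := by
    refine mem_of_forall_mem_loc fun p => ?_
    obtain ⟨w, -, hw⟩ := exists_isLocGen ha hb hO h𝔄.1 p
    have := mul_mem_loc (hw.inv_mem_loc_idealInv h𝔄.1.1.fg) hw.mem
    rwa [Units.inv_mul] at this
  have h2 := Submodule.mul_mem_mul h1 ho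
  rw [one_mul, mul_assoc] at h2
  exact mul_le_mul' le_rfl (le_rightOrder_iff.1 h𝔄.1.2.ge) h2

theorem self_mul_idealInv_le (h𝔄 : IsTwoSidedIdeal O 𝔄) :
    𝔄 * idealInv O 𝔄 ≤ Subalgebra.toSubmodule O := by
  rw [Submodule.mul_le]
  intro x hx y hy
  change x * y ∈ O
  rw [← h𝔄.2]
  intro z hz
  rw [mul_assoc]
  exact h𝔄.1.mul_mem hx (hy z hz)

/-- The ideal `J` divided by its two-sided part. -/
abbrev primitivePart (O : Subalgebra (𝓞 F) (Quat a b)) (J : Submodule (𝓞 F) (Quat a b)) :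
    Submodule (𝓞 F) (Quat a b) :=
  J * idealInv O (twoSidedClosure O J)

theorem isRightIdeal_primitivePart (hO : IsMaximalOrder O) (hJ : Submodule.IsLattice F J) :
    IsRightIdeal O (primitivePart O J) := by
  have h := isTwoSidedIdeal_twoSidedClosure hO hJ
  refine isRightIdeal_of_le hO (isLattice_mul hJ (isLattice_idealInv hO.1 h.1.1)) ?_
  rw [le_rightOrder_iff, mul_assoc]
  exact mul_le_mul' le_rfl (idealInv_mul_le (le_leftOrder_iff.1 h.2.ge))

theorem isIntegral_primitivePart (hO : IsMaximalOrder O) (hJ : Submodule.IsLattice F J) :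
    IsIntegral O (primitivePart O J) :=
  (mul_le_mul' le_twoSidedClosure le_rfl).trans
    (self_mul_idealInv_le (isTwoSidedIdeal_twoSidedClosure hO hJ))

theorem primitivePart_mul (ha : a ≠ 0) (hb : b ≠ 0) (hO : IsMaximalOrder O)
    (hJ : IsRightIdeal O J) : primitivePart O J * twoSidedClosure O J = J := by
  rw [mul_assoc, idealInv_mul_self ha hb hO (isTwoSidedIdeal_twoSidedClosure hO hJ.1)]
  refine le_antisymm (le_rightOrder_iff.1 hJ.2.ge) fun x hx => ?_
  have := Submodule.mul_mem_mul hx (one_mem_toSubmodule (O := O))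
  rwa [mul_one] at this

theorem le_primitivePart (hint : IsIntegral O J) : J ≤ primitivePart O J := fun x hx => by
  have h : twoSidedClosure O J ≤ Subalgebra.toSubmodule O :=
    twoSidedClosure_le toSubmodule_mul_self.le toSubmodule_mul_self.le hint
  have := Submodule.mul_mem_mul hx (show (1 : Quat a b) ∈ idealInv O (twoSidedClosure O J) from
    fun y hy => by
      rw [one_mul]
      exact h hy)
  rwa [mul_one] at this

/-- If the quotient lay locally in `p O`, then `J` would lie in `p 𝔄`. This is two-sided, so it
would contain the closure `𝔄` of `J`, and the norm of a local generator of `𝔄` rules that out. -/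
theorem isPrimitiveAt_primitivePart (ha : a ≠ 0) (hb : b ≠ 0) (hO : IsMaximalOrder O)
    (hJ : IsRightIdeal O J) (p : HeightOneSpectrum (𝓞 F)) :
    IsPrimitiveAt O p (primitivePart O J) := by
  intro hle
  set 𝔄 := twoSidedClosure O J with h𝔄
  have h2 : IsTwoSidedIdeal O 𝔄 := isTwoSidedIdeal_twoSidedClosure hO hJ.1
  have hl := le_leftOrder_iff.1 h2.2.ge
  have hr := le_rightOrder_iff.1 h2.1.2.ge
  have hJ' : J ≤ loc p (scale (primeIdeal p) 𝔄) := by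
    rw [← primitivePart_mul ha hb hO hJ, Submodule.mul_le]
    intro x hx y hy
    have := mul_mem_loc (hle hx) (le_loc (p := p) hy)
    rw [scale_mul_eq] at this
    exact loc_mono (scale_mono hl) this
  have h𝔄' : 𝔄 ≤ loc p (scale (primeIdeal p) 𝔄) := by
    refine twoSidedClosure_le ?_ ?_ hJ'
    · rw [Submodule.mul_le]
      intro x hx y hy
      have := mul_mem_loc (le_loc (p := p) hx) hy
      rw [mul_scale_eq] at this
      exact loc_mono (scale_mono hl) this
    · rw [Submodule.mul_le]
      intro x hx y hy
      have := mul_mem_loc hx (le_loc (p := p) hy)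
      rw [scale_mul_eq] at this
      exact loc_mono (scale_mono hr) this
  obtain ⟨w, -, hw⟩ := exists_isLocGen ha hb hO h2.1 p
  obtain ⟨π, hπ⟩ := exists_unit_valuation_eq p (-1)
  have h3 := (mem_loc_scale primeIdeal_ne_zero (x := (π : F))
    (by rw [hπ, FractionalIdeal.count_self])).1 (loc_le_loc h𝔄' hw.mem)
  have h4 := valuation_nrd_le_one hO.1 (hw.inv_mul_mem_of_loc h3)
  rw [mul_smul_comm, Units.inv_mul, nrd_smul, map_one, mul_one, map_pow, map_inv₀, hπ,
    ← WithZero.exp_neg, ← WithZero.exp_nsmul, ← WithZero.exp_zero, WithZero.exp_le_exp] at h4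
  simp at h4

theorem vnrd_eq_zero_of_one_mem_loc (hO : IsOrder O) (hJ : Submodule.IsLattice F J)
    (hint : IsIntegral O J) (h : (1 : Quat a b) ∈ loc p J) : vnrd p J = 0 :=
  le_antisymm (vnrd_le hJ h (n := 0) (by simp)) (vnrd_nonneg hO hJ hint)

/-- Conjugation preserves norms, hence the local order at a nonsplit prime. A local generator `y` of
`J` therefore also generates the two-sided closure, and `1 = y y⁻¹` lies in the quotient. -/
theorem vnrd_primitivePart_of_not_splitsAt (ha : a ≠ 0) (hb : b ≠ 0) (hO : IsMaximalOrder O)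
    (hJ : IsRightIdeal O J) (hs : ¬ SplitsAt a b p) : vnrd p (primitivePart O J) = 0 := by
  refine vnrd_eq_zero_of_one_mem_loc hO.1 (isRightIdeal_primitivePart hO hJ.1).1
    (isIntegral_primitivePart hO hJ.1) ?_
  obtain ⟨y, hyJ, hy⟩ := exists_isLocGen ha hb hO hJ p
  have hconj : ∀ o ∈ O, ((y⁻¹ : (Quat a b)ˣ) : Quat a b) * o * y ∈ ordLoc p O := by
    intro o ho
    refine mem_ordLoc_of_not_splitsAt ha hb hs hO ?_
    rw [map_mul nrd, map_mul nrd, mul_right_comm, ← map_mul nrd, Units.inv_mul, map_one, one_mul]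
    exact valuation_nrd_le_one hO.1 (le_loc ho)
  have hgen : IsLocGen O p (twoSidedClosure O J) y := by
    refine ⟨le_loc (le_twoSidedClosure hyJ), fun z hz => ?_⟩
    suffices h : twoSidedClosure O J ≤ lmul (y : Quat a b) (ordLoc p O) from
      mem_lmul.1 (h hz)
    refine twoSidedClosure_le ?_ ?_ fun z hz => mem_lmul.2 (hy.inv_mul_mem z hz)
    · rw [Submodule.mul_le]
      rintro o ho _ ⟨z, hz, rfl⟩
      rw [mem_lmul]
      have := mul_mem_ordLoc (hconj o ho) hz
      rwa [mul_assoc, mul_assoc] at this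
    · rw [Submodule.mul_le]
      rintro _ ⟨z, hz, rfl⟩ o ho
      refine ⟨z * o, mul_mem_ordLoc hz (le_loc ho), ?_⟩
      exact (mul_assoc _ _ _).symm
  have := mul_mem_loc hy.mem (hgen.inv_mem_loc_idealInv
    (isTwoSidedIdeal_twoSidedClosure hO hJ.1).1.1.fg)
  rwa [Units.mul_inv] at this

theorem IsLocGen.mul {y w : (Quat a b)ˣ} (hy : IsLocGen O p J y) (hw : IsLocGen O p 𝔄 w)
    (h𝔄 : IsTwoSidedIdeal O 𝔄) : IsLocGen O p (J * 𝔄) (y * w) := by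
  refine ⟨QuatIdeal.mul_mem_loc hy.mem hw.mem, fun z hz => ?_⟩
  suffices h : J * 𝔄 ≤ QuatIdeal.lmul ((y * w : (Quat a b)ˣ) : Quat a b) (ordLoc p O) from
    mem_lmul.1 (h hz)
  rw [Submodule.mul_le]
  intro j hj α hα
  rw [mem_lmul, mul_inv_rev, Units.val_mul, mul_assoc, ← mul_assoc _ j]
  obtain ⟨s, hs, h⟩ := hy.inv_mul_mem j hj
  refine mem_loc_of_smul_mem hs ?_
  rw [← mul_smul_comm, ← smul_mul_assoc]
  exact hw.inv_mul_mem _ (h𝔄.mul_mem_left h hα)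

theorem isLocGen_one : IsLocGen O p (Subalgebra.toSubmodule O) 1 :=
  ⟨one_mem_ordLoc, fun z hz => by
    rw [inv_one, Units.val_one, one_mul]
    exact le_loc hz⟩

end TwoSided

/-! ### The global reduction algorithm -/

section GReduce

variable {O : Subalgebra (𝓞 F) (Quat a b)} {B : Finset (HeightOneSpectrum (𝓞 F))}
  {I J 𝔄 : Submodule (𝓞 F) (Quat a b)}

theorem nrdIdeal_lmul_self (hO : IsOrder O) (x : (Quat a b)ˣ) :
    nrdIdeal (lmul (x : Quat a b) (Subalgebra.toSubmodule O)) =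
      (toPrincipalIdeal (𝓞 F) F (nrdU x) : FractionalIdeal (𝓞 F)⁰ F) := by
  have hfg := (isLattice_lmul (I := Subalgebra.toSubmodule O) hO x).fg
  rw [coe_toPrincipalIdeal]
  apply FractionalIdeal.coeToSubmodule_injective
  beta_reduce
  rw [nrdIdeal_coe hfg, FractionalIdeal.coe_spanSingleton]
  apply le_antisymm
  · refine Submodule.span_le.2 ?_
    rintro _ ⟨_, ⟨o, ho, rfl⟩, rfl⟩
    obtain ⟨r, hr⟩ := exists_nrd_eq hO ho
    refine Submodule.mem_span_singleton.2 ⟨r, ?_⟩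
    change r • nrd (x : Quat a b) = nrd ((x : Quat a b) * o)
    rw [map_mul, ← hr, Algebra.smul_def, mul_comm]
  · rw [Submodule.span_singleton_le_iff_mem]
    refine Submodule.subset_span ⟨x, ⟨1, O.one_mem, mul_one _⟩, rfl⟩

/-! #### Exponents -/

theorem toPrincipalIdeal_nrdU_mem_nrdGroup {X : Finset (Quat a b)ˣ} (l : List (Quat a b)ˣ)
    (hl : ∀ x ∈ l, x ∈ X) (e : (Quat a b)ˣ → ℤ) :
    toPrincipalIdeal (𝓞 F) F (nrdU (l.map fun x => x ^ e x).prod) ∈ nrdGroup X := by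
  have : (l.map fun x => x ^ e x).prod ∈
      (nrdGroup X).comap ((toPrincipalIdeal (𝓞 F) F).comp nrdU) := by
    refine Subgroup.list_prod_mem _ fun y hy => ?_
    obtain ⟨x, hx, rfl⟩ := List.mem_map.1 hy
    have h1 : toPrincipalIdeal (𝓞 F) F (nrdU x) ∈ nrdGroup X :=
      Subgroup.subset_closure ⟨x, hl x hx, rfl⟩
    exact Subgroup.zpow_mem _ (show x ∈ (nrdGroup X).comap ((toPrincipalIdeal (𝓞 F) F).comp nrdU)
      from h1) _
  exact this

theorem exists_exponents (X : Finset (Quat a b)ˣ) {𝔡 : (FractionalIdeal (𝓞 F)⁰ F)ˣ}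
    (h : 𝔡 ∈ nrdGroup X) : ∃ e : (Quat a b)ˣ → ℤ,
      toPrincipalIdeal (𝓞 F) F (nrdU (X.toList.map fun x => x ^ e x).prod) = 𝔡 := by
  classical
  let N : (Quat a b)ˣ →* (FractionalIdeal (𝓞 F)⁰ F)ˣ := (toPrincipalIdeal (𝓞 F) F).comp nrdU
  have key : ∀ e : (Quat a b)ˣ → ℤ,
      toPrincipalIdeal (𝓞 F) F (nrdU (X.toList.map fun x => x ^ e x).prod) =
        ∏ x ∈ X, N x ^ e x := by
    intro e
    change N _ = _
    rw [map_list_prod, List.map_map, ← Finset.prod_map_toList]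
    congr 1
    exact List.map_congr_left fun x _ => map_zpow N x (e x)
  simp only [key]
  induction h using Subgroup.closure_induction with
  | mem 𝔡 h =>
    obtain ⟨x, hx, rfl⟩ := h
    refine ⟨Pi.single x 1, ?_⟩
    rw [Finset.prod_eq_single x]
    · rw [Pi.single_eq_same, zpow_one]
      rfl
    · intro y _ hy
      rw [Pi.single_eq_of_ne hy, zpow_zero]
    · exact fun h => (h hx).elim
  | one => exact ⟨0, by simp⟩
  | mul y z _ _ hy hz =>
    obtain ⟨e, rfl⟩ := hy
    obtain ⟨e', rfl⟩ := hz
    exact ⟨e + e', by simp only [Pi.add_apply, zpow_add, Finset.prod_mul_distrib]⟩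
  | inv y _ hy =>
    obtain ⟨e, rfl⟩ := hy
    exact ⟨-e, by simp only [Pi.neg_apply, zpow_neg, Finset.prod_inv_distrib]⟩

theorem nrdU_scalarUnit (f : Fˣ) : nrdU (scalarUnit a b f) = f ^ 2 :=
  Units.ext (nrd_algebraMap (f : F))

/-- Only the norm of the multiplier matters. An even power of `x` may thus be replaced by a power of
the scalar `nrd x`, because a scalar `f` has norm `f ^ 2`. -/
theorem nrdU_prod_mod_two (l : List (Quat a b)ˣ) (e : (Quat a b)ˣ → ℤ) :
    nrdU ((l.map fun x => x ^ (e x % 2)).prod *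
      scalarUnit a b (l.map fun x => nrdU x ^ (e x / 2)).prod) =
        nrdU (l.map fun x => x ^ e x).prod := by
  rw [map_mul, nrdU_scalarUnit]
  induction l with
  | nil => simp
  | cons x l ih =>
    have h : nrdU x ^ e x = nrdU x ^ (e x % 2) * (nrdU x ^ (e x / 2)) ^ 2 := by
      rw [← zpow_natCast, ← zpow_mul, ← zpow_add]
      congr 1
      have := Int.emod_add_mul_ediv (e x) 2
      push_cast
      linarith
    simp only [List.map_cons, List.prod_cons, map_mul, map_zpow, mul_pow] at ih ⊢
    rw [← ih, h]
    exact mul_mul_mul_comm _ _ _ _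

/-- The remainder modulo `2` is `0` or `1` for negative exponents too, so no inverse of a relation
occurs and multiplication by `c` preserves integrality. -/
theorem prod_mod_two_mem (l : List (Quat a b)ˣ) (hl : ∀ x ∈ l, (x : Quat a b) ∈ O)
    (e : (Quat a b)ˣ → ℤ) :
    (((l.map fun x => x ^ (e x % 2)).prod : (Quat a b)ˣ) : Quat a b) ∈ O := by
  induction l with
  | nil => simp
  | cons x l ih =>
    rw [List.map_cons, List.prod_cons, Units.val_mul]
    refine O.mul_mem ?_ (ih fun y hy => hl y (List.mem_cons_of_mem _ hy))
    rcases Int.emod_two_eq_zero_or_one (e x) with h | h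
    · rw [h, zpow_zero, Units.val_one]
      exact O.one_mem
    · rw [h, zpow_one]
      exact hl x List.mem_cons_self

/-- The invariant at the head of the `for` loop. -/
structure LoopInvariant (S : GReductionStructure O B) (I : Submodule (𝓞 F) (Quat a b))
    (𝔞 : (FractionalIdeal (𝓞 F)⁰ F)ˣ) (J : Submodule (𝓞 F) (Quat a b)) (c : (Quat a b)ˣ) (f : Fˣ)
    (𝔄 : Submodule (𝓞 F) (Quat a b)) (T : Set (SplitPrime a b B)) : Prop where
  isRightIdeal : IsRightIdeal O J
  isIntegral : IsIntegral O J
  isTwoSidedIdeal : IsTwoSidedIdeal O 𝔄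
  eq : lmul ((c * scalarUnit a b f : (Quat a b)ˣ) : Quat a b) I = J * 𝔄
  nrd_eq : toPrincipalIdeal (𝓞 F) F (nrdU (c * scalarUnit a b f)) * 𝔞 = S.φ (rayClass a b 𝔞)
  todo : ∀ p ∈ T, IsPrimitiveAt O p.1 J ∧ 1 ≤ vnrd p.1 J
  treated : ∀ p : SplitPrime a b B, p ∉ T → vnrd p.1 J ≤ 1
  other : ∀ p : HeightOneSpectrum (𝓞 F), ¬ (p ∈ B ∧ SplitsAt a b p) → vnrd p J = 0

variable {S : GReductionStructure O B} {𝔞 : (FractionalIdeal (𝓞 F)⁰ F)ˣ}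

/-- The ideals `𝔞` and `φ` of its class have the same image under the isomorphism, so their quotient
is a product of norms of relations. -/
theorem exists_prelude (h𝔞 : (𝔞 : FractionalIdeal (𝓞 F)⁰ F) = nrdIdeal I)
    (hs : 𝔞 ∈ smoothGroup B) : ∃ t, GStep S (.start I) t := by
  obtain ⟨ψ, hψ, hφ⟩ := S.φ_lift
  have h1 := (hψ ⟨𝔞, hs⟩).symm.trans (hφ (rayClass a b 𝔞)).symm
  have h2 : ((S.φ (rayClass a b 𝔞) : smoothGroup B) : (FractionalIdeal (𝓞 F)⁰ F)ˣ) * 𝔞⁻¹ ∈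
      nrdGroup S.X := by
    rw [mul_comm]
    exact Subgroup.mem_subgroupOf.1 (QuotientGroup.eq.1 h1)
  obtain ⟨e, he⟩ := exists_exponents S.X h2
  exact ⟨_, .prelude I 𝔞 S.X.toList e _ _ _ _ h𝔞 ⟨S.X.nodup_toList, fun x => Finset.mem_toList⟩
    (by rw [he, inv_mul_cancel_right]) rfl rfl rfl rfl⟩

theorem loopInvariant_of_prelude (ha : a ≠ 0) (hb : b ≠ 0) (hO : IsMaximalOrder O)
    (hI : IsRightIdeal O I) (hint : IsIntegral O I)
    (h𝔞 : (𝔞 : FractionalIdeal (𝓞 F)⁰ F) = nrdIdeal I) (hs : 𝔞 ∈ smoothGroup B)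
    {l : List (Quat a b)ˣ} {e : (Quat a b)ˣ → ℤ} (hl : ∀ x, x ∈ l ↔ x ∈ S.X)
    (he : toPrincipalIdeal (𝓞 F) F (nrdU (l.map fun x => x ^ e x).prod) * 𝔞 =
      S.φ (rayClass a b 𝔞)) {c : (Quat a b)ˣ} {f : Fˣ}
    (hc : c = (l.map fun x => x ^ (e x % 2)).prod)
    (hf : f = (l.map fun x => nrdU x ^ (e x / 2)).prod) :
    LoopInvariant S I 𝔞 (primitivePart O (lmul (c : Quat a b) I)) c f
      (lmul (algebraMap F (Quat a b) f) (twoSidedClosure O (lmul (c : Quat a b) I)))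
      {p | nrdIdeal (primitivePart O (lmul (c : Quat a b) I)) ≤ primeIdeal p.1} := by
  have hcO : (c : Quat a b) ∈ O := by
    rw [hc]
    exact prod_mod_two_mem l (fun x hx => S.X_mem x ((hl x).1 hx)) e
  have hJ := isRightIdeal_lmul hO hI c
  have hJint : IsIntegral O (lmul (c : Quat a b) I) := by
    rintro _ ⟨z, hz, rfl⟩
    exact O.mul_mem hcO (hint hz)
  have h2 := isTwoSidedIdeal_twoSidedClosure hO hJ.1
  have hP := isRightIdeal_primitivePart hO hJ.1
  have hPint := isIntegral_primitivePart hO hJ.1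
  have hlattice := isLattice_lmul h2.1.1 (scalarUnit a b f)
  refine ⟨hP, hPint, ?_, ?_, ?_, ?_, ?_, ?_⟩
  · refine isTwoSidedIdeal_of_le hO hlattice ?_ ?_
    · rw [le_leftOrder_iff, mul_lmul_algebraMap]
      exact Submodule.map_mono (le_leftOrder_iff.1 h2.2.ge)
    · rw [le_rightOrder_iff, lmul_mul_eq]
      exact Submodule.map_mono (le_rightOrder_iff.1 h2.1.2.ge)
  · rw [mul_lmul_algebraMap, primitivePart_mul ha hb hO hJ, ← lmul_mul, Units.val_mul]
    exact congrArg (fun z => lmul z I) (Algebra.commutes (f : F) (c : Quat a b)).symm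
  · rw [hc, hf, nrdU_prod_mod_two, he]
  · intro p hp
    exact ⟨isPrimitiveAt_primitivePart ha hb hO hJ p.1,
      (nrdIdeal_le_asIdeal_iff hO.1 hP.1 hPint).1 hp⟩
  · intro p hp
    by_contra! hlt
    exact hp ((nrdIdeal_le_asIdeal_iff hO.1 hP.1 hPint).2 hlt.le)
  · intro p hp
    by_cases hsp : SplitsAt a b p
    swap
    · exact vnrd_primitivePart_of_not_splitsAt ha hb hO hJ hsp
    have hpB : p ∉ B := fun h => hp ⟨h, hsp⟩
    refine le_antisymm ?_ (vnrd_nonneg hO.1 hP.1 hPint)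
    obtain ⟨y, hyJ, hy⟩ := exists_isLocGen ha hb hO hJ p
    -- The primitive part contains `c I`. Outside the factor base the norms of `c` and of `I` are
    -- trivial at `p`, hence so is that of the larger integral ideal.
    refine vnrd_le hP.1 (le_loc (le_primitivePart hJint hyJ)) ?_
    rw [hy.valuation_nrd hO.1 hJ.1, vnrd_lmul ha hb hO hI]
    have h3 : p.valuation F (nrd (c : Quat a b)) = WithZero.exp (-0 : ℤ) := by
      have h4 := valuation_eq_exp_count_toPrincipalIdeal (p := p) (nrdU c)
      rw [hc, count_eq_zero_of_mem_smoothGroup hpB (S.X_smooth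
        (toPrincipalIdeal_nrdU_mem_nrdGroup l (fun x hx => (hl x).1 hx) _)), ← hc] at h4
      exact h4
    have h5 : vnrd p I = 0 := by
      rw [vnrd, ← h𝔞]
      exact count_eq_zero_of_mem_smoothGroup hpB hs
    rw [h3, h5, ← WithZero.exp_add]
    rfl

theorem loopInvariant_of_leave (ha : a ≠ 0) (hb : b ≠ 0) (hO : IsMaximalOrder O)
    {c : (Quat a b)ˣ} {f : Fˣ} {T : Set (SplitPrime a b B)} {p : SplitPrime a b B}
    (h : LoopInvariant S I 𝔞 J c f 𝔄 (insert p T)) (hp : p ∉ T) {s : PState a b p.1}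
    (hs : PInvariant (S.pred p.1 p.2.1 p.2.2) J s) (hk : s.k < 2) :
    LoopInvariant S I 𝔞 s.J (s.c * c) f (scale (primeIdeal p.1 ^ s.r) 𝔄) T := by
  have hne := zpow_ne_zero s.r (primeIdeal_ne_zero (p := p.1))
  have hsub : ∀ {q : SplitPrime a b B}, q ≠ p → q.1 ≠ p.1 := fun hq h => hq (Subtype.ext h)
  refine ⟨hs.isRightIdeal, hs.isIntegral, isTwoSidedIdeal_scale hO h.isTwoSidedIdeal hne,
    ?_, ?_, ?_, ?_, ?_⟩
  · rw [mul_assoc, Units.val_mul, lmul_mul, h.eq, ← lmul_mul_eq, hs.eq, scale_mul_eq, mul_scale_eq]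
  · rw [mul_assoc, map_mul, map_mul, hs.nrd_c, one_mul, h.nrd_eq]
  · intro q hq
    have hqp : q.1 ≠ p.1 := hsub fun h => hp (h ▸ hq)
    obtain ⟨h1, h2⟩ := h.todo q (Set.mem_insert_of_mem _ hq)
    exact ⟨hs.isPrimitiveAt_of_ne hqp h1, by rwa [hs.vnrd_of_ne ha hb hO h.isRightIdeal hqp]⟩
  · intro q hq
    rcases eq_or_ne q p with rfl | hqp
    · rw [hs.k_eq hO]
      omega
    · rw [hs.vnrd_of_ne ha hb hO h.isRightIdeal (hsub hqp)]
      exact h.treated q fun hmem => (Set.mem_insert_iff.1 hmem).elim hqp hq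
  · intro q hq
    have hqp : q ≠ p.1 := by
      rintro rfl
      exact hq p.2
    rw [hs.vnrd_of_ne ha hb hO h.isRightIdeal hqp]
    exact h.other q hq

/-- A local generator lies in `O` and has unit norm, so it is a local unit and `1` lies in `J` at
every prime. -/
theorem eq_self_of_forall_vnrd_eq_zero (ha : a ≠ 0) (hb : b ≠ 0) (hO : IsMaximalOrder O)
    (hJ : IsRightIdeal O J) (hint : IsIntegral O J) (h : ∀ p, vnrd p J = 0) :
    J = Subalgebra.toSubmodule O := by
  refine le_antisymm hint fun o ho => ?_
  have h1 : (1 : Quat a b) ∈ J := by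
    refine mem_of_forall_mem_loc fun p => ?_
    obtain ⟨y, hyJ, hy⟩ := exists_isLocGen ha hb hO hJ p
    have hv := hy.valuation_nrd hO.1 hJ.1
    rw [h, neg_zero, WithZero.exp_zero] at hv
    have := hy.mul_mem_loc hJ (inv_mem_ordLoc hO.1 (le_loc (hint hyJ)) hv)
    rwa [Units.mul_inv] at this
  have := hJ.mul_mem h1 ho
  rwa [one_mul] at this

theorem lmul_self_of_isUnitOf {z : (Quat a b)ˣ} (hz : IsUnitOf O z) :
    lmul (z : Quat a b) (Subalgebra.toSubmodule O) = Subalgebra.toSubmodule O := by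
  apply le_antisymm
  · rintro _ ⟨o, ho, rfl⟩
    exact O.mul_mem hz.1 ho
  · intro o ho
    exact mem_lmul.2 (O.mul_mem hz.2 ho)

theorem LoopInvariant.gSpec {c : (Quat a b)ˣ} {f : Fˣ}
    (h : LoopInvariant S I 𝔞 J c f 𝔄 ∅) (ha : a ≠ 0) (hb : b ≠ 0) (hO : IsMaximalOrder O)
    (h𝔞 : (𝔞 : FractionalIdeal (𝓞 F)⁰ F) = nrdIdeal I) :
    GSpec O I J (c * scalarUnit a b f) 𝔄 := by
  have heq := h.eq
  have hnrd := h.nrd_eq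
  generalize c * scalarUnit a b f = d at heq hnrd ⊢
  refine ⟨h.isRightIdeal, h.isIntegral, h.isTwoSidedIdeal, heq, ?_, ?_⟩
  · rintro ⟨x, rfl⟩
    have h𝔞x : 𝔞 = toPrincipalIdeal (𝓞 F) F (nrdU x) :=
      Units.ext (h𝔞.trans (nrdIdeal_lmul_self hO.1 x))
    -- The norm of a generator is positive at the ramified real places, so the class is trivial.
    -- With `φ 1 = 1` this makes `z = d x` an element whose norm generates the unit ideal.
    have hray : rayClass a b 𝔞 = 1 := by
      rw [rayClass, QuotientGroup.mk'_apply, QuotientGroup.eq_one_iff, h𝔞x]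
      exact Subgroup.mem_map_of_mem _ (nrdU_mem_positiveUnits ha hb x)
    rw [hray, S.φ_one, h𝔞x, ← map_mul, ← map_mul, OneMemClass.coe_one] at hnrd
    rw [← lmul_mul, ← Units.val_mul] at heq
    generalize d * x = z at heq hnrd
    have hzv : ∀ p : HeightOneSpectrum (𝓞 F), p.valuation F (nrd (z : Quat a b)) = 1 := by
      intro p
      have h4 := valuation_eq_exp_count_toPrincipalIdeal (p := p) (nrdU z)
      rw [hnrd, Units.val_one, FractionalIdeal.count_one, neg_zero, WithZero.exp_zero] at h4
      exact h4
    have hvnrd : ∀ p, vnrd p J = 0 := by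
      intro p
      by_cases hp : p ∈ B ∧ SplitsAt a b p
      swap
      · exact h.other p hp
      have hle := h.treated ⟨p, hp⟩ (Set.notMem_empty _)
      have hge := vnrd_nonneg (p := p) hO.1 h.isRightIdeal.1 h.isIntegral
      obtain ⟨y, -, hy⟩ := exists_isLocGen ha hb hO h.isRightIdeal p
      obtain ⟨w, -, hw⟩ := exists_isLocGen ha hb hO h.isTwoSidedIdeal.1 p
      have hlat := isLattice_mul h.isRightIdeal.1 h.isTwoSidedIdeal.1.1
      have h1 := (hy.mul hw h.isTwoSidedIdeal).valuation_nrd hO.1 hlat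
      have h2 := ((isLocGen_one (O := O) (p := p)).lmul z).valuation_nrd hO.1
        (isLattice_lmul hO.1 z)
      rw [heq, ← h1, mul_one, hzv, Units.val_mul, map_mul, map_mul,
        hy.valuation_nrd hO.1 h.isRightIdeal.1] at h2
      have hwv := hw.valuation_nrd hO.1 h.isTwoSidedIdeal.1.1
      -- The valuations of the norms of `J` and `𝔄` add up to `0`. The second is even and the first
      -- is `0` or `1`, so both vanish.
      have heven := even_of_conj ha hb hO hp.2
        (fun o ho => hw.conj_mem h.isTwoSidedIdeal ho) hwv
      rw [hwv, ← WithZero.exp_add, ← WithZero.exp_zero, WithZero.exp_inj] at h2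
      obtain ⟨m, hm⟩ := heven
      change vnrd p J ≤ 1 at hle
      omega
    have hJ := eq_self_of_forall_vnrd_eq_zero ha hb hO h.isRightIdeal h.isIntegral hvnrd
    refine ⟨hJ, ?_⟩
    have hO𝔄 : Subalgebra.toSubmodule O * 𝔄 = 𝔄 := by
      refine le_antisymm (le_leftOrder_iff.1 h.isTwoSidedIdeal.2.ge) fun x hx => ?_
      have := Submodule.mul_mem_mul (one_mem_toSubmodule (O := O)) hx
      rwa [one_mul] at this
    rw [hJ, hO𝔄] at heq
    -- Now `𝔄 = z O` is two-sided, so `z` normalizes the local order, and its norm is a unit at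
    -- every prime.
    have hzO : ∀ p, (z : Quat a b) ∈ ordLoc p O := by
      intro p
      have hgen := (isLocGen_one (O := O) (p := p)).lmul z
      rw [heq, mul_one] at hgen
      exact mem_ordLoc_of_conj ha hb hO (fun o ho => hgen.conj_mem h.isTwoSidedIdeal ho) (hzv p)
    rw [← heq]
    exact lmul_self_of_isUnitOf ⟨mem_of_forall_mem_loc hzO,
      mem_of_forall_mem_loc fun p => inv_mem_ordLoc hO.1 (hzO p) (hzv p)⟩
  · rintro ⟨rfl, rfl⟩
    refine ⟨d⁻¹, ?_⟩
    rw [toSubmodule_mul_self] at heq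
    rw [← heq, ← lmul_mul, Units.inv_mul, lmul_one]

end GReduce

/-! ### Global invariant, progress and termination. -/

section Correctness

variable {O : Subalgebra (𝓞 F) (Quat a b)} {B : Finset (HeightOneSpectrum (𝓞 F))}
  {I : Submodule (𝓞 F) (Quat a b)} {S : GReductionStructure O B}
  {𝔞 : (FractionalIdeal (𝓞 F)⁰ F)ˣ}

/-- The invariant of `GReduce` on the input `I`. -/
def GInvariant (S : GReductionStructure O B) (I : Submodule (𝓞 F) (Quat a b))
    (𝔞 : (FractionalIdeal (𝓞 F)⁰ F)ˣ) : GState a b B → Prop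
  | .start I' => I' = I
  | .loop J c f 𝔄 T => LoopInvariant S I 𝔞 J c f 𝔄 T
  | .inner c f 𝔄 T p s => p ∉ T ∧ 1 ≤ s.k - (s.i : ℕ) ∧
      ∃ J, LoopInvariant S I 𝔞 J c f 𝔄 (insert p T) ∧
        PInvariant (S.pred p.1 p.2.1 p.2.2) J s
  | .done J c 𝔄 => ∃ c' f, c = c' * scalarUnit a b f ∧ LoopInvariant S I 𝔞 J c' f 𝔄 ∅

theorem GInvariant.step (ha : a ≠ 0) (hb : b ≠ 0) (hO : IsMaximalOrder O)
    (hI : IsRightIdeal O I) (hint : IsIntegral O I)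
    (h𝔞 : (𝔞 : FractionalIdeal (𝓞 F)⁰ F) = nrdIdeal I) (hs : 𝔞 ∈ smoothGroup B)
    {t t' : GState a b B} (h : GInvariant S I 𝔞 t) (ht : GStep S t t') :
    GInvariant S I 𝔞 t' := by
  cases ht with
  | prelude I' 𝔞' l e c f 𝔄 J h𝔞' hl he hc hf h𝔄 hJ =>
    obtain rfl : I' = I := h
    obtain rfl : 𝔞' = 𝔞 := Units.ext (h𝔞'.trans h𝔞.symm)
    subst h𝔄 hJ
    exact loopInvariant_of_prelude ha hb hO hI hint h𝔞 hs hl.2 he hc hf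
  | call J c f 𝔄 T p s hp hs =>
    replace h : LoopInvariant S I 𝔞 J c f 𝔄 T := h
    obtain ⟨h1, h2⟩ := h.todo p hp
    obtain ⟨h3, h4, h5⟩ := pInvariant_of_pInit ha hb hO h.isRightIdeal h.isIntegral h1 hs
    refine ⟨fun h => h.2 rfl, ?_, J, ?_, h3⟩
    · rw [h4, h5]
      simpa using h2
    · rwa [Set.insert_sdiff_singleton, Set.insert_eq_of_mem hp]
  | again c f 𝔄 T p s s' hs hk =>
    obtain ⟨h1, -, J, h3, h4⟩ := h
    refine ⟨h1, ?_, J, h3, pInvariant_of_pBody ha hb hO h4 hs⟩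
    -- The loop continues only with `k ≥ 2`, and `i ≤ 1`. The remaining distance `k - i` is
    -- positive, so the next body has a segment to follow.
    have := s'.i.isLt
    omega
  | leave c f 𝔄 T p s s' hs hk =>
    obtain ⟨h1, -, J, h3, h4⟩ := h
    exact loopInvariant_of_leave ha hb hO h3 h1 (pInvariant_of_pBody ha hb hO h4 hs) hk
  | finish J c f 𝔄 => exact ⟨c, f, rfl, h⟩

theorem GInvariant.progress (ha : a ≠ 0) (hb : b ≠ 0) (hO : IsMaximalOrder O)
    (h𝔞 : (𝔞 : FractionalIdeal (𝓞 F)⁰ F) = nrdIdeal I) (hs : 𝔞 ∈ smoothGroup B)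
    {t : GState a b B} (h : GInvariant S I 𝔞 t) :
    (∃ J c 𝔄, t = .done J c 𝔄) ∨ ∃ t', GStep S t t' := by
  cases t with
  | start I' =>
    obtain rfl : I' = I := h
    exact Or.inr (exists_prelude h𝔞 hs)
  | loop J c f 𝔄 T =>
    replace h : LoopInvariant S I 𝔞 J c f 𝔄 T := h
    right
    rcases T.eq_empty_or_nonempty with rfl | ⟨p, hp⟩
    · exact ⟨_, .finish J c f 𝔄⟩
    · obtain ⟨s, hs⟩ := exists_pInit ha hb hO (S.pred p.1 p.2.1 p.2.2) h.isRightIdeal h.isIntegral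
        (h.todo p hp).1
      exact ⟨_, .call J c f 𝔄 T p s hp hs⟩
  | inner c f 𝔄 T p s =>
    obtain ⟨-, h2, J, -, h4⟩ := h
    obtain ⟨s', hs'⟩ := exists_pBody h4 h2
    by_cases hk : s'.k < 2
    · exact Or.inr ⟨_, .leave c f 𝔄 T p s s' hs' hk⟩
    · exact Or.inr ⟨_, .again c f 𝔄 T p s s' hs' hk⟩
  | done J c 𝔄 => exact Or.inl ⟨J, c, 𝔄, rfl⟩

/-- A quantity that decreases with every step of `GReduce`. -/
def GState.rank (S : GReductionStructure O B) : GState a b B → ℕ ×ₗ ℕ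
  | .start _ => toLex (2 * Nat.card (SplitPrime a b B) + 2, 0)
  | .loop _ _ _ _ T => toLex (2 * T.ncard + 1, 0)
  | .inner _ _ _ T p s =>
    toLex (2 * T.ncard + 2, ((S.pred p.1 p.2.1 p.2.2).vert s.i).dist s.Q)
  | .done _ _ _ => toLex (0, 0)

theorem GStep.rank_lt {t t' : GState a b B} (h : GStep S t t') : t'.rank S < t.rank S := by
  have hfin : Finite (SplitPrime a b B) :=
    Finite.of_injective (fun p : SplitPrime a b B => (⟨p.1, p.2.1⟩ : B)) fun p q h =>
      Subtype.ext (Subtype.mk.inj h)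
  cases h with
  | prelude =>
    refine Prod.Lex.toLex_lt_toLex.2 (Or.inl ?_)
    have := fun T : Set (SplitPrime a b B) => Set.ncard_le_card T
    exact add_lt_add_of_le_of_lt (Nat.mul_le_mul_left 2 (this _)) (by norm_num)
  | call J c f 𝔄 T p s hp hs =>
    refine Prod.Lex.toLex_lt_toLex.2 (Or.inl ?_)
    -- With `t` primes left the first component is `2 t + 1` at the loop head, `2 t` during the call
    -- and `2 t - 1` on return. Inside the call the distance decreases.
    have := Set.ncard_sdiff_singleton_add_one hp (Set.toFinite T)
    simp only
    omega
  | again c f 𝔄 T p s s' hs hk =>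
    refine Prod.Lex.toLex_lt_toLex.2 (Or.inr ⟨rfl, ?_⟩)
    have := dist_of_pBody hs
    simp only
    omega
  | leave => exact Prod.Lex.toLex_lt_toLex.2 (Or.inl (by simp))
  | finish => exact Prod.Lex.toLex_lt_toLex.2 (Or.inl (by simp))

end Correctness

end QuatIdeal

end

open QuatIdeal in
/-- Total correctness of `GReduce`: every execution is finite, no execution gets stuck before it
returns, and whatever is returned meets the specification. -/
theorem mainTheorem3 {F : Type*} [Field F] [NumberField F] (a b : F) (ha : a ≠ 0) (hb : b ≠ 0)
    (hE : EichlerCondition a b) (O : Subalgebra (𝓞 F) (Quat a b)) (hO : IsMaximalOrder O)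
    (B : Finset (HeightOneSpectrum (𝓞 F))) (hB : IsFactorBase a b B)
    (S : GReductionStructure O B)
    (I : Submodule (𝓞 F) (Quat a b)) (hI : IsRightIdeal O I) (hint : IsIntegral O I)
    (hsm : IsSmooth B I) :
    (¬ ∃ u : ℕ → GState a b B, u 0 = .start I ∧ ∀ n, GStep S (u n) (u (n + 1))) ∧
    (∀ t, Relation.ReflTransGen (GStep S) (.start I) t →
      (∃ J c 𝔄, t = .done J c 𝔄) ∨ ∃ t', GStep S t t') ∧
    (∀ J c 𝔄, Relation.ReflTransGen (GStep S) (.start I) (.done J c 𝔄) → GSpec O I J c 𝔄) := by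
  obtain ⟨𝔞, hs, h𝔞⟩ := hsm
  have hinv : ∀ t, Relation.ReflTransGen (GStep S) (.start I) t → GInvariant S I 𝔞 t := by
    intro t ht
    induction ht with
    | refl => exact rfl
    | tail _ hstep ih => exact ih.step ha hb hO hI hint h𝔞 hs hstep
  refine ⟨?_, fun t ht => (hinv t ht).progress ha hb hO h𝔞 hs, fun J c 𝔄 ht => ?_⟩
  · rintro ⟨u, -, hu⟩
    obtain ⟨n, hn⟩ := WellFounded.not_rel_apply_succ (r := (· < ·)) fun n => (u n).rank S
    exact hn (hu n).rank_lt
  · obtain ⟨c', f, rfl, h⟩ := hinv _ ht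
    exact h.gSpec ha hb hO h𝔞
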